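/- Let $K$ be a pretzel knot (or link) with three negative twist regions: three vertical columns of $p_1,p_2,p_3\ge 1$ negative half-twists, adjacent columns (cyclically) being joined by arcs at the top and at the bottom. A negative half-twist is a crossing of two vertical strands whose Kauffman resolution is $A^{-1}\,\langle\,)(\,\rangle + A\,\langle\asymp\rangle$, i.e. the vertical smoothing is the $B$-smoothing. Let $n$ be the number of $i$ with $p_i=2$ and $m$ the number of $i$ with $p_i\ge 3$. Let $q=A^{-4}$, $[k]=\frac{A^{2k}-A^{-2k}}{A^2-A^{-2}}$, and let $J_{N+1,K}$ be the colored Jones polynomial of $K$, obtained from the Kauffman bracket by coloring every component with the $N$-th Jones–Wenzl idempotent and correcting the framing. Let $J'_{N+1,K}=J_{N+1,K}\big/\big((-1)^N[N+1]\big)$ be its normalization with value $1$ on the unknot. Then for all $N\ge 0$ there is a power series $P_N(q^{-1})$ with positive constant term such that $J'_{N+1,K}=\pm A^{s_N}P_N(q^{-1})$ for some $s_N\in\mathbb Z$; thus $P_N$ lists the coefficients of $J'_{N+1,K}$ from the highest power of $q$ downwards, up to a common sign. Moreover there are power series $H_K, H_{1,K}, H_{2,K}$ in $q^{-1}$ (the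 head, the 1-head and the 2-head), which are then unique, such that for all $N\ge 0$: * the first $N+1$ coefficients of $P_N$ agree with those of $H_K$; * the coefficients of $q^{-(N+1)-k}$, $0\le k<N$, in $P_N-H_K$ are the coefficients of $q^{-k}$ in $H_{1,K}$; * the coefficients of $q^{-(2N+1)-k}$, $0\le k<N$, in $P_N-H_K-q^{-(N+1)}H_{1,K}$ are the coefficients of $q^{-k}$ in $H_{2,K}$; and the 2-head is $$H_{2,K}(q)=\prod_{i=1}^{\infty}(1-q^{-i})\left(q^{-1}+\frac{n}{1-q^{-1}}-\frac{f_{n,m}(q)}{(1-q^{-1})(1-q^{-2})}\right),$$ where $$f_{n,m}(q)=\begin{cases}0 & \text{if } n+m=0,\\ 1-3q^{-1}-q^{-2}+2q^{-3} & \text{if } n+m=1,\\ 2-6q^{-1}-3q^{-2}+3q^{-3} & \text{if } n+m=2,\\ 3-9q^{-1}-6q^{-2}+3q^{-3} & \text{if } n+m=3.\end{cases}$$ -/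

import Mathlib

noncomputable section

namespace PretzelHead

/-! ### Coefficients -/

/-- The coefficient field: formal Laurent series in the Kauffman variable `A`. All the invariants
below are rational functions of `A`; they are kept as their expansions at `A = 0`, that is, at
`q = A⁻⁴ = ∞`, because the highest coefficients in `q` are wanted. -/
abbrev Coeff : Type := LaurentSeries ℚ

/-- The Kauffman variable `A`. The variable of the colored Jones polynomial is `q = A⁻⁴`. -/
def A : Coeff := HahnSeries.single (1 : ℤ) (1 : ℚ)

/-- The quantum integer `[n] = (A^{2n} - A^{-2n}) / (A² - A⁻²)`. -/
def qInt (n : ℕ) : Coeff :=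
  (A ^ (2 * (n : ℤ)) - A ^ (-(2 * (n : ℤ)))) / (A ^ (2 : ℤ) - A ^ (-2 : ℤ))

/-- The value `Δ_n = (-1)^n [n+1]` of the unknot colored by `n`. -/
def unknotValue (n : ℕ) : Coeff := (-1) ^ n * qInt (n + 1)

/-- The value `-A² - A⁻²` of a closed loop. -/
def loopValue : Coeff := -A ^ (2 : ℤ) - A ^ (-2 : ℤ)

/-! ### Link patterns and the skein module

A crossingless tangle in the lower half plane with boundary points `0, 1, …, k - 1` on the boundary
line, read from left to right, is recorded by the function sending each boundary point to the other
end of its arc. A function `ℕ → ℕ` is used for every `k`, being the identity from `k` on, so that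
the empty tangle is `id`. -/

/-- The partner function of a crossingless tangle. -/
abbrev Pattern : Type := ℕ → ℕ

/-- Renumbering of the points when two new points `i`, `i + 1` are inserted. -/
def skip (i k : ℕ) : ℕ := if k < i then k else k + 2

/-- Renumbering of the other points when the points `i`, `i + 1` are removed. -/
def unskip (i k : ℕ) : ℕ := if k < i then k else k - 2

/-- Add a new arc whose ends are the new points `i` and `i + 1`. -/
def insertArc (i : ℕ) (π : Pattern) : Pattern := fun j =>
  if j = i then i + 1 else if j = i + 1 then i else skip i (π (unskip i j))

/-- Join the points `i` and `i + 1` by an arc and remove them from the boundary: their former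
partners become partners of each other. (If `i` and `i + 1` were partners, a closed loop is
produced, and it is removed.) -/
def joinArc (i : ℕ) (π : Pattern) : Pattern := fun j =>
  unskip i <|
    if skip i j = π i then π (i + 1) else if skip i j = π (i + 1) then π i else π (skip i j)

/-- Formal linear combinations of crossingless tangles. -/
abbrev Skein : Type := Pattern →₀ Coeff

/-- The skein of the empty tangle. -/
def emptySkein : Skein := Finsupp.single id 1

/-- Glue on a local minimum (cup) with ends `i`, `i + 1`. -/
def cupOp (i : ℕ) : Module.End Coeff Skein :=
  Finsupp.linearCombination Coeff fun π => Finsupp.single (insertArc i π) (1 : Coeff)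

/-- Glue a local maximum (cap) to the points `i`, `i + 1`; a closed loop that arises is replaced
by the factor `-A² - A⁻²`. -/
def capOp (i : ℕ) : Module.End Coeff Skein :=
  Finsupp.linearCombination Coeff fun π =>
    Finsupp.single (joinArc i π) (if π i = i + 1 then loopValue else 1)

/-- Glue the Temperley–Lieb generator (a cap below a cup) to the points `i`, `i + 1`. -/
def tlOp (i : ℕ) : Module.End Coeff Skein := cupOp i * capOp i

/-- The handedness of a crossing between two vertical strands, i.e. of a half-twist. -/
inductive HalfTwist
  | negative
  | positive

/-- Glue a half-twist of the strands `i`, `i + 1`, resolved by the Kauffman relation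
`⟨crossing⟩ = A ⟨A-smoothing⟩ + A⁻¹ ⟨B-smoothing⟩`. For a negative half-twist the two vertical
strands form the `B`-smoothing and cap-cup the `A`-smoothing; for a positive one conversely. -/
def crossOp (i : ℕ) : HalfTwist → Module.End Coeff Skein
  | .negative => A⁻¹ • 1 + A • tlOp i
  | .positive => A • 1 + A⁻¹ • tlOp i

/-! ### Link diagrams and their colored brackets -/

/-- The elementary pieces of a link diagram in general position with respect to the height
function. -/
inductive Slice
  /-- a local minimum, creating the strands `i` and `i + 1` -/
  | cup (i : ℕ)
  /-- a local maximum, ending the strands `i` and `i + 1` -/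
  | cap (i : ℕ)
  /-- a crossing of the strands `i` and `i + 1` -/
  | cross (i : ℕ) (t : HalfTwist)

/-- An (unoriented, blackboard framed) link diagram in the plane, cut into horizontal slices which
are listed from bottom to top. -/
abbrev Diagram : Type := List Slice

/-- The Jones–Wenzl idempotent on the `n` points `b, b + 1, …, b + n - 1`, defined by Wenzl's
recursion `f_{k+1} = f_k - (Δ_{k-1} / Δ_k) f_k U_k f_k`, where `-Δ_{k-1} / Δ_k = [k] / [k+1]`. -/
def jonesWenzl (b : ℕ) : ℕ → Module.End Coeff Skein
  | 0 => 1
  | 1 => 1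
  | n + 2 =>
    jonesWenzl b (n + 1) + (qInt (n + 1) / qInt (n + 2)) •
      (jonesWenzl b (n + 1) * tlOp (b + n) * jonesWenzl b (n + 1))

/-- The `N`-strand cable of a slice, decorated with Jones–Wenzl idempotents: strand `i` of the
diagram becomes the `N` parallel points `N * i, …, N * i + N - 1`. A cup becomes `N` nested cups,
with an idempotent on its left leg; so every component of a diagram carries an idempotent. A cap
becomes `N` nested caps. A crossing becomes `N * N` crossings of the same kind. In a product of
operators the rightmost one is applied first. -/
def coloredSlice (N : ℕ) : Slice → Module.End Coeff Skein
  | .cup i =>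
    jonesWenzl (N * i) N * ((List.range N).map fun k => cupOp (N * i + (N - 1 - k))).prod
  | .cap i => ((List.range N).map fun k => capOp (N * i + k)).prod
  | .cross i t =>
    ((List.range N).map fun r =>
      ((List.range N).map fun s => crossOp (N * i + r + (N - 1 - s)) t).prod).prod

/-- The Kauffman bracket of the link diagram `D` with every component colored by the `N`-th
Jones–Wenzl idempotent: the coefficient of the empty tangle after all slices are glued on. -/
def coloredBracket (N : ℕ) (D : Diagram) : Coeff :=
  (D.foldl (fun v s => coloredSlice N s v) emptySkein) id

/-- The `(N+1)`-st colored Jones polynomial `J_{N+1}` of the oriented link with diagram `D` and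
writhe `w`: every component is colored by the `(N+1)`-dimensional irreducible representation of
`𝔰𝔩₂`, i.e. by the `N`-th Jones–Wenzl idempotent, and the framing is corrected by the factor
`((-1)^N A^{N² + 2N})^{-w}`. -/
def coloredJones (N : ℕ) (D : Diagram) (w : ℤ) : Coeff :=
  ((-1) ^ N * A ^ (N ^ 2 + 2 * N)) ^ (-w) * coloredBracket N D

/-- The normalized colored Jones polynomial `J'_{N+1}`, equal to `1` for the unknot. -/
def normalizedColoredJones (N : ℕ) (D : Diagram) (w : ℤ) : Coeff :=
  coloredJones N D w / unknotValue N

/-- The standard diagram of the pretzel link with three vertical columns of `p 0`, `p 1` and `p 2`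
negative half-twists. The columns consist of the strands `0, 1`, of the strands `2, 3` and of the
strands `4, 5`; adjacent columns are joined at the bottom and at the top by the arcs `1—2`, `3—4`
and the outer arc `0—5`. -/
def pretzel (p : Fin 3 → ℕ) : Diagram :=
  [.cup 0, .cup 1, .cup 3]
    ++ List.replicate (p 0) (.cross 0 .negative)
    ++ List.replicate (p 1) (.cross 2 .negative)
    ++ List.replicate (p 2) (.cross 4 .negative)
    ++ [.cap 3, .cap 1, .cap 0]

/-! ### Stability of the highest coefficients

The variable `X` of the power series below stands for `q⁻¹ = A⁴`. -/

open PowerSeries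

/-- `L = ± A^s P(q⁻¹)` for some integer `s`, where `P` has positive constant coefficient: the
coefficients of `P` are the coefficients of `L` from the highest power of `q` downwards, the common
sign being chosen so that the first of them is positive. -/
def IsTopExpansion (L : Coeff) (P : ℚ⟦X⟧) : Prop :=
  0 < coeff 0 P ∧ ∃ (s : ℤ) (ε : ℤˣ),
    (∀ k : ℕ, L.coeff (s + 4 * k) = ((ε : ℤ) : ℚ) * coeff k P) ∧
    ∀ j : ℤ, (∀ k : ℕ, j ≠ s + 4 * k) → L.coeff j = 0

/-- `H` is the head: for all `N` the first `N + 1` coefficients of the `N`-th series are those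
of `H`. Here `P N` belongs to the `(N+1)`-st colored Jones polynomial. -/
def IsHead (P : ℕ → ℚ⟦X⟧) (H : ℚ⟦X⟧) : Prop :=
  ∀ N k : ℕ, k < N + 1 → coeff k (P N) = coeff k H

/-- `H₁` is the 1-head: when the head is subtracted, the `N` coefficients that follow the first
`N + 1` ones are the first `N` coefficients of `H₁`. -/
def IsOneHead (P : ℕ → ℚ⟦X⟧) (H H₁ : ℚ⟦X⟧) : Prop :=
  ∀ N k : ℕ, k < N → coeff (N + 1 + k) (P N - H) = coeff k H₁

/-- `H₂` is the 2-head: when the head and the 1-head, shifted by `q^{-(N+1)}`, are subtracted, the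
`N` coefficients that follow the first `2N + 1` ones are the first `N` coefficients of `H₂`. -/
def IsTwoHead (P : ℕ → ℚ⟦X⟧) (H H₁ H₂ : ℚ⟦X⟧) : Prop :=
  ∀ N k : ℕ, k < N → coeff (2 * N + 1 + k) (P N - H - X ^ (N + 1) * H₁) = coeff k H₂

/-- The sequence `J` of normalized colored Jones polynomials (`J N` being `J'_{N+1}`) has a head
and a 1-head, and its 2-head exists and equals `H₂`. The top expansions `P N`, the head, the 1-head
and the 2-head are all determined by `J`. -/
def HasTwoHead (J : ℕ → Coeff) (H₂ : ℚ⟦X⟧) : Prop :=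
  ∃ P : ℕ → ℚ⟦X⟧, (∀ N, IsTopExpansion (J N) (P N)) ∧
    ∃ H H₁ : ℚ⟦X⟧, IsHead P H ∧ IsOneHead P H H₁ ∧ IsTwoHead P H H₁ H₂

section
open scoped PowerSeries.WithPiTopology

/-- The infinite product `∏_{i ≥ 1} (1 - q^{-i})`. -/
def eulerProduct : ℚ⟦X⟧ := ∏' i : ℕ, (1 - X ^ (i + 1))

end

/-- The polynomial `f_{n,m}` in `X = q⁻¹`, as a function of `n + m`. -/
def fPoly : ℕ → ℚ⟦X⟧
  | 1 => 1 - 3 * X - X ^ 2 + 2 * X ^ 3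
  | 2 => 2 - 6 * X - 3 * X ^ 2 + 3 * X ^ 3
  | 3 => 3 - 9 * X - 6 * X ^ 2 + 3 * X ^ 3
  | _ => 0

/-- `∏_{i ≥ 1} (1 - q^{-i}) (q⁻¹ + n / (1 - q⁻¹) - f_{n,m}(q) / ((1 - q⁻¹) (1 - q⁻²)))`. -/
def twoHeadFormula (n m : ℕ) : ℚ⟦X⟧ :=
  eulerProduct *
    (X + (n : ℚ⟦X⟧) * (1 - X)⁻¹ - fPoly (n + m) * ((1 - X) * (1 - X ^ 2))⁻¹)

end PretzelHead

end

noncomputable section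

/-! ### Insertion and joining of arcs in pairings of ℕ -/

namespace PretzelHead

/-! The bracket is computed by fusion. Each column of the pretzel acts next to a product `ff` of two
adjacent `N`-strand Jones–Wenzl idempotents. Between two copies of `ff`, the tangles `h j` (`j`
nested cups above `j` nested caps) span a commutative algebra: `h 1 * h j = α j • h j + β j • h (j +
1)` with distinct `α 0, …, α N` (`h_one_mul_h`). So `h j` is a Newton polynomial in `h 1`, and
Lagrange interpolation gives orthogonal idempotents `e i` with sum `ff`. The idempotent `e i`
projects to the channel of color `2 (N - i)`, on which a half-twist is the scalar `twist N i`
(`block_mul_e`).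

A quarter turn exchanges `h j` and `h (N - j)` and turns juxtaposition of columns into
multiplication. A column of `p` half-twists is the rotation of an element with eigenvalues `spec N p
i = ∑ l, twist N l ^ p * gram N l i`, where `gram` is the change of basis between the two channels
(quantum 6j-symbols up to normalization). The closure of a rotated `e i` is `[2 (N - i) + 1]`, so
the bracket is the sum over `i` of three factors `spec` times this quantum integer (`pretzel_eq`).

Three facts about `gram` suffice. For `p = 1` the sum `spec` is explicit, because a rotated
half-twist is a half-twist (`spec_one`, by `q`-Chu–Vandermonde). The row `l = 0` is an explicit
product (`gram_zero`). Relative to a common power of `A`, row `l` is divisible by `X ^ l`, where `X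
= A⁴` (`isSeries_gram`). The exponents of the twists for `l = 0, 1, 2, …` are `0, N, 2N - 1, …`;
hence modulo `X ^ (3N + 1)` only row `0` matters for `p ≥ 3`, and for `p = 2` the row `l = 1` is
eliminated with the help of the case `p = 1`. With `i = N - k`, a column contributes `(-1) ^ k X ^
(k (k + 1) / 2) (1 + (ratio N k - 1) w)`, where `w` is `0`, `1 + X ^ N` or `1` according to `p = 1`,
`p = 2` or `p ≥ 3` (`dvd_specSeries_sub`). This is how `n` and `m` enter.

Finally `ratio N k` is expanded in powers of `X ^ (N - k)` (`exists_ratio_eq`). The sums over `k`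
that arise are partial theta sums that telescope to multiples of the pentagonal number series, that
is, of the Euler product (`sum_theta_one`, `sum_theta_two`). The outcome is one congruence modulo `X
^ (3N + 1)`, which contains the head, the 1-head and the 2-head at once (`exists_heads`). -/

theorem skip_injective (i : ℕ) : Function.Injective (skip i) := by
  intro a b h; simp only [skip] at h; split_ifs at h <;> omega

theorem skip_inj {i a b : ℕ} : skip i a = skip i b ↔ a = b := (skip_injective i).eq_iff

theorem unskip_skip (i m : ℕ) : unskip i (skip i m) = m := by
  simp only [skip, unskip]; split_ifs <;> omega

theorem skip_unskip {i m : ℕ} (h : m ≠ i) (h' : m ≠ i + 1) : skip i (unskip i m) = m := by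
  simp only [skip, unskip]; split_ifs <;> omega

theorem skip_ne (i m : ℕ) : skip i m ≠ i := by
  simp only [skip]; split_ifs <;> omega

theorem skip_ne_succ (i m : ℕ) : skip i m ≠ i + 1 := by
  simp only [skip]; split_ifs <;> omega

theorem skip_skip {i j : ℕ} (h : i ≤ j) (m : ℕ) : skip i (skip j m) = skip (j + 2) (skip i m) := by
  simp only [skip]; split_ifs <;> omega

theorem eq_or_skip (i m : ℕ) : m = i ∨ m = i + 1 ∨ ∃ k, m = skip i k := by
  by_cases h : m = i
  · exact .inl h
  · by_cases h' : m = i + 1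
    · exact .inr (.inl h')
    · exact .inr (.inr ⟨_, (skip_unskip h h').symm⟩)

theorem skip_of_lt {i m : ℕ} (h : m < i) : skip i m = m := by simp [skip, h]

theorem skip_of_le {i m : ℕ} (h : i ≤ m) : skip i m = m + 2 := by simp [skip, h]

@[simp] theorem insertArc_self (i : ℕ) (π : Pattern) : insertArc i π i = i + 1 := by
  simp [insertArc]

@[simp] theorem insertArc_succ (i : ℕ) (π : Pattern) : insertArc i π (i + 1) = i := by
  simp [insertArc]

@[simp] theorem insertArc_skip (i : ℕ) (π : Pattern) (m : ℕ) :
    insertArc i π (skip i m) = skip i (π m) := by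
  simp [insertArc, skip_ne, skip_ne_succ, unskip_skip]

/-- The partner functions of the pairings of all the points of `ℕ`. -/
structure IsMatching (π : Pattern) : Prop where
  invol : ∀ j, π (π j) = j
  ne : ∀ j, π j ≠ j

variable {π : Pattern}

/-- For a matching the new partner is never one of the removed points, so `unskip` can be undone. In
this form identities of joins become case distinctions on values of the involution. -/
theorem skip_joinArc (h : IsMatching π) (i m : ℕ) :
    skip i (joinArc i π m) = if skip i m = π i then π (i + 1) else
      if skip i m = π (i + 1) then π i else π (skip i m) := by
  have h1 := h.invol i
  have h2 := h.invol (i + 1)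
  have h3 := h.invol (skip i m)
  have h4 := h.ne i
  have h5 := h.ne (i + 1)
  have h6 := skip_ne i m
  have h7 := skip_ne_succ i m
  rw [joinArc, skip_unskip]
  · grind
  · grind

theorem IsMatching.insertArc (h : IsMatching π) (i : ℕ) : IsMatching (insertArc i π) := by
  constructor <;> intro j <;> rcases eq_or_skip i j with rfl | rfl | ⟨k, rfl⟩ <;>
    simp [h.invol, skip_inj, h.ne]

theorem IsMatching.joinArc (h : IsMatching π) (i : ℕ) : IsMatching (joinArc i π) := by
  have h1 := h.invol i
  have h2 := h.invol (i + 1)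
  have h4 := h.ne i
  have h5 := h.ne (i + 1)
  constructor <;> intro j
  · rw [← skip_inj (i := i), skip_joinArc h, skip_joinArc h]
    have h3 := h.invol (skip i j)
    have h6 := skip_ne i j
    have h7 := skip_ne_succ i j
    grind
  · rw [Ne, ← skip_inj (i := i), skip_joinArc h]
    have h3 := h.ne (skip i j)
    have h6 := skip_ne i j
    have h7 := skip_ne_succ i j
    grind

theorem insertArc_of_skip {i m m' : ℕ} (e : skip i m = m') (π : Pattern) :
    insertArc i π m' = skip i (π m) := by rw [← e, insertArc_skip]

theorem insertArc_insertArc {i j : ℕ} (hij : i ≤ j) (π : Pattern) :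
    insertArc i (insertArc j π) = insertArc (j + 2) (insertArc i π) := by
  have e1 : skip i j = j + 2 := skip_of_le hij
  have e2 : skip i (j + 1) = j + 2 + 1 := skip_of_le (by omega)
  have e3 : skip (j + 2) i = i := skip_of_lt (by omega)
  have e4 : skip (j + 2) (i + 1) = i + 1 := skip_of_lt (by omega)
  funext m
  rcases eq_or_skip i m with rfl | rfl | ⟨k, rfl⟩
  · rw [insertArc_of_skip e3, insertArc_self, insertArc_self, e4]
  · rw [insertArc_of_skip e4, insertArc_succ, insertArc_succ, e3]
  · rcases eq_or_skip j k with rfl | rfl | ⟨k, rfl⟩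
    · rw [e1, insertArc_of_skip e1, insertArc_self, insertArc_self, e2]
    · rw [e2, insertArc_of_skip e2, insertArc_succ, insertArc_succ, e1]
    · rw [insertArc_skip, insertArc_skip, skip_skip hij, skip_skip hij, insertArc_skip,
        insertArc_skip]

theorem joinArc_insertArc_self (h : IsMatching π) (i : ℕ) : joinArc i (insertArc i π) = π := by
  funext m
  rw [← skip_inj (i := i), skip_joinArc (h.insertArc i)]
  simp [skip_ne, skip_ne_succ]

theorem joinArc_succ_insertArc (h : IsMatching π) (i : ℕ) :
    joinArc (i + 1) (insertArc i π) = π := by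
  funext m
  rw [← skip_inj (i := i + 1), skip_joinArc (h.insertArc i)]
  have e2 : skip i i = i + 1 + 1 := skip_of_le le_rfl
  have e3 : insertArc i π (i + 1 + 1) = skip i (π i) := by rw [← e2, insertArc_skip]
  have h1 := h.invol i
  have h2 := h.ne i
  rw [e3, insertArc_succ]
  rcases lt_trichotomy m i with hm | rfl | hm
  · have : skip (i + 1) m = skip i m := by rw [skip_of_lt hm, skip_of_lt (by omega)]
    rw [this, if_neg (skip_ne i m), insertArc_skip]
    simp only [skip_inj]
    have h3 := h.invol m
    split_ifs with h4
    · rw [h4, h1, skip_of_lt (by omega)]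
    · have h5 : π m ≠ i := fun h5 => h4 (by rw [← h5, h3])
      simp only [skip]; split_ifs <;> omega
  · rw [skip_of_lt (by omega), if_pos rfl]
    simp only [skip]; split_ifs <;> omega
  · have : skip (i + 1) m = skip i m := by rw [skip_of_le (by omega), skip_of_le hm.le]
    rw [this, if_neg (skip_ne i m), insertArc_skip]
    simp only [skip_inj]
    have h3 := h.invol m
    split_ifs with h4
    · rw [h4, h1, skip_of_lt (by omega)]
    · have h5 : π m ≠ i := fun h5 => h4 (by rw [← h5, h3])
      simp only [skip]; split_ifs <;> omega

theorem joinArc_insertArc_succ (h : IsMatching π) (i : ℕ) :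
    joinArc i (insertArc (i + 1) π) = π := by
  funext m
  rw [← skip_inj (i := i), skip_joinArc (h.insertArc _)]
  have e2 : skip (i + 1) i = i := skip_of_lt (by omega)
  have e3 : insertArc (i + 1) π i = skip (i + 1) (π i) := insertArc_of_skip e2 π
  have h1 := h.invol i
  have h2 := h.ne i
  rw [e3, insertArc_self]
  have key : ∀ m, m ≠ i → skip i m = skip (i + 1) m := by
    intro m hm
    simp only [skip]; split_ifs <;> omega
  rcases eq_or_ne m i with rfl | hm
  · rw [skip_of_le le_rfl, if_neg, if_pos rfl]
    · exact (key _ h2).symm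
    · exact (skip_ne_succ (m + 1) (π m)).symm
  · rw [key m hm, insertArc_skip, if_neg (skip_ne_succ (i + 1) m)]
    simp only [skip_inj]
    have h3 := h.invol m
    split_ifs with h4
    · rw [h4, h1, skip_of_le le_rfl]
    · have h5 : π m ≠ i := fun h5 => h4 (by rw [← h5, h3])
      simp only [skip]; split_ifs <;> omega

theorem joinArc_insertArc_of_le {i j : ℕ} (hij : i ≤ j) (h : IsMatching π) :
    joinArc (j + 2) (insertArc i π) = insertArc i (joinArc j π) := by
  have e1 : insertArc i π (j + 2) = skip i (π j) := insertArc_of_skip (skip_of_le hij) π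
  have e2 : insertArc i π (j + 2 + 1) = skip i (π (j + 1)) :=
    insertArc_of_skip (skip_of_le (by omega)) π
  have e3 : skip (j + 2) i = i := skip_of_lt (by omega)
  have e4 : skip (j + 2) (i + 1) = i + 1 := skip_of_lt (by omega)
  funext m
  rw [← skip_inj (i := j + 2), skip_joinArc (h.insertArc _), e1, e2]
  rcases eq_or_skip i m with rfl | rfl | ⟨k, rfl⟩
  · simp [e3, e4, (skip_ne _ _).symm]
  · simp [e3, e4, (skip_ne_succ _ _).symm]
  · rw [insertArc_skip, ← skip_skip hij, insertArc_skip, ← skip_skip hij, skip_joinArc h]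
    simp only [skip_inj]
    split_ifs <;> rfl

theorem joinArc_insertArc_of_ge {i j : ℕ} (hij : i ≤ j) (h : IsMatching π) :
    joinArc i (insertArc (j + 2) π) = insertArc j (joinArc i π) := by
  have e3 : skip (j + 2) i = i := skip_of_lt (by omega)
  have e4 : skip (j + 2) (i + 1) = i + 1 := skip_of_lt (by omega)
  have e1 : insertArc (j + 2) π i = skip (j + 2) (π i) := insertArc_of_skip e3 π
  have e2 : insertArc (j + 2) π (i + 1) = skip (j + 2) (π (i + 1)) :=
    insertArc_of_skip e4 π
  have e5 : skip i j = j + 2 := skip_of_le hij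
  have e6 : skip i (j + 1) = j + 2 + 1 := skip_of_le (by omega)
  funext m
  rw [← skip_inj (i := i), skip_joinArc (h.insertArc _), e1, e2]
  rcases eq_or_skip j m with rfl | rfl | ⟨k, rfl⟩
  · simp [e5, e6, (skip_ne _ _).symm]
  · simp [e5, e6, (skip_ne_succ _ _).symm]
  · rw [insertArc_skip, skip_skip hij, insertArc_skip, skip_skip hij, skip_joinArc h]
    simp only [skip_inj]
    split_ifs <;> rfl

theorem joinArc_joinArc {i j : ℕ} (hij : i ≤ j) (h : IsMatching π) :
    joinArc i (joinArc (j + 2) π) = joinArc j (joinArc i π) := by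
  have e3 : skip (j + 2) i = i := skip_of_lt (by omega)
  have e4 : skip (j + 2) (i + 1) = i + 1 := skip_of_lt (by omega)
  have e5 : skip i j = j + 2 := skip_of_le hij
  have e6 : skip i (j + 1) = j + 2 + 1 := skip_of_le (by omega)
  funext m
  rw [← skip_inj (i := j), ← skip_inj (i := i), skip_skip hij, skip_joinArc (h.joinArc _),
    skip_joinArc (h.joinArc _)]
  have a1 := skip_joinArc h (j + 2) i
  have a2 := skip_joinArc h (j + 2) (i + 1)
  have a3 := skip_joinArc h (j + 2) (skip i m)
  have b1 := skip_joinArc h i j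
  have b2 := skip_joinArc h i (j + 1)
  have b3 := skip_joinArc h i (skip j m)
  rw [e3] at a1
  rw [e4] at a2
  rw [e5] at b1
  rw [e6] at b2
  rw [skip_skip hij] at b3
  have c1 := @skip_inj (j + 2) (skip i m) (joinArc (j + 2) π i)
  have c2 := @skip_inj (j + 2) (skip i m) (joinArc (j + 2) π (i + 1))
  have d1 := @skip_inj i (skip j m) (joinArc i π j)
  have d2 := @skip_inj i (skip j m) (joinArc i π (j + 1))
  rw [skip_skip hij] at d1 d2
  have g1 := h.invol i
  have g2 := h.invol (i + 1)
  have g3 := h.invol (j + 2)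
  have g4 := h.invol (j + 2 + 1)
  have g5 := skip_ne (j + 2) (skip i m)
  have g6 := skip_ne_succ (j + 2) (skip i m)
  have g7 := skip_ne i (skip j m)
  have g8 := skip_ne_succ i (skip j m)
  rw [skip_skip hij] at g7 g8
  have g9 := h.invol (skip (j + 2) (skip i m))
  -- With all renumberings undone, both sides are nested conditionals in the values of the
  -- involution at five points: `M` and the four joined points.
  generalize skip (j + 2) (skip i m) = M at *
  simp only [apply_ite (skip i), apply_ite (skip (j + 2)), a1, a2, a3, b1, b2, b3, ← c1, ← c2,
    ← d1, ← d2]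
  have : i ≠ j + 2 := by omega
  have : i + 1 ≠ j + 2 := by omega
  have : i ≠ j + 2 + 1 := by omega
  have : j + 2 ≠ j + 2 + 1 := by omega
  have : i + 1 ≠ j + 2 + 1 := by omega
  clear a1 a2 a3 b1 b2 b3 c1 c2 d1 d2 e3 e4 e5 e6
  generalize j + 2 + 1 = q at *
  generalize j + 2 = p at *
  grind (splits := 30)

/-- Two distant caps may form a loop jointly, and then the cap that is glued last closes it. So the
individual factors depend on the order, and only their product does not. -/
theorem loop_loop {i j : ℕ} (hij : i ≤ j) (h : IsMatching π) {R : Type*} [Field R] (a : R) :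
    (if joinArc i π j = j + 1 then a else 1) * (if π i = i + 1 then a else 1) =
      (if joinArc (j + 2) π i = i + 1 then a else 1) * (if π (j + 2) = j + 2 + 1 then a else 1) := by
  have e3 : skip (j + 2) i = i := skip_of_lt (by omega)
  have e4 : skip (j + 2) (i + 1) = i + 1 := skip_of_lt (by omega)
  have e5 : skip i j = j + 2 := skip_of_le hij
  have e6 : skip i (j + 1) = j + 2 + 1 := skip_of_le (by omega)
  have a1 := skip_joinArc h (j + 2) i
  have b1 := skip_joinArc h i j
  have c1 := @skip_inj (j + 2) (joinArc (j + 2) π i) (i + 1)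
  have d1 := @skip_inj i (joinArc i π j) (j + 1)
  simp only [← c1, ← d1, a1, b1, e3, e4, e5, e6]
  have g1 := h.invol i
  have g2 := h.invol (i + 1)
  have g3 := h.invol (j + 2)
  have g4 := h.invol (j + 2 + 1)
  have : i ≠ j + 2 := by omega
  have : i + 1 ≠ j + 2 := by omega
  have : i ≠ j + 2 + 1 := by omega
  have : i ≠ i + 1 := by omega
  have : i + 1 ≠ j + 2 + 1 := by omega
  have : j + 2 ≠ j + 2 + 1 := by omega
  generalize j + 2 + 1 = q at *
  generalize j + 2 = p at *
  generalize i + 1 = r at *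
  grind (splits := 30)

/-! ### The relations of cups and caps -/

/-- A module with operators that satisfy the relations of cups and caps in the plane. -/
structure IsCupCap {K E : Type*} [Field K] [Ring E] [Algebra K E] (δ : K) (cup cap : ℕ → E) :
    Prop where
  cap_cup_self : ∀ i, cap i * cup i = algebraMap K E δ
  cap_succ_cup : ∀ i, cap (i + 1) * cup i = 1
  cap_cup_succ : ∀ i, cap i * cup (i + 1) = 1
  cup_cup : ∀ i j, i ≤ j → cup i * cup j = cup (j + 2) * cup i
  cap_cap : ∀ i j, i ≤ j → cap j * cap i = cap i * cap (j + 2)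
  cap_cup_of_le : ∀ i j, i ≤ j → cap (j + 2) * cup i = cup i * cap j
  cap_cup_of_ge : ∀ i j, i ≤ j → cap i * cup (j + 2) = cup j * cap i

/-- The pairings of all the points of `ℕ`. -/
abbrev Matching : Type := {π : Pattern // IsMatching π}

/-- Formal linear combinations of pairings of `ℕ`. -/
abbrev MatchingSkein : Type := Matching →₀ Coeff

/-- Insertion of a new arc into pairings of `ℕ`. -/
def cupMatching (i : ℕ) : Module.End Coeff MatchingSkein :=
  Finsupp.linearCombination Coeff fun π =>
    Finsupp.single (⟨insertArc i π.1, π.2.insertArc i⟩ : Matching) (1 : Coeff)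

/-- Joining of neighboring points in pairings of `ℕ`. -/
def capMatching (i : ℕ) : Module.End Coeff MatchingSkein :=
  Finsupp.linearCombination Coeff fun π =>
    Finsupp.single (⟨joinArc i π.1, π.2.joinArc i⟩ : Matching)
      (if π.1 i = i + 1 then loopValue else 1)

theorem cupMatching_single (i : ℕ) (π : Matching) (a : Coeff) :
    cupMatching i (Finsupp.single π a) =
      Finsupp.single (⟨insertArc i π.1, π.2.insertArc i⟩ : Matching) a := by
  rw [cupMatching, Finsupp.linearCombination_single, Finsupp.smul_single, smul_eq_mul, mul_one]

theorem capMatching_single (i : ℕ) (π : Matching) (a : Coeff) :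
    capMatching i (Finsupp.single π a) =
      Finsupp.single (⟨joinArc i π.1, π.2.joinArc i⟩ : Matching)
        (a * if π.1 i = i + 1 then loopValue else 1) := by
  rw [capMatching, Finsupp.linearCombination_single, Finsupp.smul_single, smul_eq_mul]

/-- Pairings of all of `ℕ` are used because the relations then hold at every index, without a record
of the number of strands. For patterns that are the identity from some point on, they can fail at
unpaired points. -/
theorem isCupCap_matching : IsCupCap loopValue cupMatching capMatching where
  cap_cup_self i := by
    refine Finsupp.lhom_ext fun π a => ?_
    rw [Module.End.mul_apply, cupMatching_single, capMatching_single, Module.algebraMap_end_apply,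
      Finsupp.smul_single, smul_eq_mul, mul_comm]
    simp [joinArc_insertArc_self π.2]
  cap_succ_cup i := by
    refine Finsupp.lhom_ext fun π a => ?_
    rw [Module.End.mul_apply, cupMatching_single, capMatching_single, Module.End.one_apply]
    have : i ≠ i + 1 + 1 := by omega
    simp [joinArc_succ_insertArc π.2, this]
  cap_cup_succ i := by
    refine Finsupp.lhom_ext fun π a => ?_
    rw [Module.End.mul_apply, cupMatching_single, capMatching_single, Module.End.one_apply]
    have : insertArc (i + 1) π.1 i ≠ i + 1 := by
      rw [insertArc_of_skip (skip_of_lt (Nat.lt_succ_self i))]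
      exact skip_ne _ _
    simp [joinArc_insertArc_succ π.2, this]
  cup_cup i j h := by
    refine Finsupp.lhom_ext fun π a => ?_
    simp only [Module.End.mul_apply, cupMatching_single, insertArc_insertArc h]
  cap_cap i j h := by
    refine Finsupp.lhom_ext fun π a => ?_
    simp only [Module.End.mul_apply, capMatching_single, joinArc_joinArc h π.2]
    congr 1
    have := loop_loop h π.2 loopValue
    rw [mul_assoc, mul_assoc, mul_comm (ite _ _ _), this, mul_comm (ite _ _ _)]
  cap_cup_of_le i j h := by
    refine Finsupp.lhom_ext fun π a => ?_
    simp only [Module.End.mul_apply, cupMatching_single, capMatching_single,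
      joinArc_insertArc_of_le h π.2]
    have : insertArc i π.1 (j + 2) = j + 2 + 1 ↔ π.1 j = j + 1 := by
      rw [insertArc_of_skip (skip_of_le h), ← skip_of_le (by omega : i ≤ j + 1), skip_inj]
    simp only [this]
  cap_cup_of_ge i j h := by
    refine Finsupp.lhom_ext fun π a => ?_
    simp only [Module.End.mul_apply, cupMatching_single, capMatching_single,
      joinArc_insertArc_of_ge h π.2]
    have : insertArc (j + 2) π.1 i = i + 1 ↔ π.1 i = i + 1 := by
      rw [insertArc_of_skip (skip_of_lt (by omega : i < j + 2)),
        ← skip_of_lt (by omega : i + 1 < j + 2), skip_inj, skip_of_lt (by omega : i + 1 < j + 2)]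
    simp only [this]

/-! ### Comparison of the two models -/

/-- `π` is the partner function of a complete pairing of the points `0, …, k - 1`. -/
structure IsPairing (k : ℕ) (π : Pattern) : Prop where
  lt : ∀ j < k, π j < k
  invol : ∀ j < k, π (π j) = j
  ne : ∀ j < k, π j ≠ j
  fix : ∀ j, k ≤ j → π j = j

/-- Pair the points from `k` on with their neighbors. -/
def pad (k : ℕ) (π : Pattern) : Pattern := fun j =>
  if j < k then π j else if (j - k) % 2 = 0 then j + 1 else j - 1

theorem pad_of_lt {k j : ℕ} (h : j < k) (π : Pattern) : pad k π j = π j := if_pos h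

theorem IsPairing.pad {k : ℕ} (h : IsPairing k π) : IsMatching (pad k π) := by
  constructor <;> intro j
  · by_cases hj : j < k
    · rw [pad_of_lt hj, pad_of_lt (h.lt j hj), h.invol j hj]
    · simp only [PretzelHead.pad]; split_ifs <;> omega
  · by_cases hj : j < k
    · rw [pad_of_lt hj]; exact h.ne j hj
    · simp only [PretzelHead.pad]; split_ifs <;> omega

theorem IsPairing.insertArc {k i : ℕ} (h : IsPairing k π) (hi : i ≤ k) :
    IsPairing (k + 2) (insertArc i π) := by
  have key : ∀ m, skip i m < k + 2 ↔ m < k := by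
    intro m; simp only [skip]; split_ifs <;> omega
  constructor <;> intro j hj <;> rcases eq_or_skip i j with rfl | rfl | ⟨m, rfl⟩
  · simp; omega
  · simp; omega
  · rw [insertArc_skip, key]; exact h.lt m ((key m).1 hj)
  · simp
  · simp
  · rw [insertArc_skip, insertArc_skip, h.invol m ((key m).1 hj)]
  · simp
  · simp
  · rw [insertArc_skip, Ne, skip_inj]; exact h.ne m ((key m).1 hj)
  · omega
  · omega
  · rw [insertArc_skip, h.fix m]
    by_contra hm
    exact absurd ((key m).2 (not_le.1 hm)) (not_lt.2 hj)

theorem pad_insertArc {k i : ℕ} (hi : i ≤ k) (π : Pattern) :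
    pad (k + 2) (insertArc i π) = insertArc i (pad k π) := by
  have key : ∀ m, skip i m < k + 2 ↔ m < k := by
    intro m; simp only [skip]; split_ifs <;> omega
  funext j
  rcases eq_or_skip i j with rfl | rfl | ⟨m, rfl⟩
  · rw [pad_of_lt (by omega), insertArc_self, insertArc_self]
  · rw [pad_of_lt (by omega), insertArc_succ, insertArc_succ]
  · rw [insertArc_skip]
    by_cases hm : m < k
    · rw [pad_of_lt ((key m).2 hm), pad_of_lt hm, insertArc_skip]
    · simp only [pad, if_neg hm, skip]; split_ifs <;> omega

theorem pad_joinArc {k i : ℕ} (h : IsPairing (k + 2) π) (hi : i ≤ k) :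
    pad k (joinArc i π) = joinArc i (pad (k + 2) π) := by
  have key : ∀ m, skip i m < k + 2 ↔ m < k := by
    intro m; simp only [skip]; split_ifs <;> omega
  have l1 := h.lt i (by omega)
  have l2 := h.lt (i + 1) (by omega)
  funext j
  by_cases hj : j < k
  · simp only [pad_of_lt hj, joinArc, pad_of_lt (by omega : i < k + 2),
      pad_of_lt (by omega : i + 1 < k + 2), pad_of_lt ((key j).2 hj)]
  · simp only [joinArc, pad_of_lt (by omega : i < k + 2), pad_of_lt (by omega : i + 1 < k + 2)]
    rw [if_neg (by have := mt (key j).1 hj; omega), if_neg (by have := mt (key j).1 hj; omega)]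
    simp only [pad, if_neg hj, skip, unskip]; split_ifs <;> omega

theorem IsPairing.joinArc {k i : ℕ} (h : IsPairing (k + 2) π) (hi : i ≤ k) :
    IsPairing k (joinArc i π) := by
  have key : ∀ m, skip i m < k + 2 ↔ m < k := by
    intro m; simp only [skip]; split_ifs <;> omega
  have l1 := h.lt i (by omega)
  have l2 := h.lt (i + 1) (by omega)
  -- Below `k` the joined pairing agrees with the joined padding. The latter is a matching, which
  -- gives involutivity and the absence of fixed points.
  have e := pad_joinArc h hi
  have hm : IsMatching (PretzelHead.joinArc i (PretzelHead.pad (k + 2) π)) := h.pad.joinArc i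
  have e' : ∀ j < k, PretzelHead.joinArc i π j =
      PretzelHead.joinArc i (PretzelHead.pad (k + 2) π) j := by
    intro j hj; rw [← e, pad_of_lt hj]
  have hlt : ∀ j < k, PretzelHead.joinArc i π j < k := by
    intro j hj
    rw [e' j hj, ← key, skip_joinArc h.pad, pad_of_lt ((key j).2 hj),
      pad_of_lt (by omega : i < k + 2), pad_of_lt (by omega : i + 1 < k + 2)]
    have := h.lt (skip i j) ((key j).2 hj)
    split_ifs <;> assumption
  refine ⟨hlt, fun j hj => ?_, fun j hj => ?_, fun j hj => ?_⟩
  · rw [e' _ (hlt j hj), e' j hj, hm.invol]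
  · rw [e' j hj]; exact hm.ne j
  · have hs : skip i j = j + 2 := skip_of_le (by omega)
    rw [PretzelHead.joinArc, hs, if_neg (by omega), if_neg (by omega), h.fix _ (by omega), ← hs,
      unskip_skip]

open Classical in
/-- The embedding of the skein of `k` points into the skein of pairings of `ℕ`. -/
def padSkein (k : ℕ) : Skein →ₗ[Coeff] MatchingSkein :=
  Finsupp.linearCombination Coeff fun π =>
    if h : IsPairing k π then Finsupp.single (⟨pad k π, h.pad⟩ : Matching) (1 : Coeff) else 0

theorem padSkein_single {k : ℕ} (h : IsPairing k π) (a : Coeff) :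
    padSkein k (Finsupp.single π a) = Finsupp.single (⟨pad k π, h.pad⟩ : Matching) a := by
  rw [padSkein, Finsupp.linearCombination_single, dif_pos h, Finsupp.smul_single, smul_eq_mul,
    mul_one]

/-- The skein of `k` points. -/
def pairingSkein (k : ℕ) : Submodule Coeff Skein :=
  Submodule.span Coeff {v | ∃ π, IsPairing k π ∧ v = Finsupp.single π 1}

theorem single_mem_pairingSkein {k : ℕ} (h : IsPairing k π) (a : Coeff) :
    (Finsupp.single π a : Skein) ∈ pairingSkein k := by
  have : (Finsupp.single π a : Skein) = a • Finsupp.single π 1 := by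
    rw [Finsupp.smul_single, smul_eq_mul, mul_one]
  rw [this]
  exact Submodule.smul_mem _ _ (Submodule.subset_span ⟨π, h, rfl⟩)

/-- The operator `x` maps the skein of `k` points to that of `l` points, where it corresponds to
the operator `y` on pairings of `ℕ`. -/
def Corresponds (k l : ℕ) (x : Module.End Coeff Skein) (y : Module.End Coeff MatchingSkein) :
    Prop :=
  ∀ v ∈ pairingSkein k, x v ∈ pairingSkein l ∧ padSkein l (x v) = y (padSkein k v)

theorem corresponds_of_single {k l : ℕ} {x : Module.End Coeff Skein}
    {y : Module.End Coeff MatchingSkein}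
    (h : ∀ π, IsPairing k π → x (Finsupp.single π 1) ∈ pairingSkein l ∧
      padSkein l (x (Finsupp.single π 1)) = y (padSkein k (Finsupp.single π 1))) :
    Corresponds k l x y := by
  intro v hv
  induction hv using Submodule.span_induction with
  | mem v hv => obtain ⟨π, hπ, rfl⟩ := hv; exact h π hπ
  | zero => simp
  | add v w _ _ h1 h2 =>
    simp only [map_add, h1.2, h2.2, and_true]
    exact Submodule.add_mem _ h1.1 h2.1
  | smul a v _ h1 =>
    simp only [map_smul, h1.2, and_true]
    exact Submodule.smul_mem _ _ h1.1

namespace Corresponds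

variable {k l m : ℕ} {x x' : Module.End Coeff Skein} {y y' : Module.End Coeff MatchingSkein}

theorem mul (h : Corresponds l m x y) (h' : Corresponds k l x' y') :
    Corresponds k m (x * x') (y * y') := fun v hv => by
  obtain ⟨h1, h2⟩ := h' v hv
  obtain ⟨h3, h4⟩ := h _ h1
  exact ⟨h3, by rw [Module.End.mul_apply, h4, h2, Module.End.mul_apply]⟩

theorem add (h : Corresponds k l x y) (h' : Corresponds k l x' y') :
    Corresponds k l (x + x') (y + y') := fun v hv => by
  obtain ⟨h1, h2⟩ := h v hv
  obtain ⟨h3, h4⟩ := h' v hv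
  exact ⟨Submodule.add_mem _ h1 h3, by
    rw [LinearMap.add_apply, map_add, h2, h4, LinearMap.add_apply]⟩

theorem smul (a : Coeff) (h : Corresponds k l x y) : Corresponds k l (a • x) (a • y) :=
  fun v hv => by
    obtain ⟨h1, h2⟩ := h v hv
    exact ⟨Submodule.smul_mem _ _ h1, by
      rw [LinearMap.smul_apply, map_smul, h2, LinearMap.smul_apply]⟩

theorem one : Corresponds k k 1 1 := fun _ hv => ⟨hv, rfl⟩

theorem pow (h : Corresponds k k x y) (n : ℕ) : Corresponds k k (x ^ n) (y ^ n) := by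
  induction n with
  | zero => simpa using one
  | succ n ih => rw [pow_succ, pow_succ]; exact ih.mul h

theorem prod_range {f : ℕ → Module.End Coeff Skein} {g : ℕ → Module.End Coeff MatchingSkein}
    (n : ℕ) (h : ∀ r < n, Corresponds k k (f r) (g r)) :
    Corresponds k k ((List.range n).map f).prod ((List.range n).map g).prod := by
  induction n with
  | zero => simpa using one
  | succ n ih =>
    simp only [List.range_succ, List.map_append, List.prod_append, List.map_cons, List.map_nil,
      List.prod_cons, List.prod_nil, mul_one]
    exact (ih fun r hr => h r (by omega)).mul (h n (by omega))

end Corresponds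

theorem corresponds_cupOp {k i : ℕ} (hi : i ≤ k) :
    Corresponds k (k + 2) (cupOp i) (cupMatching i) := by
  refine corresponds_of_single fun π hπ => ?_
  rw [cupOp, Finsupp.linearCombination_single, one_smul, padSkein_single hπ, cupMatching_single,
    padSkein_single (hπ.insertArc hi)]
  refine ⟨single_mem_pairingSkein (hπ.insertArc hi) _, ?_⟩
  simp only [pad_insertArc hi]

theorem corresponds_capOp {k i : ℕ} (hi : i ≤ k) :
    Corresponds (k + 2) k (capOp i) (capMatching i) := by
  refine corresponds_of_single fun π hπ => ?_
  rw [capOp, Finsupp.linearCombination_single, one_smul, padSkein_single hπ, capMatching_single,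
    padSkein_single (hπ.joinArc hi)]
  refine ⟨single_mem_pairingSkein (hπ.joinArc hi) _, ?_⟩
  simp only [pad_joinArc hπ hi, pad_of_lt (by omega : i < k + 2), one_mul]

end PretzelHead

/-! ### Quantum integers and planar operators over a general field -/

namespace PretzelHead

/-- The quantum integer `[n]` in the variable `a`. -/
def quantumInt {K : Type*} [Field K] (a : K) (n : ℕ) : K :=
  (a ^ (2 * (n : ℤ)) - a ^ (-(2 * (n : ℤ)))) / (a ^ (2 : ℤ) - a ^ (-2 : ℤ))

/-- An algebra with elements that satisfy the relations of cups and caps in the plane, where the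
value of a closed loop is `-a² - a⁻²`. -/
structure PlanarOps (K E : Type*) [Field K] [Ring E] [Algebra K E] where
  /-- the Kauffman variable -/
  a : K
  /-- the cups -/
  cup : ℕ → E
  /-- the caps -/
  cap : ℕ → E
  a_ne_zero : a ≠ 0
  a_pow_ne_one : ∀ n : ℕ, n ≠ 0 → a ^ n ≠ 1
  isCupCap : IsCupCap (-a ^ (2 : ℤ) - a ^ (-2 : ℤ)) cup cap

namespace PlanarOps

variable {K E : Type*} [Field K] [Ring E] [Algebra K E] (T : PlanarOps K E)

/-- The value of a closed loop. -/
def loop : K := -T.a ^ (2 : ℤ) - T.a ^ (-2 : ℤ)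

/-- The quantum integers. -/
def q (n : ℕ) : K := quantumInt T.a n

theorem den_ne_zero : T.a ^ (2 : ℤ) - T.a ^ (-2 : ℤ) ≠ 0 := by
  intro h
  have h0 := T.a_ne_zero
  apply T.a_pow_ne_one 4 (by norm_num)
  have h2 : T.a ^ (2 : ℤ) = T.a ^ (-2 : ℤ) := sub_eq_zero.1 h
  have : T.a ^ (2 : ℤ) * T.a ^ (2 : ℤ) = T.a ^ (-2 : ℤ) * T.a ^ (2 : ℤ) := by rw [h2]
  rw [← zpow_add₀ h0, ← zpow_add₀ h0] at this
  norm_num at this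
  exact_mod_cast this

theorem q_ne_zero {n : ℕ} (hn : n ≠ 0) : T.q n ≠ 0 := by
  have h0 := T.a_ne_zero
  refine div_ne_zero (fun h => ?_) T.den_ne_zero
  apply T.a_pow_ne_one (4 * n) (by omega)
  have h2 := sub_eq_zero.1 h
  have : T.a ^ (2 * (n : ℤ)) * T.a ^ (2 * (n : ℤ)) = T.a ^ (-(2 * (n : ℤ))) * T.a ^ (2 * (n : ℤ)) := by
    rw [h2]
  rw [← zpow_add₀ h0, ← zpow_add₀ h0] at this
  have e : (2 * (n : ℤ) + 2 * n) = ((4 * n : ℕ) : ℤ) := by push_cast; ring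
  rw [e, neg_add_cancel, zpow_zero, zpow_natCast] at this
  exact this

@[simp] theorem q_zero : T.q 0 = 0 := by simp [q, quantumInt]

@[simp] theorem q_one : T.q 1 = 1 := by
  have := T.den_ne_zero
  rw [q, quantumInt]
  simpa using div_self this

/-- The quadratic identity behind the factorization of differences of the eigenvalues `α`. -/
theorem q_mul_sub (b c s : ℕ) :
    T.q (b + s) * T.q (c + s) - T.q b * T.q c = T.q s * T.q (b + c + s) := by
  have h0 := T.a_ne_zero
  have hd := T.den_ne_zero
  simp only [q, quantumInt]
  rw [div_mul_div_comm, div_mul_div_comm, div_mul_div_comm, ← sub_div]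
  congr 1
  have e : ∀ n : ℕ, T.a ^ (2 * (n : ℤ)) = (T.a ^ 2) ^ n := by
    intro n; rw [← pow_mul]; exact_mod_cast rfl
  simp only [zpow_neg, e, pow_add]
  have h2 : T.a ^ 2 ≠ 0 := pow_ne_zero _ h0
  have hb := pow_ne_zero b h2
  have hc := pow_ne_zero c h2
  have hs := pow_ne_zero s h2
  field_simp
  ring

theorem loop_mul_q (n : ℕ) : T.loop * T.q (n + 1) + T.q n = -T.q (n + 2) := by
  have h0 := T.a_ne_zero
  have hd := T.den_ne_zero
  simp only [q, quantumInt, loop]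
  rw [mul_div_assoc', ← add_div, ← neg_div]
  congr 1
  have e : ∀ n : ℕ, T.a ^ (2 * (n : ℤ)) = (T.a ^ 2) ^ n := by
    intro n; rw [← pow_mul]; exact_mod_cast rfl
  have e2 : T.a ^ (2 : ℤ) = T.a ^ 2 := by exact_mod_cast rfl
  simp only [zpow_neg, e, pow_add, e2]
  have h2 : T.a ^ 2 ≠ 0 := pow_ne_zero _ h0
  have hb := pow_ne_zero n h2
  field_simp
  ring

/-! ### Relations of cups and caps -/

theorem cap_cup_self (i : ℕ) : T.cap i * T.cup i = algebraMap K E T.loop :=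
  T.isCupCap.cap_cup_self i

theorem cap_succ_cup (i : ℕ) : T.cap (i + 1) * T.cup i = 1 := T.isCupCap.cap_succ_cup i

theorem cap_cup_succ (i : ℕ) : T.cap i * T.cup (i + 1) = 1 := T.isCupCap.cap_cup_succ i

theorem cup_cup {i j : ℕ} (h : i ≤ j) : T.cup i * T.cup j = T.cup (j + 2) * T.cup i :=
  T.isCupCap.cup_cup i j h

theorem cap_cap {i j : ℕ} (h : i ≤ j) : T.cap j * T.cap i = T.cap i * T.cap (j + 2) :=
  T.isCupCap.cap_cap i j h

theorem cap_cup_of_le {i j : ℕ} (h : i ≤ j) : T.cap (j + 2) * T.cup i = T.cup i * T.cap j :=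
  T.isCupCap.cap_cup_of_le i j h

theorem cap_cup_of_ge {i j : ℕ} (h : i ≤ j) : T.cap i * T.cup (j + 2) = T.cup j * T.cap i :=
  T.isCupCap.cap_cup_of_ge i j h

/-- The Temperley–Lieb generators. -/
def U (i : ℕ) : E := T.cup i * T.cap i

theorem cup_mul_U {i j : ℕ} (h : j ≤ i) : T.cup j * T.U i = T.U (i + 2) * T.cup j := by
  rw [U, U, ← mul_assoc, T.cup_cup h, mul_assoc, ← T.cap_cup_of_le h, mul_assoc]

theorem cup_mul_U_of_lt {i j : ℕ} (h : i + 2 ≤ j) : T.cup j * T.U i = T.U i * T.cup j := by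
  obtain ⟨j, rfl⟩ := Nat.exists_eq_add_of_le' h
  rw [U, ← mul_assoc, show j + (i + 2) = (j + i) + 2 by ring, ← T.cup_cup (by omega), mul_assoc,
    ← T.cap_cup_of_ge (by omega), mul_assoc]

theorem cap_mul_U {i j : ℕ} (h : j ≤ i) : T.cap j * T.U (i + 2) = T.U i * T.cap j := by
  rw [U, U, ← mul_assoc, T.cap_cup_of_ge h, mul_assoc, ← T.cap_cap h, mul_assoc]

theorem cap_mul_U_of_lt {i j : ℕ} (h : i + 2 ≤ j) : T.cap j * T.U i = T.U i * T.cap j := by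
  obtain ⟨j, rfl⟩ := Nat.exists_eq_add_of_le' h
  rw [U, ← mul_assoc, show j + (i + 2) = (j + i) + 2 by ring, T.cap_cup_of_le (by omega),
    mul_assoc, T.cap_cap (by omega), mul_assoc]

theorem U_mul_U_of_lt {i j : ℕ} (h : i + 2 ≤ j) : T.U i * T.U j = T.U j * T.U i := by
  obtain ⟨j, rfl⟩ := Nat.exists_eq_add_of_le' h
  rw [show j + (i + 2) = (j + i) + 2 by ring]
  nth_rewrite 1 [U]
  rw [mul_assoc, T.cap_mul_U (by omega), ← mul_assoc, T.cup_mul_U (by omega), mul_assoc, ← U]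

theorem commute_U {i j : ℕ} (h : i + 2 ≤ j ∨ j + 2 ≤ i) : Commute (T.U i) (T.U j) := by
  rcases h with h | h
  · exact T.U_mul_U_of_lt h
  · exact (T.U_mul_U_of_lt h).symm

theorem U_mul_U_self (i : ℕ) : T.U i * T.U i = T.loop • T.U i := by
  rw [U, mul_assoc, ← mul_assoc (T.cap i), cap_cup_self, ← mul_assoc, ← Algebra.commutes,
    mul_assoc, Algebra.smul_def]

theorem cap_mul_U_succ (i : ℕ) : T.cap i * T.U (i + 1) = T.cap (i + 1) := by
  rw [U, ← mul_assoc, cap_cup_succ, one_mul]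

theorem cap_succ_mul_U (i : ℕ) : T.cap (i + 1) * T.U i = T.cap i := by
  rw [U, ← mul_assoc, cap_succ_cup, one_mul]

theorem U_succ_mul_cup (i : ℕ) : T.U (i + 1) * T.cup i = T.cup (i + 1) := by
  rw [U, mul_assoc, cap_succ_cup, mul_one]

theorem U_mul_cup_succ (i : ℕ) : T.U i * T.cup (i + 1) = T.cup i := by
  rw [U, mul_assoc, cap_cup_succ, mul_one]

theorem U_U_U_succ (i : ℕ) : T.U i * (T.U (i + 1) * T.U i) = T.U i := by
  nth_rewrite 3 [U]
  rw [← mul_assoc (T.U (i + 1)), U_succ_mul_cup, ← mul_assoc, U_mul_cup_succ, U]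

theorem U_succ_U_U (i : ℕ) : T.U (i + 1) * (T.U i * T.U (i + 1)) = T.U (i + 1) := by
  nth_rewrite 3 [U]
  rw [← mul_assoc (T.U i), U_mul_cup_succ, ← mul_assoc, U_succ_mul_cup, U]

/-! ### Jones–Wenzl idempotents -/

/-- The Jones–Wenzl idempotents. -/
def jw (b : ℕ) : ℕ → E
  | 0 => 1
  | 1 => 1
  | n + 2 => jw b (n + 1) + (T.q (n + 1) / T.q (n + 2)) • (jw b (n + 1) * T.U (b + n) * jw b (n + 1))

@[simp] theorem jw_zero (b : ℕ) : T.jw b 0 = 1 := by rw [jw]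

@[simp] theorem jw_one (b : ℕ) : T.jw b 1 = 1 := by rw [jw]

theorem jw_succ_succ (b n : ℕ) : T.jw b (n + 2) = T.jw b (n + 1) +
    (T.q (n + 1) / T.q (n + 2)) • (T.jw b (n + 1) * T.U (b + n) * T.jw b (n + 1)) := by rw [jw]

theorem one_add_smul (s : K) (x : E) : (1 + s) • x = x + s • x := by rw [add_smul, one_smul]

/-- An idempotent is a polynomial in its generators, the same one at every position; so whatever
moves the generators moves the idempotent. -/
theorem mul_jw_of_forall {x : E} {b b' n : ℕ}
    (h : ∀ i, i + 1 < n → x * T.U (b + i) = T.U (b' + i) * x) :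
    x * T.jw b n = T.jw b' n * x := by
  induction n with
  | zero => simp
  | succ n ih =>
    rcases n with - | n
    · simp
    · have ih := ih fun i hi => h i (by omega)
      rw [jw_succ_succ, jw_succ_succ, mul_add, add_mul, ih, mul_smul_comm, smul_mul_assoc,
        ← mul_assoc, ← mul_assoc, ih, mul_assoc _ x, h n (by omega), ← mul_assoc, mul_assoc _ x, ih,
        ← mul_assoc]

theorem commute_jw {x : E} {b n : ℕ} (h : ∀ i, i + 1 < n → Commute x (T.U (b + i))) :
    Commute x (T.jw b n) := T.mul_jw_of_forall h

/-- The recursion adds only terms in which a generator meets `x` once the smaller idempotent has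
been absorbed. Together with `jw_kills` this yields idempotence, absorption of smaller idempotents
and uniqueness. -/
theorem jw_mul_eq_self {x : E} {b n : ℕ} (h : ∀ i, i + 1 < n → T.U (b + i) * x = 0) :
    T.jw b n * x = x := by
  induction n with
  | zero => simp
  | succ n ih =>
    rcases n with - | n
    · simp
    · have ih := ih fun i hi => h i (by omega)
      rw [jw_succ_succ, add_mul, smul_mul_assoc, mul_assoc, ih, mul_assoc, h n (by omega), mul_zero,
        smul_zero, add_zero]

theorem mul_jw_eq_self {x : E} {b n : ℕ} (h : ∀ i, i + 1 < n → x * T.U (b + i) = 0) :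
    x * T.jw b n = x := by
  induction n with
  | zero => simp
  | succ n ih =>
    rcases n with - | n
    · simp
    · have ih := ih fun i hi => h i (by omega)
      rw [jw_succ_succ, mul_add, mul_smul_comm, ← mul_assoc, ← mul_assoc, ih, h n (by omega),
        zero_mul, smul_zero, add_zero]

theorem commute_U_jw {i b n : ℕ} (h : i + 2 ≤ b ∨ b + n ≤ i) : Commute (T.U i) (T.jw b n) :=
  T.commute_jw fun j hj => T.commute_U (by omega)

/-- The reason for the coefficient in Wenzl's recursion: it cancels the partial trace factor of
`U_mul_jw_mul_U`. -/
theorem one_add_c_mul (n : ℕ) :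
    1 + T.q (n + 1) / T.q (n + 2) * (T.loop + T.q n / T.q (n + 1)) = 0 := by
  have h1 := T.q_ne_zero (Nat.succ_ne_zero n)
  have h2 := T.q_ne_zero (Nat.succ_ne_zero (n + 1))
  have := T.loop_mul_q n
  simp only [Nat.succ_eq_add_one, add_assoc, Nat.reduceAdd] at h1 h2
  field_simp
  linear_combination this

/-- Expanding the middle idempotent once leaves a closed loop and a zigzag. Idempotence of the
smaller idempotent is a hypothesis because the lemma is used inside the induction that proves it. -/
theorem U_mul_jw_mul_U (b n : ℕ) (h : T.jw b n * T.jw b n = T.jw b n) :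
    T.U (b + n) * T.jw b (n + 1) * T.U (b + n) =
      (T.loop + T.q n / T.q (n + 1)) • (T.U (b + n) * T.jw b n) := by
  rcases n with - | n
  · simp [U_mul_U_self]
  · have hc : Commute (T.U (b + (n + 1))) (T.jw b (n + 1)) := T.commute_U_jw (by omega)
    rw [jw_succ_succ, mul_add, add_mul, add_smul, hc.eq, mul_assoc, U_mul_U_self, mul_smul_comm,
      mul_smul_comm, smul_mul_assoc]
    congr 2
    · symm
      calc T.jw b (n + 1) * T.U (b + (n + 1))
          = T.U (b + (n + 1)) * (T.jw b (n + 1) * T.jw b (n + 1)) := by rw [h, hc.eq]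
        _ = T.jw b (n + 1) * T.U (b + n + 1) * T.jw b (n + 1) := by
          rw [← mul_assoc, hc.eq, add_assoc]
        _ = T.jw b (n + 1) * (T.U (b + n + 1) * (T.U (b + n) * T.U (b + n + 1))) *
            T.jw b (n + 1) := by rw [T.U_succ_U_U]
        _ = (T.jw b (n + 1) * T.U (b + (n + 1))) * T.U (b + n) *
            (T.U (b + (n + 1)) * T.jw b (n + 1)) := by simp only [mul_assoc, add_assoc]
        _ = _ := by rw [← hc.eq]; nth_rewrite 2 [hc.eq]; simp only [mul_assoc]

theorem jw_kills (b n : ℕ) : (∀ i, i + 1 < n → T.U (b + i) * T.jw b n = 0) ∧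
    (∀ i, i + 1 < n → T.jw b n * T.U (b + i) = 0) := by
  induction n using Nat.strong_induction_on with
  | _ n ih =>
    match n, ih with
    | 0, _ => simp
    | 1, _ => simp
    | n + 2, ih =>
      obtain ⟨h1, h2⟩ := ih (n + 1) (by omega)
      obtain ⟨h3, -⟩ := ih n (by omega)
      have e1 : T.jw b n * T.jw b n = T.jw b n := T.jw_mul_eq_self h3
      have e2 : T.jw b n * T.jw b (n + 1) = T.jw b (n + 1) :=
        T.jw_mul_eq_self fun i hi => h1 i (by omega)
      have e3 : T.jw b (n + 1) * T.jw b n = T.jw b (n + 1) :=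
        T.mul_jw_eq_self fun i hi => h2 i (by omega)
      have e4 := T.U_mul_jw_mul_U b n e1
      have hc : Commute (T.U (b + n)) (T.jw b n) := T.commute_U_jw (by omega)
      constructor
      · intro i hi
        rcases (by omega : i + 1 < n + 1 ∨ i = n) with hi | rfl
        · rw [jw_succ_succ, mul_add, mul_smul_comm, ← mul_assoc, ← mul_assoc, h1 i hi]
          simp
        · rw [jw_succ_succ, mul_add, mul_smul_comm, ← mul_assoc, ← mul_assoc, e4, smul_mul_assoc,
            mul_assoc, e2, smul_smul, ← one_add_smul, one_add_c_mul, zero_smul]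
      · intro i hi
        rcases (by omega : i + 1 < n + 1 ∨ i = n) with hi | rfl
        · rw [jw_succ_succ, add_mul, smul_mul_assoc, mul_assoc, h2 i hi]
          simp
        · rw [jw_succ_succ, add_mul, smul_mul_assoc, mul_assoc, mul_assoc, ← mul_assoc (T.U (b + i)),
            e4, mul_smul_comm, hc.eq, ← mul_assoc, e3, smul_smul, ← one_add_smul, one_add_c_mul,
            zero_smul]

theorem U_mul_jw {b n i : ℕ} (h : b ≤ i) (h' : i + 1 < b + n) : T.U i * T.jw b n = 0 := by
  obtain ⟨i, rfl⟩ := Nat.exists_eq_add_of_le h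
  exact (T.jw_kills b n).1 i (by omega)

theorem jw_mul_U {b n i : ℕ} (h : b ≤ i) (h' : i + 1 < b + n) : T.jw b n * T.U i = 0 := by
  obtain ⟨i, rfl⟩ := Nat.exists_eq_add_of_le h
  exact (T.jw_kills b n).2 i (by omega)

theorem jw_mul_jw {b b' n n' : ℕ} (h : b ≤ b') (h' : b' + n' ≤ b + n) :
    T.jw b' n' * T.jw b n = T.jw b n :=
  T.jw_mul_eq_self fun _ _ => T.U_mul_jw (by omega) (by omega)

theorem jw_mul_jw' {b b' n n' : ℕ} (h : b ≤ b') (h' : b' + n' ≤ b + n) :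
    T.jw b n * T.jw b' n' = T.jw b n :=
  T.mul_jw_eq_self fun _ _ => T.jw_mul_U (by omega) (by omega)

theorem jw_mul_self (b n : ℕ) : T.jw b n * T.jw b n = T.jw b n :=
  T.jw_mul_jw le_rfl le_rfl

theorem commute_jw_jw {b b' n n' : ℕ} (h : b + n ≤ b') : Commute (T.jw b n) (T.jw b' n') := by
  refine T.commute_jw fun i hi => Commute.symm (T.commute_jw fun j hj => T.commute_U ?_)
  omega

theorem cup_mul_jw {j b n : ℕ} (h : j ≤ b) : T.cup j * T.jw b n = T.jw (b + 2) n * T.cup j :=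
  T.mul_jw_of_forall fun i _ => by rw [T.cup_mul_U (by omega), add_right_comm]

theorem commute_cup_jw {j b n : ℕ} (h : b + n ≤ j) : Commute (T.cup j) (T.jw b n) :=
  T.commute_jw fun _ _ => T.cup_mul_U_of_lt (by omega)

theorem cap_mul_jw {j b n : ℕ} (h : j ≤ b) : T.cap j * T.jw (b + 2) n = T.jw b n * T.cap j :=
  T.mul_jw_of_forall fun i _ => by rw [add_right_comm, T.cap_mul_U (by omega)]

theorem commute_cap_jw {j b n : ℕ} (h : b + n ≤ j) : Commute (T.cap j) (T.jw b n) :=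
  T.commute_jw fun _ _ => T.cap_mul_U_of_lt (by omega)

/-- The recursion with the new strand on the left. -/
theorem jw_succ_succ' (b n : ℕ) : T.jw b (n + 2) = T.jw (b + 1) (n + 1) +
    (T.q (n + 1) / T.q (n + 2)) • (T.jw (b + 1) (n + 1) * T.U b * T.jw (b + 1) (n + 1)) := by
  induction n generalizing b with
  | zero => simp [jw_succ_succ]
  | succ n ih =>
    set R := T.jw (b + 1) (n + 1 + 1) + (T.q (n + 1 + 1) / T.q (n + 1 + 2)) •
      (T.jw (b + 1) (n + 1 + 1) * T.U b * T.jw (b + 1) (n + 1 + 1)) with hR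
    have key : T.U b * T.jw (b + 1) (n + 2) * T.U b =
        (T.loop + T.q (n + 1) / T.q (n + 2)) • (T.U b * T.jw (b + 2) (n + 1)) := by
      have hc : Commute (T.U b) (T.jw (b + 2) (n + 1)) := T.commute_U_jw (by omega)
      rw [ih (b + 1), mul_add, add_mul, add_smul, add_assoc, hc.eq, mul_assoc, U_mul_U_self,
        mul_smul_comm, mul_smul_comm, smul_mul_assoc]
      congr 2
      calc T.U b * (T.jw (b + 2) (n + 1) * T.U (b + 1) * T.jw (b + 2) (n + 1)) * T.U b
          = (T.U b * T.jw (b + 2) (n + 1)) * T.U (b + 1) * (T.jw (b + 2) (n + 1) * T.U b) := by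
            simp only [mul_assoc]
        _ = T.jw (b + 2) (n + 1) * (T.U b * (T.U (b + 1) * T.U b)) * T.jw (b + 2) (n + 1) := by
            rw [← hc.eq]; nth_rewrite 1 [hc.eq]; simp only [mul_assoc]
        _ = T.jw (b + 2) (n + 1) * T.U b := by
            rw [T.U_U_U_succ, mul_assoc, hc.eq, ← mul_assoc, jw_mul_self]
    -- Uniqueness: `R` is killed by every generator, so the idempotent fixes it. Conversely the
    -- idempotent absorbs the first term of `R` and annihilates the second, so the same product is
    -- the idempotent itself.
    have h1 : T.jw b (n + 1 + 2) * R = R := by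
      refine T.jw_mul_eq_self fun i hi => ?_
      rcases i with - | i
      · rw [hR, mul_add, mul_smul_comm, ← mul_assoc, ← mul_assoc, add_zero, key, smul_mul_assoc,
          mul_assoc, T.jw_mul_jw (by omega) (by omega), smul_smul, ← one_add_smul, one_add_c_mul,
          zero_smul]
      · rw [hR, mul_add, mul_smul_comm, ← mul_assoc, ← mul_assoc,
          T.U_mul_jw (by omega) (by omega)]
        simp
    rw [← h1, hR, mul_add, mul_smul_comm, ← mul_assoc, ← mul_assoc,
      T.jw_mul_jw' (by omega) (by omega), T.jw_mul_U (by omega) (by omega)]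
    simp

/-! ### Nested cups and caps -/

/-- Nested cups, the outermost of which starts at `b`. -/
def cups (b : ℕ) : ℕ → E
  | 0 => 1
  | n + 1 => T.cup (b + n) * cups b n

/-- Nested caps, the outermost of which starts at `b`. -/
def caps (b : ℕ) : ℕ → E
  | 0 => 1
  | n + 1 => caps b n * T.cap (b + n)

@[simp] theorem cups_zero (b : ℕ) : T.cups b 0 = 1 := rfl

@[simp] theorem caps_zero (b : ℕ) : T.caps b 0 = 1 := rfl

theorem cups_succ (b n : ℕ) : T.cups b (n + 1) = T.cup (b + n) * T.cups b n := rfl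

theorem caps_succ (b n : ℕ) : T.caps b (n + 1) = T.caps b n * T.cap (b + n) := rfl

theorem cups_add (b n m : ℕ) : T.cups b (n + m) = T.cups (b + n) m * T.cups b n := by
  induction m with
  | zero => simp
  | succ m ih => rw [← add_assoc, cups_succ, ih, cups_succ, add_assoc, mul_assoc]

theorem caps_add (b n m : ℕ) : T.caps b (n + m) = T.caps b n * T.caps (b + n) m := by
  induction m with
  | zero => simp
  | succ m ih => rw [← add_assoc, caps_succ, ih, caps_succ, add_assoc, mul_assoc]

theorem cups_mul_of_le {x : ℕ → E} (h : ∀ j k, j ≤ k → T.cup j * x k = x (k + 2) * T.cup j)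
    {b k : ℕ} (hb : b ≤ k) (n : ℕ) : T.cups b n * x k = x (k + 2 * n) * T.cups b n := by
  induction n with
  | zero => simp
  | succ n ih =>
    rw [cups_succ, mul_assoc, ih, ← mul_assoc, h _ _ (by omega), mul_assoc,
      show k + 2 * n + 2 = k + 2 * (n + 1) by ring]

theorem caps_mul_of_le {x : ℕ → E} (h : ∀ j k, j ≤ k → T.cap j * x (k + 2) = x k * T.cap j)
    {b k : ℕ} (hb : b ≤ k) (n : ℕ) : T.caps b n * x (k + 2 * n) = x k * T.caps b n := by
  induction n with
  | zero => simp
  | succ n ih =>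
    rw [caps_succ, mul_assoc, show k + 2 * (n + 1) = k + 2 * n + 2 by ring, h _ _ (by omega),
      ← mul_assoc, ih, mul_assoc]

theorem commute_cups {x : E} {b n : ℕ} (h : ∀ j < n, Commute (T.cup (b + j)) x) :
    Commute (T.cups b n) x := by
  induction n with
  | zero => simp
  | succ n ih => exact (h n (by omega)).mul_left (ih fun j hj => h j (by omega))

theorem commute_caps {x : E} {b n : ℕ} (h : ∀ j < n, Commute (T.cap (b + j)) x) :
    Commute (T.caps b n) x := by
  induction n with
  | zero => simp
  | succ n ih => exact (ih fun j hj => h j (by omega)).mul_left (h n (by omega))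

theorem cup_mul_cups {j k : ℕ} (h : j ≤ k) (n : ℕ) :
    T.cup j * T.cups k n = T.cups (k + 2) n * T.cup j := by
  induction n with
  | zero => simp
  | succ n ih =>
    rw [cups_succ, ← mul_assoc, T.cup_cup (by omega), mul_assoc, ih, cups_succ, mul_assoc,
      add_right_comm]

theorem cup_mul_caps {j k : ℕ} (h : j ≤ k) (n : ℕ) :
    T.cup j * T.caps k n = T.caps (k + 2) n * T.cup j := by
  induction n with
  | zero => simp
  | succ n ih =>
    rw [caps_succ, ← mul_assoc, ih, mul_assoc, ← T.cap_cup_of_le (by omega), caps_succ, mul_assoc,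
      add_right_comm]

theorem cap_mul_cups {j k : ℕ} (h : j ≤ k) (n : ℕ) :
    T.cap j * T.cups (k + 2) n = T.cups k n * T.cap j := by
  induction n with
  | zero => simp
  | succ n ih =>
    rw [cups_succ, ← mul_assoc, add_right_comm, T.cap_cup_of_ge (by omega), mul_assoc, ih,
      cups_succ, mul_assoc]

theorem cap_mul_caps {j k : ℕ} (h : j ≤ k) (n : ℕ) :
    T.cap j * T.caps (k + 2) n = T.caps k n * T.cap j := by
  induction n with
  | zero => simp
  | succ n ih =>
    rw [caps_succ, ← mul_assoc, ih, mul_assoc, add_right_comm, ← T.cap_cap (by omega), caps_succ,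
      mul_assoc]

theorem cups_mul_cups {b k : ℕ} (h : b ≤ k) (n m : ℕ) :
    T.cups b n * T.cups k m = T.cups (k + 2 * n) m * T.cups b n :=
  T.cups_mul_of_le (x := fun k => T.cups k m) (fun _ _ h => T.cup_mul_cups h m) h n

theorem cups_mul_jw {b k : ℕ} (h : b ≤ k) (n m : ℕ) :
    T.cups b n * T.jw k m = T.jw (k + 2 * n) m * T.cups b n :=
  T.cups_mul_of_le (x := fun k => T.jw k m) (fun _ _ h => T.cup_mul_jw h) h n

theorem cups_mul_U {b k : ℕ} (h : b ≤ k) (n : ℕ) :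
    T.cups b n * T.U k = T.U (k + 2 * n) * T.cups b n :=
  T.cups_mul_of_le (x := fun k => T.U k) (fun _ _ h => T.cup_mul_U h) h n

theorem caps_mul_cups {b k : ℕ} (h : b ≤ k) (n m : ℕ) :
    T.caps b n * T.cups (k + 2 * n) m = T.cups k m * T.caps b n :=
  T.caps_mul_of_le (x := fun k => T.cups k m) (fun _ _ h => T.cap_mul_cups h m) h n

theorem caps_mul_caps {b k : ℕ} (h : b ≤ k) (n m : ℕ) :
    T.caps b n * T.caps (k + 2 * n) m = T.caps k m * T.caps b n :=
  T.caps_mul_of_le (x := fun k => T.caps k m) (fun _ _ h => T.cap_mul_caps h m) h n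

theorem caps_mul_jw {b k : ℕ} (h : b ≤ k) (n m : ℕ) :
    T.caps b n * T.jw (k + 2 * n) m = T.jw k m * T.caps b n :=
  T.caps_mul_of_le (x := fun k => T.jw k m) (fun _ _ h => T.cap_mul_jw h) h n

theorem caps_mul_U {b k : ℕ} (h : b ≤ k) (n : ℕ) :
    T.caps b n * T.U (k + 2 * n) = T.U k * T.caps b n :=
  T.caps_mul_of_le (x := fun k => T.U k) (fun _ _ h => T.cap_mul_U h) h n

theorem commute_cups_jw {b n k m : ℕ} (h : k + m ≤ b) : Commute (T.cups b n) (T.jw k m) :=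
  T.commute_cups fun _ _ => T.commute_cup_jw (by omega)

theorem commute_caps_jw {b n k m : ℕ} (h : k + m ≤ b) : Commute (T.caps b n) (T.jw k m) :=
  T.commute_caps fun _ _ => T.commute_cap_jw (by omega)

theorem cups_succ' (b n : ℕ) : T.cups b (n + 1) = T.cups (b + 1) n * T.cup b := by
  rw [add_comm, cups_add, cups_succ, cups_zero, mul_one, add_zero]

theorem caps_succ' (b n : ℕ) : T.caps b (n + 1) = T.cap b * T.caps (b + 1) n := by
  rw [add_comm, caps_add, caps_succ, caps_zero, one_mul, add_zero]

theorem caps_mul_cups_right (b n : ℕ) : T.caps b n * T.cups (b + n) n = 1 := by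
  induction n with
  | zero => simp
  | succ n ih =>
    rw [cups_succ', caps_succ, mul_assoc, ← mul_assoc (T.cap _), ← add_assoc,
      show b + n + 1 + 1 = b + n + 2 by ring, T.cap_mul_cups le_rfl, mul_assoc, T.cap_cup_succ,
      mul_one, ih]

theorem caps_mul_cups_left (b n : ℕ) : T.caps (b + n) n * T.cups b n = 1 := by
  induction n with
  | zero => simp
  | succ n ih =>
    rw [caps_succ', cups_succ, mul_assoc, ← mul_assoc (T.caps _ _), ← add_assoc,
      show b + n + 1 + 1 = b + n + 2 by ring, ← T.cup_mul_caps le_rfl, mul_assoc, ih, mul_one,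
      T.cap_succ_cup]

/-! ### Two adjacent idempotents -/

/-- Two adjacent Jones–Wenzl idempotents. -/
def ff (b n : ℕ) : E := T.jw b n * T.jw (b + n) n

theorem commute_jw_adjacent (b n m : ℕ) : Commute (T.jw b n) (T.jw (b + n) m) :=
  T.commute_jw_jw le_rfl

theorem ff_mul_jw_left {b n b' n' : ℕ} (h : b ≤ b') (h' : b' + n' ≤ b + n) :
    T.ff b n * T.jw b' n' = T.ff b n := by
  rw [ff, (T.commute_jw_adjacent b n n).eq, mul_assoc, T.jw_mul_jw' h h']

theorem ff_mul_jw_right {b n b' n' : ℕ} (h : b + n ≤ b') (h' : b' + n' ≤ b + n + n) :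
    T.ff b n * T.jw b' n' = T.ff b n := by
  rw [ff, mul_assoc, T.jw_mul_jw' h h']

theorem jw_left_mul_ff {b n b' n' : ℕ} (h : b ≤ b') (h' : b' + n' ≤ b + n) :
    T.jw b' n' * T.ff b n = T.ff b n := by
  rw [ff, ← mul_assoc, T.jw_mul_jw h h']

theorem jw_right_mul_ff {b n b' n' : ℕ} (h : b + n ≤ b') (h' : b' + n' ≤ b + n + n) :
    T.jw b' n' * T.ff b n = T.ff b n := by
  rw [ff, (T.commute_jw_adjacent b n n).eq, ← mul_assoc, T.jw_mul_jw h h']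

theorem ff_mul_self (b n : ℕ) : T.ff b n * T.ff b n = T.ff b n := by
  nth_rewrite 2 [ff]
  rw [← mul_assoc, T.ff_mul_jw_left le_rfl le_rfl, T.ff_mul_jw_right le_rfl le_rfl]

theorem U_mul_ff {b n i : ℕ} (h : b ≤ i) (h' : i + 1 < b + n + n) (h'' : i + 1 ≠ b + n) :
    T.U i * T.ff b n = 0 := by
  rcases lt_or_gt_of_ne h'' with h2 | h2
  · rw [ff, ← mul_assoc, T.U_mul_jw h h2, zero_mul]
  · rw [ff, (T.commute_jw_adjacent b n n).eq, ← mul_assoc, T.U_mul_jw (by omega) h', zero_mul]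

theorem ff_mul_U {b n i : ℕ} (h : b ≤ i) (h' : i + 1 < b + n + n) (h'' : i + 1 ≠ b + n) :
    T.ff b n * T.U i = 0 := by
  rcases lt_or_gt_of_ne h'' with h2 | h2
  · rw [ff, (T.commute_jw_adjacent b n n).eq, mul_assoc, T.jw_mul_U h h2, mul_zero]
  · rw [ff, mul_assoc, T.jw_mul_U (by omega) h', mul_zero]

/-- A pair of idempotents absorbs a smaller pair next to a cup. -/
theorem ff_mul_cup_mul_ff (b n : ℕ) :
    T.ff b (n + 1) * T.cup (b + n) * T.ff b n = T.ff b (n + 1) * T.cup (b + n) := by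
  rw [ff.eq_1 T b n, ← mul_assoc, mul_assoc _ (T.cup _), (T.commute_cup_jw le_rfl).eq, ← mul_assoc,
    T.ff_mul_jw_left le_rfl (by omega), mul_assoc, T.cup_mul_jw le_rfl, ← mul_assoc,
    T.ff_mul_jw_right (by omega) (by omega)]

/-- A partial trace at the seam. The left idempotent is expanded at its right end and the right one
at its left end. Of the four terms, one closes a loop, two are straightened, and the last is the
next middle generator. For `n = 0` the corrections vanish because `q 0 = 0`. -/
theorem cap_ff_cup (b n : ℕ) : T.cap (b + n) * T.ff b (n + 1) * T.cup (b + n) =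
    (T.loop + 2 * (T.q n / T.q (n + 1))) • T.ff b n +
      (T.q n / T.q (n + 1)) ^ 2 • (T.ff b n * T.U (b + n - 1) * T.ff b n) := by
  rcases n with - | m
  · simp [ff, cap_cup_self, Algebra.algebraMap_eq_smul_one]
  · set c := T.q (m + 1) / T.q (m + 1 + 1) with hc
    set F := T.jw b (m + 1) with hF
    set G := T.jw (b + m + 3) (m + 1) with hG
    set p := b + m with hp
    have hFG : Commute F G := T.commute_jw_jw (by omega)
    have hFU : Commute F (T.U (p + 2)) := (T.commute_U_jw (by omega)).symm
    have hGU : Commute G (T.U p) := (T.commute_U_jw (by omega)).symm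
    have e1 : T.jw b (m + 1 + 1) = F * (1 + c • T.U p) * F := by
      rw [jw_succ_succ, mul_add, add_mul, mul_one, T.jw_mul_self, mul_smul_comm, smul_mul_assoc]
    have e2 : T.jw (b + (m + 1 + 1)) (m + 1 + 1) = G * (1 + c • T.U (p + 2)) * G := by
      rw [jw_succ_succ', mul_add, add_mul, mul_one, T.jw_mul_self, mul_smul_comm, smul_mul_assoc]
      rfl
    have e3 : T.ff b (m + 1 + 1) =
        (F * G) * ((1 + c • T.U p) * (1 + c • T.U (p + 2))) * (F * G) := by
      have h1 : Commute G (1 + c • T.U p) := (Commute.one_right _).add_right (hGU.smul_right c)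
      have h2 : Commute F (1 + c • T.U (p + 2)) := (Commute.one_right _).add_right (hFU.smul_right c)
      rw [ff, e1, e2]
      calc F * (1 + c • T.U p) * F * (G * (1 + c • T.U (p + 2)) * G)
          = F * (1 + c • T.U p) * (F * G) * (1 + c • T.U (p + 2)) * G := by simp only [mul_assoc]
        _ = F * ((1 + c • T.U p) * G) * (F * (1 + c • T.U (p + 2))) * G := by
            rw [hFG.eq]; simp only [mul_assoc]
        _ = _ := by rw [← h1.eq, h2.eq]; simp only [mul_assoc]
    have e4 : T.cap (p + 1) * (F * G) = T.ff b (m + 1) * T.cap (p + 1) := by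
      rw [← mul_assoc, (T.commute_cap_jw (by omega)).eq, mul_assoc, T.cap_mul_jw (by omega), ff,
        mul_assoc]
      rfl
    have e5 : F * G * T.cup (p + 1) = T.cup (p + 1) * T.ff b (m + 1) := by
      rw [ff, ← mul_assoc, (T.commute_cup_jw (by omega)).eq, mul_assoc _ (T.cup _),
        T.cup_mul_jw (by omega), mul_assoc]
      rfl
    have e6 : T.cap (p + 1) * ((1 + c • T.U p) * (1 + c • T.U (p + 2))) * T.cup (p + 1) =
        algebraMap K E (T.loop + 2 * c) + c ^ 2 • T.U p := by
      have a1 : T.cap (p + 1) * T.U p * T.cup (p + 1) = 1 := by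
        rw [cap_succ_mul_U, cap_cup_succ]
      have a2 : T.cap (p + 1) * T.U (p + 2) * T.cup (p + 1) = 1 := by
        rw [mul_assoc, U_succ_mul_cup, cap_cup_succ]
      have a3 : T.cap (p + 1) * (T.U p * T.U (p + 2)) * T.cup (p + 1) = T.U p := by
        rw [← mul_assoc, cap_succ_mul_U, mul_assoc, U_succ_mul_cup,
          T.cap_cup_of_ge (i := p) (j := p) le_rfl, U]
      have a0 := T.cap_cup_self (p + 1)
      simp only [mul_add, add_mul, mul_one, one_mul, smul_mul_assoc, mul_smul_comm, a1, a2, a3, a0,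
        smul_add, smul_smul, Algebra.algebraMap_eq_smul_one, two_mul, add_smul, pow_two]
      abel
    rw [show b + (m + 1) = p + 1 by omega, e3]
    rw [← mul_assoc (T.cap _), ← mul_assoc (T.cap _), e4, mul_assoc _ (F * G), e5]
    calc T.ff b (m + 1) * T.cap (p + 1) * ((1 + c • T.U p) * (1 + c • T.U (p + 2))) *
          (T.cup (p + 1) * T.ff b (m + 1))
        = T.ff b (m + 1) * (T.cap (p + 1) * ((1 + c • T.U p) * (1 + c • T.U (p + 2))) *
          T.cup (p + 1)) * T.ff b (m + 1) := by simp only [mul_assoc]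
      _ = _ := by
        rw [e6, mul_add, add_mul, ← Algebra.commutes, mul_assoc, ff_mul_self, mul_smul_comm,
          smul_mul_assoc, show p + 1 - 1 = p by omega, ← Algebra.smul_def]

end PlanarOps

end PretzelHead

namespace PretzelHead

/-! ### Newton and Lagrange bases -/

section Newton

variable {K : Type*} [Field K] (α β : ℕ → K)

/-- The values of the Newton basis at the nodes: those of `∏_{m<j} (x - α m) / β m` at `α i`. -/
def newton (j i : ℕ) : K := ∏ m ∈ Finset.range j, (α i - α m) / β m

/-- The coefficients of the Lagrange basis in the Newton basis. -/
def lagrange (i j : ℕ) : K :=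
  if i ≤ j then (∏ m ∈ Finset.range j, β m) / ∏ m ∈ (Finset.range (j + 1)).erase i, (α i - α m)
  else 0

@[simp] theorem newton_zero (i : ℕ) : newton α β 0 i = 1 := by simp [newton]

theorem newton_succ (j i : ℕ) :
    newton α β (j + 1) i = newton α β j i * ((α i - α j) / β j) := Finset.prod_range_succ _ _

theorem newton_of_lt {i j : ℕ} (h : i < j) : newton α β j i = 0 :=
  Finset.prod_eq_zero (Finset.mem_range.2 h) (by simp)

theorem lagrange_of_lt {i j : ℕ} (h : j < i) : lagrange α β i j = 0 := if_neg (by omega)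

variable {α β} {N : ℕ} (hα : ∀ i ≤ N, ∀ m < i, α i - α m ≠ 0) (hβ : ∀ m < N, β m ≠ 0)

include hα in
theorem sub_ne_zero_of_ne {i m : ℕ} (hi : i ≤ N) (hm : m ≤ N) (h : i ≠ m) : α i - α m ≠ 0 := by
  rcases lt_or_gt_of_ne h with h | h
  · rw [← neg_sub]; exact neg_ne_zero.2 (hα m hm i h)
  · exact hα i hi m h

include hα in
theorem lagrange_succ {i j : ℕ} (hj : j < N) :
    lagrange α β i (j + 1) * (α i - α (j + 1)) = lagrange α β i j * β j := by
  rcases lt_trichotomy i (j + 1) with h | rfl | h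
  · have h1 : (Finset.range (j + 1 + 1)).erase i =
        insert (j + 1) ((Finset.range (j + 1)).erase i) := by
      rw [Finset.range_add_one (n := j + 1), Finset.erase_insert_of_ne (by omega)]
    have h2 : α i - α (j + 1) ≠ 0 := sub_ne_zero_of_ne hα (by omega) (by omega) (by omega)
    rw [lagrange, lagrange, if_pos (by omega), if_pos (by omega), h1,
      Finset.prod_insert (by simp), Finset.prod_range_succ]
    field_simp
  · rw [sub_self, mul_zero, lagrange_of_lt _ _ (Nat.lt_succ_self j), zero_mul]
  · rw [lagrange_of_lt _ _ h, lagrange_of_lt _ _ (by omega), zero_mul, zero_mul]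

include hα hβ in
theorem lagrange_mul_newton_self {i : ℕ} (hi : i ≤ N) :
    lagrange α β i i * newton α β i i = 1 := by
  rw [lagrange, if_pos le_rfl, newton, Finset.prod_div_distrib, Finset.range_add_one,
    Finset.erase_insert (by simp)]
  have h1 : ∏ m ∈ Finset.range i, β m ≠ 0 :=
    Finset.prod_ne_zero_iff.2 fun m hm => hβ m (by have := Finset.mem_range.1 hm; omega)
  have h2 : ∏ m ∈ Finset.range i, (α i - α m) ≠ 0 :=
    Finset.prod_ne_zero_iff.2 fun m hm => hα i hi m (Finset.mem_range.1 hm)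
  field_simp

include hα hβ in
-- The sum up to `M` is the value at `α i'` of the polynomial that interpolates the `i`-th delta
-- function at `α 0, …, α M`. Each new node adds one factor to a product, and the node `α i'`
-- contributes the factor zero.
theorem sum_lagrange_mul_newton {i i' : ℕ} (hi : i ≤ N) (hi' : i' ≤ N) :
    ∑ j ∈ Finset.range (N + 1), lagrange α β i j * newton α β j i' = if i = i' then 1 else 0 := by
  rcases lt_or_ge i' i with h | h
  · rw [if_neg (by omega)]
    refine Finset.sum_eq_zero fun j _ => ?_
    rcases lt_or_ge j i with h' | h'
    · rw [lagrange_of_lt _ _ h', zero_mul]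
    · rw [newton_of_lt _ _ (by omega), mul_zero]
  · have key : ∀ M, i ≤ M → M ≤ N → ∑ j ∈ Finset.range (M + 1), lagrange α β i j * newton α β j i' =
        (lagrange α β i i * newton α β i i') *
          ∏ m ∈ Finset.Ico i M, (α i' - α (m + 1)) / (α i - α (m + 1)) := by
      intro M hM
      induction M, hM using Nat.le_induction with
      | base =>
        intro _
        rw [Finset.Ico_self, Finset.prod_empty, mul_one, Finset.sum_range_succ,
          Finset.sum_eq_zero, zero_add]
        intro j hj
        rw [lagrange_of_lt _ _ (Finset.mem_range.1 hj), zero_mul]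
      | succ M hM ih =>
        intro hMN
        -- The summand, multiplied by `α i' - α M`, in the same product form; it controls the
        -- increment of the partial sum.
        have key2 : ∀ M, i ≤ M → M ≤ N → lagrange α β i M * newton α β M i' * (α i' - α M) =
            (lagrange α β i i * newton α β i i') * (α i' - α i) *
              ∏ m ∈ Finset.Ico i M, (α i' - α (m + 1)) / (α i - α (m + 1)) := by
          intro M hM
          induction M, hM using Nat.le_induction with
          | base => intro _; simp
          | succ M hM ih =>
            intro hMN
            rw [Finset.prod_Ico_succ_top hM, ← mul_assoc, ← ih (by omega), newton_succ]
            have h2 : α i - α (M + 1) ≠ 0 := sub_ne_zero_of_ne hα (by omega) (by omega) (by omega)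
            have h3 : β M ≠ 0 := hβ M (by omega)
            have := lagrange_succ (β := β) hα (i := i) (j := M) (by omega)
            field_simp
            linear_combination (newton α β M i' * (α i' - α M) * (α i' - α (M + 1))) * this
        rw [Finset.sum_range_succ, ih (by omega), Finset.prod_Ico_succ_top hM, newton_succ]
        have h2 : α i - α (M + 1) ≠ 0 := sub_ne_zero_of_ne hα (by omega) (by omega) (by omega)
        have h3 : β M ≠ 0 := hβ M (by omega)
        have h4 := lagrange_succ (β := β) hα (i := i) (j := M) (by omega)
        have h5 := key2 M hM (by omega)
        set P := ∏ m ∈ Finset.Ico i M, (α i' - α (m + 1)) / (α i - α (m + 1))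
        field_simp
        linear_combination (newton α β M i' * (α i' - α M)) * h4 + β M * h5
    rw [key N hi le_rfl]
    rcases h.eq_or_lt with rfl | h
    · rw [if_pos rfl, lagrange_mul_newton_self hα hβ hi, one_mul]
      refine Finset.prod_eq_one fun m hm => div_self ?_
      have := Finset.mem_Ico.1 hm
      exact sub_ne_zero_of_ne hα hi (by omega) (by omega)
    · rw [if_neg (by omega)]
      refine mul_eq_zero_of_right _ (Finset.prod_eq_zero (i := i' - 1) ?_ ?_)
      · exact Finset.mem_Ico.2 (by omega)
      · rw [show i' - 1 + 1 = i' by omega, sub_self, zero_div]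

include hα hβ in
-- The two matrices are square, so the one-sided inverse of `sum_lagrange_mul_newton` is two-sided.
theorem sum_newton_mul_lagrange {j j' : ℕ} (hj : j ≤ N) (hj' : j' ≤ N) :
    ∑ i ∈ Finset.range (N + 1), newton α β j i * lagrange α β i j' = if j = j' then 1 else 0 := by
  let A : Matrix (Fin (N + 1)) (Fin (N + 1)) K := fun i j => lagrange α β i j
  let B : Matrix (Fin (N + 1)) (Fin (N + 1)) K := fun j i => newton α β j i
  have h : A * B = 1 := by
    ext i i'
    rw [Matrix.mul_apply, Matrix.one_apply, Fin.sum_univ_eq_sum_range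
      (fun j => lagrange α β i j * newton α β j i'), sum_lagrange_mul_newton hα hβ (by omega)
      (by omega)]
    simp [Fin.ext_iff]
  have h' : B * A = 1 := mul_eq_one_comm.1 h
  have := congrFun (congrFun h' ⟨j, by omega⟩) ⟨j', by omega⟩
  rw [Matrix.mul_apply, Matrix.one_apply, Fin.sum_univ_eq_sum_range
    (fun i => newton α β j i * lagrange α β i j')] at this
  simpa [Fin.ext_iff] using this

end Newton

end PretzelHead

namespace PretzelHead

/-! ### The middle generator between two pairs of idempotents -/

namespace PlanarOps

variable {K E : Type*} [Field K] [Ring E] [Algebra K E] (T : PlanarOps K E)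

/-- The eigenvalues of the middle generator between two pairs of `N`-strand idempotents. -/
def α (N j : ℕ) : K := -(T.q j * T.q (2 * N + 1 - j)) / T.q N ^ 2

/-- The second coefficient in the multiplication rule of the middle generator. -/
def β (N j : ℕ) : K := (T.q (N - j) / T.q N) ^ 2

theorem q_two_mul (n : ℕ) :
    T.q (2 * (n + 1)) = -(T.loop * T.q (n + 1) ^ 2) - 2 * T.q n * T.q (n + 1) := by
  have h1 := T.loop_mul_q n
  have h6 := T.q_mul_sub (n + 1) n 1
  rw [show n + 1 + n + 1 = 2 * (n + 1) by ring] at h6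
  simp only [q_one, one_mul] at h6
  rw [← h6]
  linear_combination T.q (n + 1) * h1

/-- The part with `j` cups and one more cap. -/
def turn (b j : ℕ) : ℕ → E
  | 0 => 0
  | e + 1 => T.cups (b + e) j * (T.cap (b + e) * T.ff b (e + 1))

theorem cup_mul_turn (b d j : ℕ) :
    T.cup (b + d + j) * T.turn b (j + 1) d = T.turn b (j + 2) d := by
  rcases d with - | e
  · simp [turn]
  · rw [turn, turn, ← mul_assoc, T.cups_succ _ (j + 1)]
    congr 3
    ring

/-- The cap either uses up one cup or is moved below all of them, which is `turn`. By `cap_ff_cup`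
the innermost cup produces a smaller middle generator, to which the induction hypothesis applies;
the coefficients add up to the closed form `α`. -/
theorem cap_ff_cups (b d j : ℕ) :
    T.cap (b + d + j) * T.ff b (d + j + 1) * T.cups (b + d) (j + 1) =
      T.α (d + j + 1) (j + 1) • (T.ff b (d + j) * T.cups (b + d) j) +
        (T.q d / T.q (d + j + 1)) ^ 2 • (T.ff b (d + j) * T.turn b (j + 1) d) := by
  induction j with
  | zero =>
    have hq := T.q_ne_zero (Nat.succ_ne_zero d)
    rw [cups_succ, cups_zero, mul_one, mul_one, add_zero, add_zero, T.cap_ff_cup]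
    congr 1
    · congr 1
      rw [α, show 2 * (d + 1) + 1 - (0 + 1) = 2 * (d + 1) by omega, q_two_mul, zero_add, q_one]
      simp only [Nat.succ_eq_add_one] at hq
      field_simp
      ring
    · rcases d with - | e
      · simp
      · rw [turn, cups_succ, cups_zero, mul_one, U, ← add_assoc, Nat.add_sub_cancel, add_zero]
        simp only [mul_assoc]
  | succ j ih =>
    rw [T.cups_succ _ (j + 1), ← mul_assoc, add_assoc b d (j + 1), T.cap_ff_cup, add_mul,
      smul_mul_assoc, smul_mul_assoc]
    have e1 : T.ff b (d + (j + 1)) * T.U (b + (d + (j + 1)) - 1) * T.ff b (d + (j + 1)) *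
        T.cups (b + d) (j + 1) =
        T.α (d + j + 1) (j + 1) • (T.ff b (d + (j + 1)) * T.cups (b + d) (j + 1)) +
        (T.q d / T.q (d + j + 1)) ^ 2 • (T.ff b (d + (j + 1)) * T.turn b (j + 2) d) := by
      have e2 : T.ff b (d + (j + 1)) * T.cup (b + d + j) * T.ff b (d + j) =
          T.ff b (d + (j + 1)) * T.cup (b + d + j) := by
        rw [add_assoc, ← add_assoc d, T.ff_mul_cup_mul_ff b (d + j)]
      rw [show b + (d + (j + 1)) - 1 = b + d + j by omega, U]
      calc _ = T.ff b (d + (j + 1)) * T.cup (b + d + j) * (T.cap (b + d + j) * T.ff b (d + j + 1) *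
            T.cups (b + d) (j + 1)) := by simp only [mul_assoc, add_assoc]
        _ = _ := by
          rw [ih, mul_add, mul_smul_comm, mul_smul_comm, ← mul_assoc, ← mul_assoc, e2, cups_succ,
            mul_assoc, mul_assoc, cup_mul_turn]
    have hq := T.q_ne_zero (Nat.succ_ne_zero (d + j))
    have hq2 := T.q_ne_zero (Nat.succ_ne_zero (d + j + 1))
    simp only [Nat.succ_eq_add_one] at hq hq2
    rw [e1, smul_add, smul_smul, smul_smul, ← add_assoc, ← add_smul, ← add_assoc d j 1]
    congr 2
    · rw [α, α, show 2 * (d + j + 1 + 1) + 1 - (j + 1 + 1) = 2 * d + j + 3 by omega,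
        show 2 * (d + j + 1) + 1 - (j + 1) = 2 * d + j + 2 by omega]
      have h1 := T.q_mul_sub (j + 1) (2 * d + j + 2) 1
      rw [show j + 1 + (2 * d + j + 2) + 1 = 2 * (d + j + 1 + 1) by ring, q_one, one_mul,
        q_two_mul] at h1
      rw [show 2 * d + j + 3 = 2 * d + j + 2 + 1 by ring]
      field_simp
      linear_combination h1
    · field_simp

/-! ### The algebra of the tangles between two pairs of idempotents -/

/-- The lower half of `h`. -/
def hd (b N j : ℕ) : E := T.caps (b + N - j) j * T.ff b N

/-- `j` nested cups above `j` nested caps between two pairs of `N`-strand idempotents. -/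
def h (b N j : ℕ) : E := T.ff b N * T.cups (b + N - j) j * T.hd b N j

theorem ff_mul_cups_mul_ff (b d j : ℕ) :
    T.ff b (d + j) * T.cups (b + d) j * T.ff b d = T.ff b (d + j) * T.cups (b + d) j := by
  rw [ff.eq_1 T b d, ← mul_assoc, mul_assoc _ (T.cups _ _), (T.commute_cups_jw le_rfl).eq,
    ← mul_assoc, T.ff_mul_jw_left le_rfl (by omega), mul_assoc, T.cups_mul_jw le_rfl, ← mul_assoc,
    T.ff_mul_jw_right (by omega) (by omega)]

theorem ff_mul_caps_mul_ff (b d j : ℕ) :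
    T.ff b d * T.caps (b + d) j * T.ff b (d + j) = T.caps (b + d) j * T.ff b (d + j) := by
  rw [ff.eq_1 T b d, mul_assoc, mul_assoc, ← mul_assoc (T.jw (b + d) d),
    ← T.caps_mul_jw le_rfl, mul_assoc, T.jw_right_mul_ff (by omega) (by omega), ← mul_assoc,
    ← (T.commute_caps_jw le_rfl).eq, mul_assoc, T.jw_left_mul_ff (by omega) (by omega)]

theorem ff_mul_hd {b N j : ℕ} (hj : j ≤ N) : T.ff b (N - j) * T.hd b N j = T.hd b N j := by
  obtain ⟨d, rfl⟩ := Nat.exists_eq_add_of_le' hj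
  rw [hd, show b + (d + j) - j = b + d by omega, Nat.add_sub_cancel, ← mul_assoc,
    ff_mul_caps_mul_ff]

theorem hd_mul_ff (b N j : ℕ) : T.hd b N j * T.ff b N = T.hd b N j := by
  rw [hd, mul_assoc, ff_mul_self]

theorem cap_mul_hd {b N j e : ℕ} (he : N = e + 1 + j) :
    T.cap (b + e) * T.hd b N j = T.hd b N (j + 1) := by
  rw [hd, hd, show b + N - j = b + e + 1 by omega, show b + N - (j + 1) = b + e by omega,
    caps_succ', mul_assoc]

@[simp] theorem h_zero (b N : ℕ) : T.h b N 0 = T.ff b N := by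
  rw [h, hd, cups_zero, caps_zero, mul_one, one_mul, ff_mul_self]

theorem ff_mul_h (b N j : ℕ) : T.ff b N * T.h b N j = T.h b N j := by
  rw [h, ← mul_assoc, ← mul_assoc, ff_mul_self]

theorem h_mul_ff (b N j : ℕ) : T.h b N j * T.ff b N = T.h b N j := by
  rw [h, mul_assoc, hd_mul_ff]

/-- `turn` continued by the lower half of `h`. -/
theorem turn_mul_hd {b N d j t : ℕ} (he : N = d + j) :
    (T.q d) • (T.turn b t d * T.hd b N j) =
      (T.q d) • (T.cups (b + d - 1) t * T.hd b N (j + 1)) := by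
  -- The factor `q d` is there for `d = 0`: then `turn` is zero by convention and `b + d - 1` is
  -- meaningless, but both sides vanish.
  rcases d with - | e
  · simp
  · have h1 := T.ff_mul_hd (b := b) (N := N) (j := j) (by omega)
    rw [show N - j = e + 1 by omega] at h1
    rw [turn, mul_assoc, mul_assoc, h1, T.cap_mul_hd he, ← add_assoc, Nat.add_sub_cancel]

/-- The cap of `h 1` meets the cups of `h j` as in `cap_ff_cups`: using up a cup reproduces `h j`,
passing below them gives `h (j + 1)`. Hence `h 1` is triangular with diagonal `α`, and it generates
the algebra because `β N j ≠ 0` for `j < N`. -/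
theorem h_one_mul_h {b N j : ℕ} (hN : N ≠ 0) (hj : j ≤ N) :
    T.h b N 1 * T.h b N j = T.α N j • T.h b N j + T.β N j • T.h b N (j + 1) := by
  obtain ⟨d, rfl⟩ := Nat.exists_eq_add_of_le' hj
  have hq := T.q_ne_zero hN
  rcases j with - | j
  · rw [h_zero, h_mul_ff]
    simp only [add_zero] at hq ⊢
    simp [α, β, div_self hq]
  · have e1 := T.cap_ff_cups b d j
    have e2 := T.turn_mul_hd (b := b) (N := d + j + 1) (d := d) (j := j + 1) (t := j + 1) rfl
    have e3 := T.ff_mul_cup_mul_ff b (d + j)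
    have e5 : T.h b (d + (j + 1)) 1 * T.h b (d + (j + 1)) (j + 1) = T.ff b (d + j + 1) *
        T.cup (b + d + j) * (T.cap (b + d + j) * T.ff b (d + j + 1) *
        T.cups (b + d) (j + 1)) * T.hd b (d + j + 1) (j + 1) := by
      rw [h.eq_1 T b _ 1, h.eq_1 T b _ (j + 1), mul_assoc, ← mul_assoc (T.hd _ _ _),
        ← mul_assoc (T.hd _ _ _), hd_mul_ff, hd.eq_1 T b _ 1,
        show b + (d + (j + 1)) - 1 = b + d + j by omega,
        show b + (d + (j + 1)) - (j + 1) = b + d by omega, cups_succ, caps_succ]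
      simp only [cups_zero, caps_zero, mul_one, one_mul, add_zero, mul_assoc]
      rfl
    rw [e5, e1, mul_add, add_mul, mul_smul_comm, mul_smul_comm, smul_mul_assoc, smul_mul_assoc,
      ← mul_assoc, ← mul_assoc, add_assoc b d j, e3, mul_assoc _ (T.cup _) (T.cups _ _), ← add_assoc,
      ← T.cups_succ]
    congr 1
    · rw [h, show b + (d + (j + 1)) - (j + 1) = b + d by omega]; rfl
    · rw [mul_assoc _ (T.turn _ _ _), β, show d + (j + 1) - (j + 1) = d by omega, div_pow, div_eq_mul_inv,
        pow_two, mul_assoc, mul_comm (T.q d), ← smul_smul _ (T.q d), ← mul_smul_comm, e2,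
        mul_smul_comm, smul_smul]
      rcases d with - | e
      · simp
      · congr 1
        · rw [← add_assoc (e + 1) j 1]
          ring
        · rw [h, mul_assoc, ← mul_assoc (T.cup _),
            show b + (e + 1 + (j + 1)) - (j + 1 + 1) = b + e by omega,
            ← add_assoc b e 1, Nat.add_sub_cancel, show b + e + 1 + j = b + e + (j + 1) by ring,
            ← cups_succ, mul_assoc]
          rfl

/-! ### Idempotents -/

/-- The coefficients of the idempotents. -/
def coeffE (N i j : ℕ) : K := lagrange (T.α N) (T.β N) i j

/-- The eigenvalue of `h j` on the `i`-th idempotent. -/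
def eta (N j i : ℕ) : K := newton (T.α N) (T.β N) j i

/-- The idempotents of the algebra spanned by the elements `h j`. -/
def e (b N i : ℕ) : E := ∑ j ∈ Finset.range (N + 1), T.coeffE N i j • T.h b N j

theorem α_sub_α {N i m : ℕ} (hi : i ≤ N) (hm : m ≤ i) :
    T.α N i - T.α N m = -(T.q (i - m) * T.q (2 * N + 1 - i - m)) / T.q N ^ 2 := by
  obtain ⟨s, rfl⟩ := Nat.exists_eq_add_of_le hm
  rw [α, α, ← sub_div]
  congr 1
  have h4 := T.q_mul_sub s (2 * N + 1 - (m + s) - m) m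
  rw [show s + m = m + s by ring, show 2 * N + 1 - (m + s) - m + m = 2 * N + 1 - (m + s) by omega,
    show s + (2 * N + 1 - (m + s) - m) + m = 2 * N + 1 - m by omega] at h4
  rw [show m + s - m = s by omega]
  linear_combination (-1) * h4

theorem α_sub_α_ne_zero {N : ℕ} : ∀ i ≤ N, ∀ m < i, T.α N i - T.α N m ≠ 0 := by
  intro i hi m hm
  rw [T.α_sub_α hi hm.le]
  have h1 := T.q_ne_zero (show i - m ≠ 0 by omega)
  have h2 := T.q_ne_zero (show 2 * N + 1 - i - m ≠ 0 by omega)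
  have h3 := T.q_ne_zero (show N ≠ 0 by omega)
  exact div_ne_zero (neg_ne_zero.2 (mul_ne_zero h1 h2)) (pow_ne_zero _ h3)

theorem β_ne_zero {N : ℕ} : ∀ m < N, T.β N m ≠ 0 := by
  intro m hm
  exact pow_ne_zero _ (div_ne_zero (T.q_ne_zero (by omega)) (T.q_ne_zero (by omega)))

theorem sum_e (b N : ℕ) : ∑ i ∈ Finset.range (N + 1), T.e b N i = T.ff b N := by
  simp only [e]
  rw [Finset.sum_comm]
  simp only [← Finset.sum_smul]
  have : ∀ j ∈ Finset.range (N + 1), (∑ i ∈ Finset.range (N + 1), T.coeffE N i j) • T.h b N j =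
      if 0 = j then T.h b N j else 0 := by
    intro j hj
    have := sum_newton_mul_lagrange T.α_sub_α_ne_zero T.β_ne_zero (N := N) (j := 0) (j' := j)
      (by omega) (by have := Finset.mem_range.1 hj; omega)
    simp only [newton_zero, one_mul] at this
    rw [show ∑ i ∈ Finset.range (N + 1), T.coeffE N i j = _ from this]
    split_ifs <;> simp
  rw [Finset.sum_congr rfl this, Finset.sum_ite_eq]
  simp

theorem ff_mul_e (b N i : ℕ) : T.ff b N * T.e b N i = T.e b N i := by
  rw [e, Finset.mul_sum]
  simp only [mul_smul_comm, ff_mul_h]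

theorem h_one_mul_e {b N i : ℕ} (hN : N ≠ 0) :
    T.h b N 1 * T.e b N i = T.α N i • T.e b N i := by
  rw [e, Finset.mul_sum, Finset.smul_sum, ← sub_eq_zero, ← Finset.sum_sub_distrib]
  have h1 : ∀ j ∈ Finset.range (N + 1), T.h b N 1 * T.coeffE N i j • T.h b N j -
      T.α N i • T.coeffE N i j • T.h b N j =
      (T.coeffE N i j * (T.α N j - T.α N i)) • T.h b N j +
        (T.coeffE N i j * T.β N j) • T.h b N (j + 1) := by
    intro j hj
    rw [mul_smul_comm, T.h_one_mul_h hN (by have := Finset.mem_range.1 hj; omega), smul_add,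
      smul_smul, smul_smul, smul_smul, mul_sub, sub_smul, mul_comm (T.α N i)]
    abel
  rw [Finset.sum_congr rfl h1, Finset.sum_add_distrib, Finset.sum_range_succ', Finset.sum_range_succ
    (fun j => (T.coeffE N i j * T.β N j) • T.h b N (j + 1))]
  have h2 : T.coeffE N i 0 * (T.α N 0 - T.α N i) = 0 := by
    rcases i with - | i
    · simp
    · rw [coeffE, lagrange_of_lt _ _ (by omega), zero_mul]
  -- There is no term `h (N + 1)`; the remaining coefficients cancel by `lagrange_succ`.
  have h3 : T.β N N = 0 := by simp [β]
  rw [h2, h3, mul_zero, zero_smul, zero_smul, add_zero, add_zero, ← Finset.sum_add_distrib]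
  refine Finset.sum_eq_zero fun j hj => ?_
  rw [← add_smul]
  have := lagrange_succ (β := T.β N) T.α_sub_α_ne_zero (i := i) (Finset.mem_range.1 hj)
  rw [show T.coeffE N i (j + 1) * (T.α N (j + 1) - T.α N i) + T.coeffE N i j * T.β N j = 0 by
    simp only [coeffE]; linear_combination (-1) * this, zero_smul]

/-- As `h j` is a Newton polynomial in `h 1`, an eigenvector of `h 1` is one of every `h j`. An
arbitrary `x` is allowed, so that this applies both to `e i` and to the closing cups. -/
theorem h_mul_of_h_one_mul {b N i j : ℕ} {x : E} (hj : j ≤ N) (h0 : T.ff b N * x = x)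
    (h1 : T.h b N 1 * x = T.α N i • x) : T.h b N j * x = T.eta N j i • x := by
  induction j with
  | zero => rw [h_zero, h0, eta, newton_zero, one_smul]
  | succ j ih =>
    have hβ := T.β_ne_zero j (by omega : j < N)
    have ih := ih (by omega)
    have h2 : T.β N j • (T.h b N (j + 1) * x) = T.β N j • (T.eta N (j + 1) i • x) := by
      have : T.β N j • T.h b N (j + 1) = T.h b N 1 * T.h b N j - T.α N j • T.h b N j := by
        rw [T.h_one_mul_h (by omega) (by omega)]; abel
      rw [← smul_mul_assoc, this, sub_mul, smul_mul_assoc, ih, mul_assoc, ih, mul_smul_comm,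
        h1, smul_smul, smul_smul, smul_smul, ← sub_smul, eta, eta, newton_succ]
      congr 1
      field_simp
    have := congrArg (fun x => (T.β N j)⁻¹ • x) h2
    simpa only [smul_smul, ← mul_assoc, inv_mul_cancel₀ hβ, one_smul, one_mul] using this

theorem h_mul_e {b N i j : ℕ} (hj : j ≤ N) :
    T.h b N j * T.e b N i = T.eta N j i • T.e b N i := by
  rcases Nat.eq_zero_or_pos j with rfl | h
  · rw [h_zero, ff_mul_e, eta, newton_zero, one_smul]
  · exact T.h_mul_of_h_one_mul hj (T.ff_mul_e b N i) (T.h_one_mul_e (by omega))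

theorem e_mul_e {b N i i' : ℕ} (hi : i ≤ N) (hi' : i' ≤ N) :
    T.e b N i * T.e b N i' = if i = i' then T.e b N i' else 0 := by
  have h1 : ∀ j ∈ Finset.range (N + 1), T.coeffE N i j • T.h b N j * T.e b N i' =
      (T.coeffE N i j * T.eta N j i') • T.e b N i' := fun j hj => by
    rw [smul_mul_assoc, T.h_mul_e (Finset.mem_range_succ_iff.1 hj), smul_smul]
  rw [e, Finset.sum_mul, Finset.sum_congr rfl h1, ← Finset.sum_smul]
  have := sum_lagrange_mul_newton T.α_sub_α_ne_zero T.β_ne_zero hi hi'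
  rw [show ∑ j ∈ Finset.range (N + 1), T.coeffE N i j * T.eta N j i' = _ from this]
  split_ifs <;> simp

theorem h_eq_sum_e {N j : ℕ} (b : ℕ) (hj : j ≤ N) :
    T.h b N j = ∑ i ∈ Finset.range (N + 1), T.eta N j i • T.e b N i := by
  rw [← T.h_mul_ff b N j, ← sum_e, Finset.mul_sum]
  exact Finset.sum_congr rfl fun i _ => T.h_mul_e hj

end PlanarOps

end PretzelHead

namespace PretzelHead

namespace PlanarOps

variable {K E : Type*} [Field K] [Ring E] [Algebra K E] (T : PlanarOps K E)

/-! ### Crossings -/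

/-- A negative crossing. -/
def σ (i : ℕ) : E := T.a⁻¹ • 1 + T.a • T.U i

/-- A positive crossing. -/
def τ (i : ℕ) : E := T.a • 1 + T.a⁻¹ • T.U i

theorem loop_eq : T.loop = -(T.a ^ 2) - (T.a⁻¹) ^ 2 := by
  rw [loop, zpow_neg, inv_pow]; norm_cast

theorem commute_σ {x : E} {i : ℕ} (h : Commute x (T.U i)) : Commute x (T.σ i) :=
  ((Commute.one_right x).smul_right _).add_right (h.smul_right _)

theorem commute_τ {x : E} {i : ℕ} (h : Commute x (T.U i)) : Commute x (T.τ i) :=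
  ((Commute.one_right x).smul_right _).add_right (h.smul_right _)

theorem mul_τ_of_mul_U {x : E} {i j : ℕ} (h : x * T.U i = T.U j * x) :
    x * T.τ i = T.τ j * x := by
  rw [τ, τ, mul_add, add_mul, mul_smul_comm, mul_smul_comm, smul_mul_assoc, smul_mul_assoc, h,
    mul_one, one_mul]

theorem σ_mul_cup (i : ℕ) : T.σ i * T.cup i = -(T.a ^ 3) • T.cup i := by
  rw [σ, add_mul, smul_mul_assoc, smul_mul_assoc, U, mul_assoc, cap_cup_self, one_mul,
    ← Algebra.commutes, ← Algebra.smul_def, smul_smul, ← add_smul, loop_eq]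
  congr 1
  have := T.a_ne_zero
  field_simp
  ring

theorem σ_succ_mul_cup (i : ℕ) : T.σ (i + 1) * T.cup i = T.τ i * T.cup (i + 1) := by
  rw [σ, τ, add_mul, add_mul, smul_mul_assoc, smul_mul_assoc, smul_mul_assoc, smul_mul_assoc,
    U_succ_mul_cup, U_mul_cup_succ, one_mul, one_mul, add_comm]

theorem σ_mul_cup_succ (i : ℕ) : T.σ i * T.cup (i + 1) = T.τ (i + 1) * T.cup i := by
  rw [σ, τ, add_mul, add_mul, smul_mul_assoc, smul_mul_assoc, smul_mul_assoc, smul_mul_assoc,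
    U_succ_mul_cup, U_mul_cup_succ, one_mul, one_mul, add_comm]

/-- Expand the two crossings: all terms but one are multiples of `u`, and these cancel since `a⁻² +
loop + a² = 0`. Applied with the two generators in either order, this slides a generator past two
crossings. -/
theorem σ_σ_aux {u v : E} (hu : u * u = T.loop • u) (h : u * (v * u) = u) :
    (T.a⁻¹ • 1 + T.a • u) * (T.a⁻¹ • 1 + T.a • v) * u = v * u ∧
      u * ((T.a⁻¹ • 1 + T.a • v) * (T.a⁻¹ • 1 + T.a • u)) = u * v := by
  have ha := T.a_ne_zero
  have this : (T.a⁻¹ * T.a⁻¹) • u + (T.loop • u + (T.a * T.a) • u) = 0 := by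
    rw [← add_smul, ← add_smul, loop_eq]
    convert zero_smul K u using 2
    ring
  constructor
  · simp only [add_mul, mul_add, smul_mul_assoc, mul_smul_comm, one_mul, mul_one, smul_smul,
      smul_add, mul_assoc, hu, h]
    rw [inv_mul_cancel_left₀ ha, mul_inv_cancel₀ ha, one_smul]
    exact (by abel : _ = ((T.a⁻¹ * T.a⁻¹) • u + (T.loop • u + (T.a * T.a) • u)) + v * u).trans
      (by rw [this, zero_add])
  · simp only [add_mul, mul_add, smul_mul_assoc, mul_smul_comm, one_mul, mul_one, smul_smul,
      smul_add, mul_assoc, hu, h]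
    rw [mul_inv_cancel_left₀ ha, inv_mul_cancel₀ ha, one_smul]
    exact (by abel : _ = ((T.a⁻¹ * T.a⁻¹) • u + (T.loop • u + (T.a * T.a) • u)) + u * v).trans
      (by rw [this, zero_add])

theorem σ_succ_σ_mul_U (i : ℕ) : T.σ (i + 1) * T.σ i * T.U (i + 1) = T.U i * (T.σ (i + 1) * T.σ i) :=
  (T.σ_σ_aux (T.U_mul_U_self _) (T.U_succ_U_U i)).1.trans
    (T.σ_σ_aux (T.U_mul_U_self _) (T.U_U_U_succ i)).2.symm

theorem σ_σ_succ_mul_U (i : ℕ) : T.σ i * T.σ (i + 1) * T.U i = T.U (i + 1) * (T.σ i * T.σ (i + 1)) :=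
  (T.σ_σ_aux (T.U_mul_U_self _) (T.U_U_U_succ i)).1.trans
    (T.σ_σ_aux (T.U_mul_U_self _) (T.U_succ_U_U i)).2.symm

/-- A strand crossing `m` strands to its right. -/
def row (i : ℕ) : ℕ → E
  | 0 => 1
  | m + 1 => T.σ (i + m) * row i m

/-- A strand crossing `n` strands to its left. -/
def col (i : ℕ) : ℕ → E
  | 0 => 1
  | n + 1 => col i n * T.σ (i + n)

/-- The crossing of `n` strands with `m` strands to their right. -/
def block (b m : ℕ) : ℕ → E
  | 0 => 1
  | n + 1 => block b m n * T.row (b + n) m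

theorem commute_row {x : E} {i m : ℕ} (h : ∀ s < m, Commute x (T.U (i + s))) :
    Commute x (T.row i m) := by
  induction m with
  | zero => exact Commute.one_right x
  | succ m ih =>
    exact (T.commute_σ (h m (by omega))).mul_right (ih fun s hs => h s (by omega))

theorem commute_col {x : E} {i m : ℕ} (h : ∀ s < m, Commute x (T.U (i + s))) :
    Commute x (T.col i m) := by
  induction m with
  | zero => exact Commute.one_right x
  | succ m ih =>
    exact (ih fun s hs => h s (by omega)).mul_right (T.commute_σ (h m (by omega)))

theorem commute_block {x : E} {b m n : ℕ} (h : ∀ s, s + 1 < m + n → Commute x (T.U (b + s))) :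
    Commute x (T.block b m n) := by
  induction n with
  | zero => exact Commute.one_right x
  | succ n ih =>
    refine (ih fun s hs => h s (by omega)).mul_right (T.commute_row fun s hs => ?_)
    rw [add_assoc]
    exact h _ (by omega)

theorem commute_U_σ {i j : ℕ} (h : i + 2 ≤ j ∨ j + 2 ≤ i) : Commute (T.U i) (T.σ j) :=
  T.commute_σ (T.commute_U h)

theorem block_succ_left (b m n : ℕ) :
    T.block b (m + 1) n = T.col (b + m) n * T.block b m n := by
  induction n with
  | zero => simp [block, col]
  | succ n ih =>
    have h : Commute (T.σ (b + n + m)) (T.block b m n) := T.commute_block fun s hs =>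
      (T.commute_U_σ (by omega)).symm
    rw [block, block, col, row, ih, mul_assoc, ← mul_assoc (T.block b m n), ← h.eq,
      show b + n + m = b + m + n by ring]
    simp only [mul_assoc]

theorem row_mul_U {i m t : ℕ} (h : t + 1 < m) :
    T.row i m * T.U (i + t + 1) = T.U (i + t) * T.row i m := by
  induction m with
  | zero => omega
  | succ m ih =>
    rcases Nat.lt_or_ge (t + 1) m with h1 | h1
    · rw [row, mul_assoc, ih h1, ← mul_assoc, ← mul_assoc]
      congr 1
      exact (T.commute_U_σ (by omega)).symm.eq
    · obtain rfl : m = t + 1 := by omega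
      rw [row, row, mul_assoc, mul_assoc, ← (T.commute_row (i := i) (m := t)
        (x := T.U (i + t + 1)) fun s hs => T.commute_U (by omega)).eq, ← mul_assoc, ← mul_assoc,
        ← add_assoc i t 1, σ_succ_σ_mul_U]
      simp only [mul_assoc]

theorem col_mul_U {i n t : ℕ} (h : t + 1 < n) :
    T.col i n * T.U (i + t) = T.U (i + t + 1) * T.col i n := by
  induction n with
  | zero => omega
  | succ n ih =>
    rcases Nat.lt_or_ge (t + 1) n with h1 | h1
    · rw [col, mul_assoc, ← (T.commute_U_σ (by omega)).eq, ← mul_assoc, ih h1, mul_assoc]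
    · obtain rfl : n = t + 1 := by omega
      rw [col, col, ← add_assoc i t 1, mul_assoc, mul_assoc, ← mul_assoc (T.σ _), σ_σ_succ_mul_U,
        ← mul_assoc, ← (T.commute_col (i := i) (m := t)
        (x := T.U (i + t + 1)) fun s hs => T.commute_U (by omega)).eq]
      simp only [mul_assoc]

theorem block_mul_U_right {b m n t : ℕ} (h : t + 1 < m) :
    T.block b m n * T.U (b + n + t) = T.U (b + t) * T.block b m n := by
  induction n with
  | zero => simp [block]
  | succ n ih =>
    rw [block, mul_assoc, show b + (n + 1) + t = b + n + t + 1 by ring, T.row_mul_U h, ← mul_assoc,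
      ih, mul_assoc]

theorem block_mul_U_left {b m n t : ℕ} (h : t + 1 < n) :
    T.block b m n * T.U (b + t) = T.U (b + m + t) * T.block b m n := by
  induction m with
  | zero =>
    have : ∀ n, T.block b 0 n = 1 := fun n => by
      induction n with
      | zero => rfl
      | succ n ih => rw [block, ih, row, mul_one]
    simp [this]
  | succ m ih =>
    rw [block_succ_left, mul_assoc, ih, ← mul_assoc, T.col_mul_U h, mul_assoc]
    congr 2
    ring

theorem commute_block_ff (b N : ℕ) : Commute (T.block b N N) (T.ff b N) := by
  rw [ff, Commute, SemiconjBy, ← mul_assoc,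
    T.mul_jw_of_forall (b' := b + N) fun i hi => T.block_mul_U_left hi, mul_assoc,
    T.mul_jw_of_forall (b' := b) fun i hi => T.block_mul_U_right hi, ← mul_assoc,
    (T.commute_jw_adjacent b N N).eq]

theorem mul_τ_of_mul_U_eq_zero {x : E} {i : ℕ} (h : x * T.U i = 0) : x * T.τ i = T.a • x := by
  rw [τ, mul_add, mul_smul_comm, mul_smul_comm, h, smul_zero, add_zero, mul_one]

/-- The cup is pulled through the `n` strands one at a time; each crossing passes to the other leg
and changes its type. -/
theorem row_mul_cup (b n : ℕ) : T.row (b + 1) n * T.cup b =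
    ((List.range n).map fun s => T.τ (b + s)).prod * T.cup (b + n) := by
  induction n with
  | zero => simp [row]
  | succ n ih =>
    rw [row, mul_assoc, ih, List.range_succ, List.map_append, List.prod_append, ← mul_assoc]
    have h : Commute (T.σ (b + 1 + n)) ((List.range n).map fun s => T.τ (b + s)).prod := by
      refine Commute.list_prod_right _ _ fun y hy => ?_
      obtain ⟨s, hs, rfl⟩ := List.mem_map.1 hy
      exact T.commute_τ (T.commute_U_σ (by have := List.mem_range.1 hs; omega)).symm
    rw [h.eq, mul_assoc, show b + 1 + n = b + n + 1 by ring, σ_succ_mul_cup, List.map_singleton,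
      List.prod_singleton]
    simp only [mul_assoc, add_assoc]

theorem col_mul_cup (b n : ℕ) : T.col b n * T.cup (b + n) =
    ((List.range n).map fun s => T.τ (b + n - s)).prod * T.cup b := by
  induction n with
  | zero => simp [col]
  | succ n ih =>
    rw [col, mul_assoc, ← add_assoc b n 1, σ_mul_cup_succ, ← mul_assoc, ← (T.commute_col
      (x := T.τ (b + n + 1)) fun s hs => (T.commute_τ (T.commute_U (by omega))).symm).eq,
      mul_assoc, ih, List.range_succ_eq_map, List.map_cons, List.prod_cons, List.map_map, mul_assoc,
      Nat.sub_zero]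
    congr 4
    funext s
    simp only [Function.comp_apply]
    congr 1
    omega

theorem mul_list_prod_smul {x : E} {c : K} {l : List E} (h : ∀ y ∈ l, x * y = c • x) :
    x * l.prod = c ^ l.length • x := by
  induction l with
  | nil => simp
  | cons y l ih =>
    rw [List.prod_cons, ← mul_assoc, h y (by simp), smul_mul_assoc,
      ih fun z hz => h z (by simp [hz]), smul_smul, List.length_cons, pow_succ']

theorem mul_list_prod_τ {x : E} {n : ℕ} (f g : ℕ → ℕ) (h : ∀ s < n, x * T.τ (f s) = T.τ (g s) * x) :
    x * ((List.range n).map fun s => T.τ (f s)).prod =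
      ((List.range n).map fun s => T.τ (g s)).prod * x := by
  induction n with
  | zero => simp
  | succ n ih =>
    simp only [List.range_succ, List.map_append, List.prod_append, List.map_singleton,
      List.prod_singleton]
    rw [← mul_assoc, ih fun s hs => h s (by omega), mul_assoc, h n (by omega), mul_assoc]

/-- A crossing of two decorated bundles is absorbed by a turn. -/
theorem ff_mul_block_mul_cup (b n : ℕ) :
    T.ff b (n + 1) * T.block b (n + 1) (n + 1) * T.cup (b + n) =
      -(T.a ^ (2 * n + 3)) • (T.ff b (n + 1) * T.cup (b + n) * T.block b n n) := by
  -- The crossing next to the cup is a kink, worth `-a ^ 3`; the rest of the row reappears as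
  -- positive crossings beyond the cup.
  have h1 : T.row (b + n) (n + 1) * T.cup (b + n) = -(T.a ^ 3) •
      (((List.range n).map fun s => T.τ (b + n + s)).prod * T.cup (b + n + n)) := by
    rw [← row_mul_cup, ← mul_smul_comm, ← σ_mul_cup, ← mul_assoc]
    congr 1
    have : ∀ m i, T.row i (m + 1) = T.row (i + 1) m * T.σ i := fun m i => by
      induction m with
      | zero => simp [row]
      | succ m ih => rw [row, ih, row, mul_assoc, show i + (m + 1) = i + 1 + m by ring]
    exact this n _
  have h2 : T.block b (n + 1) n * ((List.range n).map fun s => T.τ (b + n + s)).prod =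
      ((List.range n).map fun s => T.τ (b + s)).prod * T.block b (n + 1) n :=
    T.mul_list_prod_τ (fun s => b + n + s) (fun s => b + s) fun s hs =>
      T.mul_τ_of_mul_U (T.block_mul_U_right (by omega))
  have h3 : T.block b (n + 1) n * T.cup (b + n + n) =
      ((List.range n).map fun s => T.τ (b + n + n - s)).prod * (T.cup (b + n) * T.block b n n) := by
    rw [block_succ_left, mul_assoc, ← (T.commute_block (x := T.cup (b + n + n)) fun s hs =>
      T.cup_mul_U_of_lt (by omega)).eq, ← mul_assoc, col_mul_cup, mul_assoc]
  -- A positive crossing inside one idempotent is the scalar `a`. There are `n` of them in each of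
  -- the two idempotents, which explains `2 * n` in the exponent.
  have h4 : T.ff b (n + 1) * ((List.range n).map fun s => T.τ (b + s)).prod =
      T.a ^ n • T.ff b (n + 1) := by
    have := mul_list_prod_smul (x := T.ff b (n + 1)) (c := T.a)
      (l := (List.range n).map fun s => T.τ (b + s)) fun y hy => by
        obtain ⟨s, hs, rfl⟩ := List.mem_map.1 hy
        have := List.mem_range.1 hs
        exact T.mul_τ_of_mul_U_eq_zero (T.ff_mul_U (by omega) (by omega) (by omega))
    simpa using this
  have h5 : T.ff b (n + 1) * ((List.range n).map fun s => T.τ (b + n + n - s)).prod =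
      T.a ^ n • T.ff b (n + 1) := by
    have := mul_list_prod_smul (x := T.ff b (n + 1)) (c := T.a)
      (l := (List.range n).map fun s => T.τ (b + n + n - s)) fun y hy => by
        obtain ⟨s, hs, rfl⟩ := List.mem_map.1 hy
        have := List.mem_range.1 hs
        exact T.mul_τ_of_mul_U_eq_zero (T.ff_mul_U (by omega) (by omega) (by omega))
    simpa using this
  rw [block, mul_assoc, mul_assoc, h1, mul_smul_comm, mul_smul_comm, ← mul_assoc (T.block _ _ _), h2,
    mul_assoc _ (T.block _ _ _), h3, ← mul_assoc, h4, smul_mul_assoc, ← mul_assoc, h5,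
    smul_mul_assoc, smul_smul, smul_smul, mul_assoc, mul_assoc]
  congr 1
  ring

theorem block_mul_of_forall {x : E} {b m n : ℕ} (h : ∀ s, s + 1 < m + n → T.U (b + s) * x = 0) :
    T.block b m n * x = (T.a⁻¹) ^ (m * n) • x := by
  have h1 : ∀ i m, (∀ s < m, T.U (i + s) * x = 0) → T.row i m * x = (T.a⁻¹) ^ m • x := by
    intro i m h
    induction m with
    | zero => simp [row]
    | succ m ih =>
      rw [row, mul_assoc, ih fun s hs => h s (by omega), mul_smul_comm, σ, add_mul, smul_mul_assoc,
        smul_mul_assoc, h m (by omega), smul_zero, add_zero, one_mul, smul_smul, pow_succ]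
  induction n with
  | zero => simp [block]
  | succ n ih =>
    rw [block, mul_assoc, h1 _ m fun s hs => by rw [add_assoc]; exact h _ (by omega),
      mul_smul_comm, ih fun s hs => h s (by omega), smul_smul, mul_add, pow_add, mul_one, mul_comm]

/-- The cups are absorbed from the inside outwards; the exponent is the sum of `2 n + 3` over `d ≤ n
< d + i`. -/
theorem ff_mul_block_mul_cups (b d i : ℕ) :
    T.ff b (d + i) * T.block b (d + i) (d + i) * T.cups (b + d) i =
      ((-1) ^ i * T.a ^ (i * (2 * d + i + 2))) •
        (T.ff b (d + i) * T.cups (b + d) i * T.block b d d) := by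
  induction i with
  | zero => simp
  | succ i ih =>
    rw [cups_succ, ← mul_assoc, ← add_assoc d i 1, add_assoc b d i, ff_mul_block_mul_cup,
      ← ff_mul_cup_mul_ff, smul_mul_assoc, mul_assoc, mul_assoc, ← mul_assoc (T.ff b (d + i)), ih,
      mul_smul_comm, smul_smul]
    congr 1
    · ring
    · rw [← mul_assoc, ← mul_assoc, ← mul_assoc, ff_mul_cup_mul_ff]

end PlanarOps

end PretzelHead

namespace PretzelHead

namespace PlanarOps

variable {K E : Type*} [Field K] [Ring E] [Algebra K E] (T : PlanarOps K E)

/-! ### The twist eigenvalues -/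

/-- The lower half of the idempotent `e`. -/
def eLower (b N i : ℕ) : E := ∑ t ∈ Finset.range (N - i + 1),
  T.coeffE N i (i + t) • (T.ff b (N - i) * T.cups (b + (N - i) - t) t * T.hd b N (i + t))

/-- Only `h j` with `j ≥ i` occur in `e i`, since the Lagrange coefficients are triangular; so `i`
cups can be split off from every term. -/
theorem e_eq {N i : ℕ} (b : ℕ) (hi : i ≤ N) :
    T.e b N i = T.ff b N * T.cups (b + (N - i)) i * T.eLower b N i := by
  obtain ⟨d, rfl⟩ := Nat.exists_eq_add_of_le' hi
  rw [e, eLower, Nat.add_sub_cancel, show d + i + 1 = i + (d + 1) by ring, Finset.sum_range_add,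
    Finset.sum_eq_zero fun j hj => by
      rw [coeffE, lagrange_of_lt _ _ (Finset.mem_range.1 hj), zero_smul], zero_add, Finset.mul_sum]
  refine Finset.sum_congr rfl fun t ht => ?_
  have := Finset.mem_range.1 ht
  rw [mul_smul_comm, ← mul_assoc, ← mul_assoc, ff_mul_cups_mul_ff, h, add_comm i t, T.cups_add _ t i,
    show b + (d + i) - (t + i) + t = b + d by omega, show b + (d + i) - (t + i) = b + d - t by omega]
  simp only [mul_assoc]

/-- The terms of the effect of a cap on the lower half. -/
def capTerm (b D i N : ℕ) : ℕ → E
  | 0 => 0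
  | t + 1 => T.ff b D * T.cups (b + D - t) t * T.hd b N (i + (t + 1))

theorem cap_mul_eLower_term {b N i D t : ℕ} (hN : N = i + (D + 1)) (ht : t ≤ D + 1) :
    T.cap (b + D) * (T.ff b (D + 1) * T.cups (b + (D + 1) - t) t * T.hd b N (i + t)) =
      T.α (D + 1) t • T.capTerm b D i N t + T.β (D + 1) t • T.capTerm b D i N (t + 1) := by
  rcases t with - | t
  · have h1 := T.ff_mul_hd (b := b) (N := N) (j := i) (by omega)
    have h2 := T.ff_mul_hd (b := b) (N := N) (j := i + 1) (by omega)
    have hq := T.q_ne_zero (Nat.succ_ne_zero D)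
    rw [show N - i = D + 1 by omega] at h1
    rw [show N - (i + 1) = D by omega] at h2
    simp only [Nat.succ_eq_add_one] at hq
    simp [capTerm, α, β, h1, h2, T.cap_mul_hd (b := b) (N := N) (j := i) (e := D) (by omega), hq]
  · obtain ⟨d, rfl⟩ := Nat.exists_eq_add_of_le' (show t ≤ D by omega)
    have e1 := T.cap_ff_cups b d t
    have e2 := T.turn_mul_hd (b := b) (N := N) (d := d) (j := i + (t + 1)) (t := t + 1) (by omega)
    rw [show b + (d + t + 1) - (t + 1) = b + d by omega, ← mul_assoc, ← mul_assoc, ← add_assoc, e1,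
      add_mul, smul_mul_assoc, smul_mul_assoc, capTerm, capTerm, show b + (d + t) - t = b + d by omega]
    congr 1
    rw [mul_assoc, β, show d + t + 1 - (t + 1) = d by omega, div_pow, div_eq_mul_inv,
        pow_two, mul_assoc, mul_comm (T.q d), ← smul_smul _ (T.q d), ← mul_smul_comm, e2,
        mul_smul_comm, smul_smul, mul_assoc (T.ff b (d + t)),
        show b + (d + t) - (t + 1) = b + d - 1 by omega]
    rfl

/-- The recursion of the Lagrange coefficients, rewritten with the `α` and `β` of `N - i` strands:
the differences `α N (i + t + 1) - α N i` are proportional to `α (N - i) (t + 1)`. -/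
theorem coeffE_succ {N i t : ℕ} (h : i + t < N) :
    T.coeffE N i (i + (t + 1)) * T.α (N - i) (t + 1) + T.coeffE N i (i + t) * T.β (N - i) t = 0 := by
  have h1 := lagrange_succ (β := T.β N) T.α_sub_α_ne_zero (i := i) h
  rw [← neg_sub (T.α N (i + t + 1)), T.α_sub_α (by omega) (by omega)] at h1
  have hq := T.q_ne_zero (show N ≠ 0 by omega)
  have hq' := T.q_ne_zero (show N - i ≠ 0 by omega)
  rw [coeffE, coeffE, α, β, ← add_assoc]
  rw [β, show N - (i + t) = N - i - t by omega, show i + t + 1 - i = t + 1 by omega,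
    show 2 * N + 1 - (i + t + 1) - i = 2 * (N - i) + 1 - (t + 1) by omega] at h1
  field_simp at h1 ⊢
  linear_combination (-1) * h1

/-- The middle cap turns each term of the lower half into two neighboring ones, and these telescope
by `coeffE_succ`. Consequently all generators on the `2 (N - i)` strands kill the lower half: `e i`
factors through the color `2 (N - i)`. -/
theorem cap_mul_eLower {b N i D : ℕ} (hN : N = i + (D + 1)) :
    T.cap (b + D) * T.eLower b N i = 0 := by
  rw [eLower, show N - i = D + 1 by omega, Finset.mul_sum]
  have h1 : ∀ t ∈ Finset.range (D + 1 + 1), T.cap (b + D) * T.coeffE N i (i + t) •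
      (T.ff b (D + 1) * T.cups (b + (D + 1) - t) t * T.hd b N (i + t)) =
      (T.coeffE N i (i + t) * T.α (D + 1) t) • T.capTerm b D i N t +
        (T.coeffE N i (i + t) * T.β (D + 1) t) • T.capTerm b D i N (t + 1) := by
    intro t ht
    rw [mul_smul_comm, T.cap_mul_eLower_term hN (by have := Finset.mem_range.1 ht; omega), smul_add,
      smul_smul, smul_smul]
  rw [Finset.sum_congr rfl h1, Finset.sum_add_distrib, Finset.sum_range_succ',
    Finset.sum_range_succ (fun t => (T.coeffE N i (i + t) * T.β (D + 1) t) • T.capTerm b D i N (t + 1))]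
  have h3 : T.β (D + 1) (D + 1) = 0 := by simp [β]
  rw [h3, mul_zero, zero_smul, add_zero, capTerm, smul_zero, add_zero, add_zero,
    ← Finset.sum_add_distrib]
  refine Finset.sum_eq_zero fun t ht => ?_
  have := Finset.mem_range.1 ht
  have h4 := T.coeffE_succ (N := N) (i := i) (t := t) (by omega)
  rw [show N - i = D + 1 by omega] at h4
  rw [← add_smul, h4, zero_smul]

theorem U_mul_eLower {b N i s : ℕ} (hi : i ≤ N) (hs : s + 1 < (N - i) + (N - i)) :
    T.U (b + s) * T.eLower b N i = 0 := by
  by_cases h : s + 1 = N - i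
  · rw [U, mul_assoc, T.cap_mul_eLower (by omega), mul_zero]
  · rw [eLower, Finset.mul_sum]
    refine Finset.sum_eq_zero fun t _ => ?_
    rw [mul_smul_comm, mul_assoc, ← mul_assoc, T.U_mul_ff (by omega) (by omega) (by omega),
      zero_mul, smul_zero]

/-- The eigenvalues of a half-twist. -/
def twist (N i : ℕ) : K :=
  (-1) ^ i * T.a ^ (i * (2 * (N - i) + i + 2)) * (T.a⁻¹) ^ ((N - i) * (N - i))

/-- The crossing commutes with `ff`, the `i` cups absorb part of it, and the remaining `(N - i) ^ 2`
crossings each act on `eLower` by the scalar `a⁻¹`. -/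
theorem block_mul_e {b N i : ℕ} (hi : i ≤ N) :
    T.block b N N * T.e b N i = T.twist N i • T.e b N i := by
  obtain ⟨d, rfl⟩ := Nat.exists_eq_add_of_le' hi
  have h1 : T.block b d d * T.eLower b (d + i) i = T.a⁻¹ ^ (d * d) • T.eLower b (d + i) i :=
    T.block_mul_of_forall fun s hs => T.U_mul_eLower (by omega) (by omega)
  rw [T.e_eq b hi, ← mul_assoc, ← mul_assoc, (T.commute_block_ff _ _).eq, Nat.add_sub_cancel,
    ff_mul_block_mul_cups, smul_mul_assoc, mul_assoc _ (T.block _ _ _), h1, mul_smul_comm,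
    smul_smul, twist, Nat.add_sub_cancel]

/-- The power of a half-twist between decorated bundles. -/
theorem block_pow_mul_ff (b N p : ℕ) : T.block b N N ^ p * T.ff b N =
    ∑ i ∈ Finset.range (N + 1), T.twist N i ^ p • T.e b N i := by
  rw [← sum_e, Finset.mul_sum]
  refine Finset.sum_congr rfl fun i hi => ?_
  have hi := Finset.mem_range_succ_iff.1 hi
  induction p with
  | zero => simp
  | succ p ih => rw [pow_succ', mul_assoc, ih, mul_smul_comm, T.block_mul_e hi, smul_smul, pow_succ]

/-- The coefficients of the power of a half-twist. -/
def twistCoeff (N p j : ℕ) : K := ∑ i ∈ Finset.range (N + 1), T.twist N i ^ p * T.coeffE N i j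

theorem block_pow_mul_ff_eq_sum_h (b N p : ℕ) : T.block b N N ^ p * T.ff b N =
    ∑ j ∈ Finset.range (N + 1), T.twistCoeff N p j • T.h b N j := by
  rw [block_pow_mul_ff]
  simp only [e, twistCoeff, Finset.smul_sum, Finset.sum_smul, smul_smul]
  exact Finset.sum_comm

end PlanarOps

end PretzelHead

namespace PretzelHead

namespace PlanarOps

variable {K E : Type*} [Field K] [Ring E] [Algebra K E] (T : PlanarOps K E)

/-! ### Distant elements -/

/-- A family of elements that are translates of each other to the right. -/
structure IsShift (x : ℕ → E) : Prop where
  cup_mul : ∀ j k, j ≤ k → T.cup j * x k = x (k + 2) * T.cup j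
  cap_mul : ∀ j k, j ≤ k → T.cap j * x (k + 2) = x k * T.cap j

variable {T}

theorem IsShift.cups_mul {x : ℕ → E} (hx : T.IsShift x) {b k : ℕ} (hb : b ≤ k) (n : ℕ) :
    T.cups b n * x k = x (k + 2 * n) * T.cups b n := T.cups_mul_of_le hx.cup_mul hb n

theorem IsShift.caps_mul {x : ℕ → E} (hx : T.IsShift x) {b k : ℕ} (hb : b ≤ k) (n : ℕ) :
    T.caps b n * x (k + 2 * n) = x k * T.caps b n := T.caps_mul_of_le hx.cap_mul hb n

theorem IsShift.mul {x y : ℕ → E} (hx : T.IsShift x) (hy : T.IsShift y) :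
    T.IsShift fun k => x k * y k where
  cup_mul j k h := by rw [← mul_assoc, hx.cup_mul j k h, mul_assoc, hy.cup_mul j k h, mul_assoc]
  cap_mul j k h := by rw [← mul_assoc, hx.cap_mul j k h, mul_assoc, hy.cap_mul j k h, mul_assoc]

theorem IsShift.smul {x : ℕ → E} (hx : T.IsShift x) (c : K) : T.IsShift fun k => c • x k where
  cup_mul j k h := by rw [mul_smul_comm, hx.cup_mul j k h, smul_mul_assoc]
  cap_mul j k h := by rw [mul_smul_comm, hx.cap_mul j k h, smul_mul_assoc]

theorem IsShift.sum {ι : Type*} {s : Finset ι} {x : ι → ℕ → E} (hx : ∀ i ∈ s, T.IsShift (x i)) :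
    T.IsShift fun k => ∑ i ∈ s, x i k where
  cup_mul j k h := by
    rw [Finset.mul_sum, Finset.sum_mul]
    exact Finset.sum_congr rfl fun i hi => (hx i hi).cup_mul j k h
  cap_mul j k h := by
    rw [Finset.mul_sum, Finset.sum_mul]
    exact Finset.sum_congr rfl fun i hi => (hx i hi).cap_mul j k h

theorem IsShift.add_right {x : ℕ → E} (hx : T.IsShift x) (m : ℕ) : T.IsShift fun k => x (k + m) where
  cup_mul j k h := by rw [hx.cup_mul j (k + m) (by omega), add_right_comm]
  cap_mul j k h := by rw [add_right_comm, hx.cap_mul j (k + m) (by omega)]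

theorem IsShift.commute_U {x : ℕ → E} (hx : T.IsShift x) {i k : ℕ} (h : i + 2 ≤ k) :
    Commute (x k) (T.U i) := by
  obtain ⟨k, rfl⟩ := Nat.exists_eq_add_of_le' h
  rw [U, Commute, SemiconjBy, ← mul_assoc, ← add_assoc, ← hx.cup_mul i (k + i) (by omega),
    mul_assoc, ← hx.cap_mul i (k + i) (by omega), mul_assoc]

theorem IsShift.commute_jw {x : ℕ → E} (hx : T.IsShift x) {b n k : ℕ} (h : b + n ≤ k) :
    Commute (x k) (T.jw b n) := T.commute_jw fun _ _ => hx.commute_U (by omega)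

variable (T)

theorem isShift_jw (n : ℕ) : T.IsShift fun k => T.jw k n := ⟨fun _ _ h => T.cup_mul_jw h, fun _ _ h => T.cap_mul_jw h⟩

theorem isShift_U : T.IsShift T.U := ⟨fun _ _ h => T.cup_mul_U h, fun _ _ h => T.cap_mul_U h⟩

theorem isShift_cups (n : ℕ) : T.IsShift fun k => T.cups k n :=
  ⟨fun _ _ h => T.cup_mul_cups h n, fun _ _ h => T.cap_mul_cups h n⟩

theorem isShift_caps (n : ℕ) : T.IsShift fun k => T.caps k n :=
  ⟨fun _ _ h => T.cup_mul_caps h n, fun _ _ h => T.cap_mul_caps h n⟩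

theorem isShift_ff (n : ℕ) : T.IsShift fun k => T.ff k n :=
  (T.isShift_jw n).mul ((T.isShift_jw n).add_right n)

theorem h_eq {b N j : ℕ} (hj : j ≤ N) : T.h b N j =
    T.ff b N * (T.cups (b + (N - j)) j * T.caps (b + (N - j)) j) * T.ff b N := by
  rw [h, hd, Nat.add_sub_assoc hj]
  simp only [mul_assoc]

theorem isShift_h {N j : ℕ} (hj : j ≤ N) : T.IsShift fun k => T.h k N j := by
  have : (fun k => T.h k N j) = fun k =>
      T.ff k N * (T.cups (k + (N - j)) j * T.caps (k + (N - j)) j) * T.ff k N :=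
    funext fun k => T.h_eq hj
  rw [this]
  exact ((T.isShift_ff N).mul (((T.isShift_cups j).add_right _).mul
    ((T.isShift_caps j).add_right _))).mul (T.isShift_ff N)

variable {T}

theorem IsShift.commute_cups_caps {x : ℕ → E} (hx : T.IsShift x) {b n k : ℕ} (h : b + 2 * n ≤ k) :
    Commute (x k) (T.cups b n * T.caps b n) := by
  obtain ⟨k, rfl⟩ := Nat.exists_eq_add_of_le' h
  rw [Commute, SemiconjBy, ← mul_assoc, ← add_assoc, ← hx.cups_mul (by omega), mul_assoc,
    ← hx.caps_mul (by omega), mul_assoc]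

theorem IsShift.commute_ff {x : ℕ → E} (hx : T.IsShift x) {b N k : ℕ} (h : b + 2 * N ≤ k) :
    Commute (x k) (T.ff b N) :=
  (hx.commute_jw (by omega)).mul_right (hx.commute_jw (by omega))

theorem IsShift.commute_h {x : ℕ → E} (hx : T.IsShift x) {b N j k : ℕ} (hj : j ≤ N)
    (h : b + 2 * N ≤ k) : Commute (x k) (T.h b N j) := by
  rw [T.h_eq hj]
  exact ((hx.commute_ff h).mul_right (hx.commute_cups_caps (by omega))).mul_right (hx.commute_ff h)

theorem IsShift.commute_row {x : ℕ → E} (hx : T.IsShift x) {b m n k : ℕ} (h : b + m + n ≤ k) :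
    Commute (x k) (T.block b m n) :=
  T.commute_block fun s hs => hx.commute_U (by omega)

variable (T)

/-! ### Rotation by a quarter turn -/

/-- Rotation of a tangle on the strands that follow the first `N` ones. -/
def rot (b N : ℕ) (x : E) : E := T.caps b N * x * T.cups (b + 2 * N) N

/-- A generator on the right legs of nested cups slides along two neighboring cups to the mirror
position on the left legs. -/
theorem U_mul_cups_symm (b j s : ℕ) :
    T.U (b + j + 2 + 2 * s) * T.cups b (j + 2 + s) = T.U (b + j) * T.cups b (j + 2 + s) := by
  have h1 : T.U (b + j + 2) * (T.cup (b + j + 1) * T.cup (b + j)) =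
      T.U (b + j) * (T.cup (b + j + 1) * T.cup (b + j)) := by
    rw [← mul_assoc, ← mul_assoc, U_succ_mul_cup, U_mul_cup_succ, T.cup_cup le_rfl]
  have h2 : T.cups b (j + 2 + s) =
      T.cups (b + j + 2) s * (T.cup (b + j + 1) * T.cup (b + j)) * T.cups b j := by
    rw [cups_add, cups_succ, cups_succ]
    simp only [mul_assoc, add_assoc]
  have h3 : Commute (T.cups (b + j + 2) s) (T.U (b + j)) :=
    T.commute_cups fun _ _ => T.cup_mul_U_of_lt (by omega)
  have h4 := T.cups_mul_U (b := b + j + 2) le_rfl s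
  set M := T.cup (b + j + 1) * T.cup (b + j)
  calc _ = (T.U (b + j + 2 + 2 * s) * T.cups (b + j + 2) s) * M * T.cups b j := by
        rw [h2]; simp only [mul_assoc]
    _ = T.cups (b + j + 2) s * (T.U (b + j + 2) * M) * T.cups b j := by
        rw [← h4]; simp only [mul_assoc]
    _ = (T.cups (b + j + 2) s * T.U (b + j)) * M * T.cups b j := by
        rw [h1]; simp only [mul_assoc]
    _ = _ := by rw [h3.eq, h2]; simp only [mul_assoc]

theorem caps_mul_U_symm (b j s : ℕ) :
    T.caps b (j + 2 + s) * T.U (b + j + 2 + 2 * s) = T.caps b (j + 2 + s) * T.U (b + j) := by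
  have h1 : T.cap (b + j) * T.cap (b + j + 1) * T.U (b + j + 2) =
      T.cap (b + j) * T.cap (b + j + 1) * T.U (b + j) := by
    rw [mul_assoc, mul_assoc, cap_mul_U_succ, cap_succ_mul_U, T.cap_cap le_rfl]
  have h2 : T.caps b (j + 2 + s) =
      T.caps b j * (T.cap (b + j) * T.cap (b + j + 1)) * T.caps (b + j + 2) s := by
    rw [caps_add, caps_succ, caps_succ]
    simp only [mul_assoc, add_assoc]
  have h3 : Commute (T.caps (b + j + 2) s) (T.U (b + j)) :=
    T.commute_caps fun _ _ => T.cap_mul_U_of_lt (by omega)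
  have h4 := T.caps_mul_U (b := b + j + 2) le_rfl s
  set M := T.cap (b + j) * T.cap (b + j + 1)
  calc _ = T.caps b j * M * (T.caps (b + j + 2) s * T.U (b + j + 2 + 2 * s)) := by
        rw [h2]; simp only [mul_assoc]
    _ = T.caps b j * (M * T.U (b + j + 2)) * T.caps (b + j + 2) s := by
        rw [h4]; simp only [mul_assoc]
    _ = T.caps b j * M * (T.U (b + j) * T.caps (b + j + 2) s) := by
        rw [h1]; simp only [mul_assoc]
    _ = _ := by rw [← h3.eq, h2]; simp only [mul_assoc]

theorem U_mul_cups_of_lt {b N s : ℕ} (h : s + 1 < N) :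
    T.U (b + N + s) * T.cups b N = T.U (b + (N - 2 - s)) * T.cups b N := by
  have := T.U_mul_cups_symm b (N - 2 - s) s
  rwa [show N - 2 - s + 2 + s = N by omega, show b + (N - 2 - s) + 2 + 2 * s = b + N + s by omega]
    at this

theorem caps_mul_U_of_lt {b N s : ℕ} (h : s + 1 < N) :
    T.caps b N * T.U (b + N + s) = T.caps b N * T.U (b + (N - 2 - s)) := by
  have := T.caps_mul_U_symm b (N - 2 - s) s
  rwa [show N - 2 - s + 2 + s = N by omega, show b + (N - 2 - s) + 2 + 2 * s = b + N + s by omega]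
    at this

theorem jw_right_mul_jw_left_mul_cups (b N : ℕ) :
    T.jw (b + N) N * (T.jw b N * T.cups b N) = T.jw b N * T.cups b N :=
  T.jw_mul_eq_self fun i hi => by
    rw [← mul_assoc, (T.commute_U_jw (by omega)).eq, mul_assoc, T.U_mul_cups_of_lt hi, ← mul_assoc,
      T.jw_mul_U (by omega) (by omega), zero_mul]

theorem jw_left_mul_jw_right_mul_cups (b N : ℕ) :
    T.jw b N * (T.jw (b + N) N * T.cups b N) = T.jw (b + N) N * T.cups b N :=
  T.jw_mul_eq_self fun i hi => by
    obtain ⟨s, hs⟩ : ∃ s, s + i + 2 = N := ⟨N - 2 - i, by omega⟩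
    have h1 := T.U_mul_cups_of_lt (b := b) (N := N) (s := s) (by omega)
    rw [show N - 2 - s = i by omega] at h1
    rw [← mul_assoc, (T.commute_U_jw (by omega)).eq, mul_assoc, ← h1, ← mul_assoc,
      T.jw_mul_U (by omega) (by omega), zero_mul]

/-- An idempotent slides along nested cups. Since generators do so, each leg's idempotent absorbs
that of the other leg; no mirror symmetry of the idempotent is required. -/
theorem jw_mul_cups_symm (b N : ℕ) : T.jw (b + N) N * T.cups b N = T.jw b N * T.cups b N := by
  rw [← jw_left_mul_jw_right_mul_cups, ← mul_assoc, (T.commute_jw_adjacent b N N).eq, mul_assoc,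
    jw_right_mul_jw_left_mul_cups]

theorem caps_mul_jw_right_mul_jw_left (b N : ℕ) :
    T.caps b N * T.jw (b + N) N * T.jw b N = T.caps b N * T.jw (b + N) N :=
  T.mul_jw_eq_self fun i hi => by
    obtain ⟨s, hs⟩ : ∃ s, s + i + 2 = N := ⟨N - 2 - i, by omega⟩
    have h1 := T.caps_mul_U_of_lt (b := b) (N := N) (s := s) (by omega)
    rw [show N - 2 - s = i by omega] at h1
    rw [mul_assoc, ← (T.commute_U_jw (by omega)).eq, ← mul_assoc, ← h1, mul_assoc,
      T.U_mul_jw (by omega) (by omega), mul_zero]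

theorem caps_mul_jw_left_mul_jw_right (b N : ℕ) :
    T.caps b N * T.jw b N * T.jw (b + N) N = T.caps b N * T.jw b N :=
  T.mul_jw_eq_self fun i hi => by
    rw [mul_assoc, ← (T.commute_U_jw (by omega)).eq, ← mul_assoc, T.caps_mul_U_of_lt hi, mul_assoc,
      T.U_mul_jw (by omega) (by omega), mul_zero]

theorem caps_mul_jw_symm (b N : ℕ) : T.caps b N * T.jw (b + N) N = T.caps b N * T.jw b N := by
  rw [← caps_mul_jw_right_mul_jw_left, mul_assoc, ← (T.commute_jw_adjacent b N N).eq, ← mul_assoc,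
    caps_mul_jw_left_mul_jw_right]

/-- Rotation commutes with the decoration by idempotents. -/
theorem rot_ff_mul_mul_ff (b N : ℕ) {x : E} (h1 : Commute (T.jw b N) x)
    (h2 : Commute (T.jw (b + 3 * N) N) x) :
    T.rot b N (T.ff (b + N) N * x * T.ff (b + N) N) = T.ff b N * T.rot b N x * T.ff b N := by
  have c1 : Commute (T.jw b N) (T.ff (b + N) N) :=
    (T.commute_jw_jw le_rfl).mul_right (T.commute_jw_jw (by omega))
  have c2 : Commute (T.jw (b + 3 * N) N) (T.ff (b + N) N) :=
    (T.commute_jw_jw (by omega)).symm.mul_right (T.commute_jw_jw (by omega)).symm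
  have c3 : Commute (T.jw b N) (T.cups (b + 2 * N) N) := (T.commute_cups_jw (by omega)).symm
  have c4 : Commute (T.jw (b + N) N) (T.cups (b + 2 * N) N) := (T.commute_cups_jw (by omega)).symm
  have e1 : T.caps b N * T.ff (b + N) N = T.jw b N * T.caps b N * T.jw b N := by
    rw [ff, ← mul_assoc, caps_mul_jw_symm, show b + N + N = b + 2 * N by ring, mul_assoc,
      (T.commute_jw_jw (by omega)).eq, ← mul_assoc, T.caps_mul_jw le_rfl]
  have e2 : T.ff (b + N) N * T.cups (b + 2 * N) N =
      T.jw (b + 3 * N) N * T.cups (b + 2 * N) N * T.jw (b + N) N := by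
    rw [ff, show b + N + N = b + 2 * N by ring, mul_assoc, ← T.jw_mul_cups_symm, ← mul_assoc,
      (T.commute_jw_jw (by omega)).eq, mul_assoc, c4.eq, show b + 2 * N + N = b + 3 * N by ring,
      mul_assoc]
  have e3 : T.caps b N * T.jw (b + 3 * N) N = T.jw (b + N) N * T.caps b N := by
    rw [show b + 3 * N = b + N + 2 * N by ring, T.caps_mul_jw (by omega)]
  calc T.rot b N (T.ff (b + N) N * x * T.ff (b + N) N)
      = (T.caps b N * T.ff (b + N) N) * x * (T.ff (b + N) N * T.cups (b + 2 * N) N) := by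
        rw [rot]; simp only [mul_assoc]
    _ = T.jw b N * T.caps b N * (T.jw b N * (x * T.jw (b + 3 * N) N)) * T.cups (b + 2 * N) N *
        T.jw (b + N) N := by rw [e1, e2]; simp only [mul_assoc]
    _ = T.jw b N * (T.caps b N * T.jw (b + 3 * N) N) * x * (T.jw b N * T.cups (b + 2 * N) N) *
        T.jw (b + N) N := by
        rw [← h2.eq, ← mul_assoc (T.jw b N), (T.commute_jw_jw (b := b) (by omega)).eq, mul_assoc _ _ x,
          h1.eq]
        simp only [mul_assoc]
    _ = _ := by
        rw [e3, c3.eq, ff, rot]; simp only [mul_assoc]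

/-- The `N - j` through strands on either side are bent into cups and caps, while the `j` cups and
caps are opened into through strands; the zigzags on the way are straightened. -/
theorem rot_cups_caps {b N j : ℕ} (hj : j ≤ N) :
    T.rot b N (T.cups (b + N + (N - j)) j * T.caps (b + N + (N - j)) j) =
      T.cups (b + j) (N - j) * T.caps (b + j) (N - j) := by
  obtain ⟨d, rfl⟩ := Nat.exists_eq_add_of_le hj
  rw [Nat.add_sub_cancel_left, rot, T.caps_add b j d, show b + 2 * (j + d) = b + j + d + d + j by ring,
    T.cups_add _ j d]
  have h1 : T.caps (b + j) d * T.cups (b + (j + d) + d) j = T.cups (b + j) j * T.caps (b + j) d := by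
    rw [← T.caps_mul_cups le_rfl]; congr 2; ring
  have h2 : T.caps (b + (j + d) + d) j * T.cups (b + j + d + d + j + j) d =
      T.cups (b + j + d + d) d * T.caps (b + j + d + d) j := by
    rw [← T.caps_mul_cups le_rfl, show b + (j + d) + d = b + j + d + d by ring]
    congr 2; ring
  calc _ = T.caps b j * (T.caps (b + j) d * T.cups (b + (j + d) + d) j) *
        (T.caps (b + (j + d) + d) j * T.cups (b + j + d + d + j + j) d) *
          T.cups (b + j + d + d + j) j := by simp only [mul_assoc]
    _ = (T.caps b j * T.cups (b + j) j) * (T.caps (b + j) d * T.cups (b + j + d + d) d) *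
        (T.caps (b + j + d + d) j * T.cups (b + j + d + d + j) j) := by
          rw [h1, h2]; simp only [mul_assoc]
    _ = _ := by
          rw [caps_mul_cups_right, caps_mul_cups_right, one_mul, mul_one,
            ← T.caps_mul_cups le_rfl]
          congr 2; ring

theorem rot_h {b N j : ℕ} (hj : j ≤ N) : T.rot b N (T.h (b + N) N j) = T.h b N (N - j) := by
  have h1 : Commute (T.jw b N) (T.cups (b + N + (N - j)) j * T.caps (b + N + (N - j)) j) :=
    (T.commute_cups_jw (by omega)).symm.mul_right (T.commute_caps_jw (by omega)).symm
  have h2 : Commute (T.jw (b + 3 * N) N) (T.cups (b + N + (N - j)) j * T.caps (b + N + (N - j)) j) :=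
    (T.isShift_jw N).commute_cups_caps (by omega)
  rw [T.h_eq hj, T.rot_ff_mul_mul_ff b N h1 h2, T.rot_cups_caps hj, T.h_eq (by omega),
    show N - (N - j) = j by omega]

/-- Horizontal composition becomes multiplication after rotation. -/
theorem caps_mul_rot_mul_rot_mul_cups (b N : ℕ) (x : E) {y : ℕ → E} (hx : Commute (T.caps (b + 3 * N) N) x)
    (hy : T.IsShift y) :
    T.caps (b + N) N * (T.rot b N x * T.rot (b + 2 * N) N (y (b + 2 * N + N))) * T.cups (b + N) N =
      T.rot b N (x * y (b + N)) := by
  have e1 : T.cups (b + 2 * N + 2 * N) N * T.cups (b + N) N =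
      T.cups (b + N) N * T.cups (b + 2 * N) N := by
    rw [T.cups_mul_cups (b := b + N) (k := b + 2 * N) (by omega)]
  have e2 : y (b + 2 * N + N) * T.cups (b + N) N = T.cups (b + N) N * y (b + N) := by
    rw [hy.cups_mul le_rfl, show b + 2 * N + N = b + N + 2 * N by ring]
  have e3 : T.caps (b + 2 * N) N * T.cups (b + N) N = 1 := by
    rw [← T.caps_mul_cups_left (b + N) N, show b + 2 * N = b + N + N by ring]
  have e4 : T.caps (b + N) N * T.caps b N = T.caps b N * T.caps (b + 3 * N) N := by
    rw [← T.caps_mul_caps (b := b) (k := b + N) (by omega), show b + 3 * N = b + N + 2 * N by ring]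
  have e5 : T.caps (b + 3 * N) N * T.cups (b + 2 * N) N = 1 := by
    rw [← T.caps_mul_cups_left (b + 2 * N) N, show b + 3 * N = b + 2 * N + N by ring]
  calc _ = (T.caps (b + N) N * T.caps b N) * x * T.cups (b + 2 * N) N * (T.caps (b + 2 * N) N *
        (y (b + 2 * N + N) * (T.cups (b + 2 * N + 2 * N) N * T.cups (b + N) N))) := by
          simp only [rot, mul_assoc]
    _ = T.caps b N * (T.caps (b + 3 * N) N * x) * T.cups (b + 2 * N) N *
        ((T.caps (b + 2 * N) N * T.cups (b + N) N) * (y (b + N) * T.cups (b + 2 * N) N)) := by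
          rw [e1, ← mul_assoc (y _), e2, e4]; simp only [mul_assoc]
    _ = T.caps b N * x * (T.caps (b + 3 * N) N * T.cups (b + 2 * N) N) *
        (y (b + N) * T.cups (b + 2 * N) N) := by
          rw [e3, hx.eq, one_mul]; simp only [mul_assoc]
    _ = _ := by rw [e5, mul_one, rot]; simp only [mul_assoc]

end PlanarOps

end PretzelHead

namespace PretzelHead

namespace PlanarOps

variable {K E : Type*} [Field K] [Ring E] [Algebra K E] (T : PlanarOps K E)

/-! ### Closures -/

/-- The value of the unknot. -/
def unknot (n : ℕ) : K := (-1) ^ n * T.q (n + 1)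

/-- The case `d = 0` of `cap_ff_cups`, where the second term disappears with `q 0`. Closing by all
`N` cups thus selects the channel `i = N`, of color `0`. -/
theorem h_one_mul_ff_mul_cups {b N : ℕ} (hN : N ≠ 0) :
    T.h b N 1 * (T.ff b N * T.cups b N) = T.α N N • (T.ff b N * T.cups b N) := by
  obtain ⟨j, rfl⟩ := Nat.exists_eq_succ_of_ne_zero hN
  have e1 := T.cap_ff_cups b 0 j
  simp only [add_zero, zero_add, q_zero, zero_div, ne_eq, OfNat.ofNat_ne_zero, not_false_eq_true,
    zero_pow, zero_smul] at e1
  have e2 := T.ff_mul_cup_mul_ff b j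
  rw [← mul_assoc, h_mul_ff, h, hd, Nat.succ_eq_add_one, ← add_assoc, Nat.add_sub_cancel, cups_succ,
    cups_zero, caps_succ, caps_zero, mul_one, one_mul, add_zero]
  rw [mul_assoc _ (T.cap _ * _), e1, mul_smul_comm, ← mul_assoc, e2, cups_succ, mul_assoc]

theorem h_mul_ff_mul_cups {b N j : ℕ} (hj : j ≤ N) :
    T.h b N j * (T.ff b N * T.cups b N) = T.eta N j N • (T.ff b N * T.cups b N) := by
  rcases Nat.eq_zero_or_pos j with rfl | h
  · rw [h_zero, ← mul_assoc, ff_mul_self, eta, newton_zero, one_smul]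
  · exact T.h_mul_of_h_one_mul hj (by rw [← mul_assoc, ff_mul_self])
      (T.h_one_mul_ff_mul_cups (by omega))

theorem α_self {N : ℕ} (hN : N ≠ 0) : T.α N N = -T.q (N + 1) / T.q N := by
  have := T.q_ne_zero hN
  rw [α, show 2 * N + 1 - N = N + 1 by omega]
  field_simp

/-- `cap_ff_cup` removes the innermost cap and cup, and the middle generator left over acts on the
remaining cups by `α N N`. -/
theorem caps_mul_ff_mul_cups (b N : ℕ) :
    T.caps b N * (T.ff b N * T.cups b N) = T.unknot N • 1 := by
  induction N with
  | zero => simp [ff, jw, unknot]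
  | succ N ih =>
    have h1 : T.caps b (N + 1) * (T.ff b (N + 1) * T.cups b (N + 1)) =
        T.caps b N * ((T.cap (b + N) * T.ff b (N + 1) * T.cup (b + N)) * T.cups b N) := by
      rw [cups_succ, caps_succ]; simp only [mul_assoc]
    have hq := T.q_ne_zero (Nat.succ_ne_zero N)
    have hl := T.loop_mul_q N
    rw [h1, cap_ff_cup, add_mul, smul_mul_assoc, smul_mul_assoc, mul_add, mul_smul_comm,
      mul_smul_comm, ih]
    simp only [Nat.succ_eq_add_one] at hq
    rcases N with - | n
    · simp only [q_zero, zero_div, ne_eq, OfNat.ofNat_ne_zero, not_false_eq_true, zero_pow,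
        zero_smul, add_zero, smul_smul, unknot]
      congr 1
      simp at hl ⊢
      rw [hl]
    · have h2 : T.ff b (n + 1) * T.U (b + (n + 1) - 1) * T.ff b (n + 1) * T.cups b (n + 1) =
          T.α (n + 1) (n + 1) • (T.ff b (n + 1) * T.cups b (n + 1)) := by
        rw [← T.h_one_mul_ff_mul_cups (by omega), h, hd, ← mul_assoc, U]
        simp only [cups_succ, cups_zero, caps_succ, caps_zero, mul_one, one_mul, add_zero, mul_assoc]
        rw [← mul_assoc (T.ff b (n + 1)) (T.ff b (n + 1)), ff_mul_self]
      have hq' := T.q_ne_zero (Nat.succ_ne_zero n)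
      simp only [Nat.succ_eq_add_one] at hq'
      rw [h2, mul_smul_comm, ih, smul_smul, smul_smul, smul_smul, ← add_smul, α_self _ (by omega),
        unknot, unknot]
      congr 1
      field_simp
      linear_combination (-1) ^ (n + 1) * hl

theorem eta_self {N j : ℕ} (hj : j ≤ N) : T.eta N j N = (-1) ^ j * (T.q (N + 1) / T.q (N + 1 - j)) := by
  induction j with
  | zero => simp [eta, T.q_ne_zero (Nat.succ_ne_zero N)]
  | succ j ih =>
    have h1 := T.q_ne_zero (show N + 1 - j ≠ 0 by omega)
    have h2 := T.q_ne_zero (show N - j ≠ 0 by omega)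
    have h3 := T.q_ne_zero (show N ≠ 0 by omega)
    rw [eta, newton_succ, ← eta, ih (by omega), T.α_sub_α le_rfl (by omega), β,
      show 2 * N + 1 - N - j = N + 1 - j by omega, show N + 1 - (j + 1) = N - j by omega]
    field_simp
    ring

theorem caps_mul_h_mul_cups {b N j : ℕ} (hj : j ≤ N) :
    T.caps b N * T.h b N j * T.cups b N = (T.unknot N * T.eta N j N) • 1 := by
  rw [← h_mul_ff, mul_assoc, mul_assoc, T.h_mul_ff_mul_cups hj, mul_smul_comm, caps_mul_ff_mul_cups,
    smul_smul, mul_comm]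

theorem q_mul_add (b s t : ℕ) :
    T.q (b + s) * T.q (b + t) - T.q b * T.q (b + s + t) = T.q s * T.q t := by
  have := T.q_mul_sub s t b
  rw [show s + b = b + s by ring, show t + b = b + t by ring, show s + t + b = b + s + t by ring] at this
  linear_combination this

theorem eta_eq {N j i : ℕ} (hi : i ≤ N) (hj : j ≤ i) : T.eta N j i =
    (-1) ^ j * ∏ m ∈ Finset.range j, T.q (i - m) * T.q (2 * N + 1 - i - m) / T.q (N - m) ^ 2 := by
  induction j with
  | zero => simp [eta]
  | succ j ih =>
    have h2 := T.q_ne_zero (show N - j ≠ 0 by omega)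
    have h3 := T.q_ne_zero (show N ≠ 0 by omega)
    rw [eta, newton_succ, ← eta, ih (by omega), T.α_sub_α hi (by omega), β, Finset.prod_range_succ]
    field_simp
    ring

/-- The right side telescopes in `n`: consecutive values share all factors but two on each side, and
these combine by `q_mul_add`. -/
theorem sum_mul_prod_q {N j n : ℕ} (hj : j ≤ N) (hn : n ≤ N + 1) :
    ∑ i ∈ Finset.range n, T.q (j + 1) * T.q (2 * (N - i) + 1) *
      ∏ m ∈ Finset.range j, T.q (i - m) * T.q (2 * N + 1 - i - m) =
    ∏ l ∈ Finset.range (j + 1), T.q (n - l) * T.q (2 * N + 2 - n - l) := by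
  induction n with
  | zero =>
    rw [Finset.prod_eq_zero (i := 0) (by simp) (by simp)]
    simp
  | succ i ih =>
    rw [Finset.sum_range_succ, ih (by omega)]
    rcases Nat.lt_or_ge i j with h | h
    · rw [Finset.prod_eq_zero (i := i) (by simp; omega) (by simp),
        Finset.prod_eq_zero (i := i) (Finset.mem_range.2 h) (by simp),
        Finset.prod_eq_zero (i := i + 1) (by simp; omega) (by simp)]
      simp
    · have e1 : ∏ l ∈ Finset.range (j + 1), T.q (i - l) * T.q (2 * N + 2 - i - l) =
          T.q (i - j) * T.q (2 * N + 2 - i) *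
            ∏ m ∈ Finset.range j, T.q (i - m) * T.q (2 * N + 1 - i - m) := by
        rw [Finset.prod_mul_distrib, Finset.prod_range_succ, Finset.prod_range_succ',
          Finset.prod_mul_distrib, Nat.sub_zero]
        simp only [show ∀ l, 2 * N + 2 - i - (l + 1) = 2 * N + 1 - i - l by omega]
        ring
      have e2 : ∏ l ∈ Finset.range (j + 1), T.q (i + 1 - l) * T.q (2 * N + 2 - (i + 1) - l) =
          T.q (i + 1) * T.q (2 * N + 1 - i - j) *
            ∏ m ∈ Finset.range j, T.q (i - m) * T.q (2 * N + 1 - i - m) := by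
        rw [Finset.prod_mul_distrib, Finset.prod_range_succ', Finset.prod_range_succ,
          Finset.prod_mul_distrib, Nat.sub_zero]
        simp only [show ∀ l, i + 1 - (l + 1) = i - l by omega,
          show ∀ l, 2 * N + 2 - (i + 1) - l = 2 * N + 1 - i - l by omega]
        ring
      have e3 := T.q_mul_add (i - j) (j + 1) (2 * (N - i) + 1)
      rw [show i - j + (j + 1) = i + 1 by omega,
        show i - j + (2 * (N - i) + 1) = 2 * N + 1 - i - j by omega,
        show i + 1 + (2 * (N - i) + 1) = 2 * N + 2 - i by omega] at e3
      rw [e1, e2]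
      linear_combination (-∏ m ∈ Finset.range j, T.q (i - m) * T.q (2 * N + 1 - i - m)) * e3

/-- The right side is the closure of `h (N - j)`, which is the rotation of `h j`. Inverting the
Newton matrix, one sees that the rotated `e i` must close to `[2 (N - i) + 1]`, the quantum
dimension of its channel up to sign. -/
theorem sum_q_mul_eta {N j : ℕ} (hj : j ≤ N) :
    ∑ i ∈ Finset.range (N + 1), T.q (2 * (N - i) + 1) * T.eta N j i =
      T.unknot N * T.eta N (N - j) N := by
  have h1 := T.sum_mul_prod_q hj le_rfl (N := N) (n := N + 1)
  have h2 := T.q_ne_zero (Nat.succ_ne_zero j)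
  have h3 : (∏ m ∈ Finset.range j, T.q (N - m) ^ 2) ≠ 0 :=
    Finset.prod_ne_zero_iff.2 fun m hm => pow_ne_zero _ (T.q_ne_zero (by
      have := Finset.mem_range.1 hm; omega))
  have h4 : ∀ i ∈ Finset.range (N + 1), T.q (2 * (N - i) + 1) * T.eta N j i =
      (-1) ^ j * (T.q (j + 1) * T.q (2 * (N - i) + 1) *
      ∏ m ∈ Finset.range j, T.q (i - m) * T.q (2 * N + 1 - i - m)) /
        (T.q (j + 1) * ∏ m ∈ Finset.range j, T.q (N - m) ^ 2) := by
    intro i hi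
    rcases Nat.lt_or_ge i j with h | h
    · rw [eta, newton_of_lt _ _ h, Finset.prod_eq_zero (i := i) (Finset.mem_range.2 h) (by simp)]
      simp
    · rw [T.eta_eq (by have := Finset.mem_range.1 hi; omega) h, Finset.prod_div_distrib]
      simp only [Nat.succ_eq_add_one] at h2
      field_simp
  rw [Finset.sum_congr rfl h4, ← Finset.sum_div, ← Finset.mul_sum, h1, Finset.prod_mul_distrib,
    T.eta_self (by omega), unknot, show N + 1 - (N - j) = j + 1 by omega,
    Finset.prod_range_succ']
  simp only [show ∀ l, N + 1 - (l + 1) = N - l by omega,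
    show ∀ l, 2 * N + 2 - (N + 1) - l = N + 1 - l by omega]
  rw [Finset.prod_range_succ', Finset.prod_pow]
  simp only [show ∀ l, N + 1 - (l + 1) = N - l by omega, Nat.sub_zero]
  rw [Finset.prod_pow] at h3
  simp only [Nat.succ_eq_add_one] at h2
  have h5 : (-1 : K) ^ (N - j) = (-1) ^ N * (-1) ^ j := by
    rw [← pow_add, show N + j = (N - j) + 2 * j by omega, pow_add, pow_mul]; simp
  have h6 : (-1 : K) ^ N * (-1) ^ N = 1 := by rw [← mul_pow]; simp
  have h7 := pow_ne_zero_iff (n := 2) (by norm_num) |>.1 h3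
  rw [h5]
  field_simp
  linear_combination (-(T.q (N + 1)) ^ 2) * h6

/-- The closure of an idempotent. -/
theorem caps_mul_rot_e_mul_cups {b N i : ℕ} (hi : i ≤ N) :
    T.caps b N * T.rot b N (T.e (b + N) N i) * T.cups b N = T.q (2 * (N - i) + 1) • 1 := by
  have h1 : T.rot b N (T.e (b + N) N i) =
      ∑ j ∈ Finset.range (N + 1), T.coeffE N i j • T.h b N (N - j) := by
    rw [rot, e, Finset.mul_sum, Finset.sum_mul]
    refine Finset.sum_congr rfl fun j hj => ?_
    rw [mul_smul_comm, smul_mul_assoc]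
    congr 1
    exact T.rot_h (Finset.mem_range_succ_iff.1 hj)
  have h2 : ∀ j ∈ Finset.range (N + 1), T.caps b N * T.coeffE N i j • T.h b N (N - j) * T.cups b N =
      (T.coeffE N i j * ∑ i' ∈ Finset.range (N + 1), T.q (2 * (N - i') + 1) * T.eta N j i') • 1 := by
    intro j hj
    rw [T.sum_q_mul_eta (Finset.mem_range_succ_iff.1 hj), mul_smul_comm, smul_mul_assoc,
      T.caps_mul_h_mul_cups (by omega), smul_smul]
  rw [h1, Finset.mul_sum, Finset.sum_mul, Finset.sum_congr rfl h2, ← Finset.sum_smul]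
  congr 1
  simp only [Finset.mul_sum]
  rw [Finset.sum_comm]
  have h3 : ∀ i' ∈ Finset.range (N + 1), ∑ j ∈ Finset.range (N + 1),
      T.coeffE N i j * (T.q (2 * (N - i') + 1) * T.eta N j i') =
      if i = i' then T.q (2 * (N - i') + 1) else 0 := by
    intro i' hi'
    have := sum_lagrange_mul_newton T.α_sub_α_ne_zero T.β_ne_zero hi (Finset.mem_range_succ_iff.1 hi')
    simp only [mul_left_comm (T.coeffE N i _), ← Finset.mul_sum]
    rw [show ∑ j ∈ Finset.range (N + 1), T.coeffE N i j * T.eta N j i' = _ from this]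
    simp
  rw [Finset.sum_congr rfl h3, Finset.sum_ite_eq, if_pos (Finset.mem_range_succ_iff.2 hi)]

/-! ### The bracket of a pretzel link -/

/-- The element with given eigenvalues. -/
def ofSpec (g : ℕ → K) (N b : ℕ) : E := ∑ i ∈ Finset.range (N + 1), g i • T.e b N i

theorem ofSpec_mul (g g' : ℕ → K) (N b : ℕ) :
    T.ofSpec g N b * T.ofSpec g' N b = T.ofSpec (g * g') N b := by
  rw [ofSpec, ofSpec, Finset.sum_mul_sum]
  refine Finset.sum_congr rfl fun i hi => ?_
  have h1 : ∀ i' ∈ Finset.range (N + 1), g i • T.e b N i * g' i' • T.e b N i' =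
      if i = i' then (g i * g' i) • T.e b N i else 0 := by
    intro i' hi'
    rw [smul_mul_assoc, mul_smul_comm, smul_smul, T.e_mul_e (Finset.mem_range_succ_iff.1 hi)
      (Finset.mem_range_succ_iff.1 hi')]
    split_ifs with h
    · rw [h]
    · simp
  rw [Finset.sum_congr rfl h1, Finset.sum_ite_eq, if_pos hi]
  rfl

theorem isShift_ofSpec (g : ℕ → K) (N : ℕ) : T.IsShift (T.ofSpec g N) :=
  IsShift.sum fun _ _ => (IsShift.sum fun _ hj => (T.isShift_h (Finset.mem_range_succ_iff.1 hj)).smul _).smul _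

variable {T} in
theorem IsShift.commute_ofSpec {x : ℕ → E} (hx : T.IsShift x) (g : ℕ → K) {b N k : ℕ}
    (h : b + 2 * N ≤ k) : Commute (x k) (T.ofSpec g N b) :=
  Commute.sum_right _ _ _ fun _ _ => (Commute.sum_right _ _ _ fun _ hj =>
    (hx.commute_h (Finset.mem_range_succ_iff.1 hj) h).smul_right _).smul_right _

/-- The eigenvalues of a rotated column of half-twists. -/
def spec (N p i : ℕ) : K := ∑ j ∈ Finset.range (N + 1), T.twistCoeff N p j * T.eta N (N - j) i

/-- Each `h j` in the expansion of the column is the rotation of `h (N - j)`, which is diagonal in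
the idempotents. -/
theorem block_pow_mul_ff_eq_rot (b N p : ℕ) :
    T.block b N N ^ p * T.ff b N = T.rot b N (T.ofSpec (T.spec N p) N (b + N)) := by
  have h1 : T.ofSpec (T.spec N p) N (b + N) =
      ∑ j ∈ Finset.range (N + 1), T.twistCoeff N p j • T.h (b + N) N (N - j) := by
    simp only [ofSpec, spec, Finset.sum_smul]
    rw [Finset.sum_comm]
    refine Finset.sum_congr rfl fun j _ => ?_
    rw [T.h_eq_sum_e _ (Nat.sub_le N j), Finset.smul_sum]
    simp only [smul_smul]
  rw [block_pow_mul_ff_eq_sum_h, h1, rot, Finset.mul_sum, Finset.sum_mul]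
  refine Finset.sum_congr rfl fun j hj => ?_
  have hj := Finset.mem_range_succ_iff.1 hj
  have h2 := T.rot_h (b := b) (Nat.sub_le N j)
  rw [rot, Nat.sub_sub_self hj] at h2
  rw [mul_smul_comm, smul_mul_assoc, h2]

theorem caps_mul_rot_ofSpec_mul_cups (g : ℕ → K) (b N : ℕ) :
    T.caps b N * T.rot b N (T.ofSpec g N (b + N)) * T.cups b N =
      (∑ i ∈ Finset.range (N + 1), g i * T.q (2 * (N - i) + 1)) • 1 := by
  rw [rot, ofSpec]
  simp only [Finset.mul_sum, Finset.sum_mul, Finset.sum_smul]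
  refine Finset.sum_congr rfl fun i hi => ?_
  rw [mul_smul_comm, smul_mul_assoc, mul_smul_comm, smul_mul_assoc, ← smul_smul,
    ← T.caps_mul_rot_e_mul_cups (b := b) (Finset.mem_range_succ_iff.1 hi)]
  rfl

theorem isShift_block (m n : ℕ) : T.IsShift fun k => T.block k m n := by
  have one : T.IsShift fun _ => (1 : E) := ⟨by simp, by simp⟩
  have hσ : T.IsShift T.σ := by
    have h1 := one.smul T.a⁻¹
    have h2 := T.isShift_U.smul T.a
    exact ⟨fun j k h => by rw [σ, σ, mul_add, add_mul, h1.cup_mul j k h, h2.cup_mul j k h],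
      fun j k h => by rw [σ, σ, mul_add, add_mul, h1.cap_mul j k h, h2.cap_mul j k h]⟩
  have hrow : T.IsShift fun k => T.row k m := by
    induction m with
    | zero => exact one
    | succ m ih => exact (hσ.add_right m).mul ih
  induction n with
  | zero => exact one
  | succ n ih => exact ih.mul (hrow.add_right n)

theorem jw_mul_cups_eq (b N : ℕ) : T.jw b N * T.cups b N = T.ff b N * T.cups b N := by
  rw [ff, mul_assoc, jw_mul_cups_symm, ← mul_assoc, jw_mul_self]

/-- The diagram carries one idempotent per cup, but each column needs one on both of its bundles.
Sliding along the cups duplicates them. -/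
theorem decorated_cups (b N : ℕ) :
    T.jw (b + 3 * N) N * T.cups (b + 3 * N) N * (T.jw (b + N) N * T.cups (b + N) N *
      (T.jw b N * T.cups b N)) = T.ff b N * (T.ff (b + 2 * N) N * (T.ff (b + 4 * N) N *
        (T.cups (b + 3 * N) N * (T.cups (b + N) N * T.cups b N)))) := by
  have e1 : T.jw (b + N) N * T.cups (b + N) N * (T.jw b N * T.cups b N) =
      T.ff b N * (T.ff (b + 2 * N) N * (T.cups (b + N) N * T.cups b N)) := by
    have c1 : T.cups (b + N) N * T.ff b N = T.jw b N * T.jw (b + 3 * N) N * T.cups (b + N) N := by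
      rw [ff, ← mul_assoc, (T.commute_cups_jw le_rfl).eq, mul_assoc, T.cups_mul_jw le_rfl, ← mul_assoc,
        show b + N + 2 * N = b + 3 * N by ring]
    have c2 : Commute (T.jw (b + N) N * T.jw (b + 2 * N) N) (T.jw b N) :=
      ((T.commute_jw_jw (by omega)).mul_right (T.commute_jw_jw (by omega))).symm
    rw [jw_mul_cups_eq, jw_mul_cups_eq, mul_assoc, ← mul_assoc (T.cups _ _), c1, ff,
      show b + N + N = b + 2 * N by ring, ff, ff, show b + 2 * N + N = b + 3 * N by ring]
    simp only [← mul_assoc]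
    rw [c2.eq]
    simp only [mul_assoc]
  have c1 : T.cups (b + 3 * N) N * T.ff b N = T.ff b N * T.cups (b + 3 * N) N :=
    ((T.commute_cups_jw (by omega)).mul_right (T.commute_cups_jw (by omega))).eq
  have c2 : T.cups (b + 3 * N) N * T.ff (b + 2 * N) N =
      T.jw (b + 2 * N) N * T.jw (b + 5 * N) N * T.cups (b + 3 * N) N := by
    rw [ff, ← mul_assoc, (T.commute_cups_jw (by omega)).eq, mul_assoc, T.cups_mul_jw (by omega),
      ← mul_assoc, show b + 2 * N + N + 2 * N = b + 5 * N by ring]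
  have c3 : Commute (T.ff (b + 3 * N) N) (T.ff b N) :=
    (T.isShift_ff N).commute_ff (by omega)
  have c4 : Commute (T.jw (b + 3 * N) N * T.jw (b + 4 * N) N) (T.jw (b + 2 * N) N) :=
      ((T.commute_jw_jw (by omega)).mul_right (T.commute_jw_jw (by omega))).symm
  rw [e1, jw_mul_cups_eq, mul_assoc, ← mul_assoc (T.cups _ _), c1, mul_assoc (T.ff b N),
    ← mul_assoc (T.cups _ _), c2, ← mul_assoc, c3.eq, mul_assoc, ff.eq_1 T (b + 3 * N),
    show b + 3 * N + N = b + 4 * N by ring, ff.eq_1 T (b + 2 * N),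
    show b + 2 * N + N = b + 3 * N by ring, ff.eq_1 T (b + 4 * N),
    show b + 4 * N + N = b + 5 * N by ring]
  simp only [← mul_assoc]
  rw [mul_assoc (T.ff b N) (T.jw _ _) (T.jw _ _), mul_assoc (T.ff b N), c4.eq]
  simp only [mul_assoc]

/-- The arcs between adjacent columns multiply the elements whose rotations the columns are, so
their eigenvalues multiply; the outer arc closes up the product. -/
theorem pretzel_eq (b N p₀ p₁ p₂ : ℕ) :
    T.caps b N * (T.caps (b + N) N * (T.caps (b + 3 * N) N *
      (T.block (b + 4 * N) N N ^ p₂ * (T.block (b + 2 * N) N N ^ p₁ * (T.block b N N ^ p₀ *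
      (T.jw (b + 3 * N) N * T.cups (b + 3 * N) N * (T.jw (b + N) N * T.cups (b + N) N *
      (T.jw b N * T.cups b N)))))))) =
    (∑ i ∈ Finset.range (N + 1),
      T.spec N p₀ i * T.spec N p₁ i * T.spec N p₂ i * T.q (2 * (N - i) + 1)) • 1 := by
  have hb := T.isShift_block N N
  have cb : ∀ {x : ℕ → E} {k l : ℕ}, T.IsShift x → k + 2 * N ≤ l → ∀ p, Commute (x l) (T.block k N N ^ p) :=
    fun hx h p => (hx.commute_row (by omega)).pow_right p
  set F₀ := T.ofSpec (T.spec N p₀) N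
  set F₁ := T.ofSpec (T.spec N p₁) N
  set F₂ := T.ofSpec (T.spec N p₂) N
  set R₀ := T.rot b N (F₀ (b + N)) with hR₀
  set R₁ := T.rot (b + 2 * N) N (F₁ (b + 2 * N + N)) with hR₁
  set R₂ := T.rot (b + 4 * N) N (F₂ (b + 4 * N + N)) with hR₂
  have e0 : T.block b N N ^ p₀ * T.ff b N = R₀ := T.block_pow_mul_ff_eq_rot b N p₀
  have e1 : T.block (b + 2 * N) N N ^ p₁ * T.ff (b + 2 * N) N = R₁ := T.block_pow_mul_ff_eq_rot _ N p₁
  have e2 : T.block (b + 4 * N) N N ^ p₂ * T.ff (b + 4 * N) N = R₂ := T.block_pow_mul_ff_eq_rot _ N p₂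
  have c0 : ∀ {x : ℕ → E} {l : ℕ}, T.IsShift x → b + 2 * N ≤ l → Commute (x l) R₀ := by
    intro x l hx hl
    rw [← e0]
    exact (cb hx hl p₀).mul_right (hx.commute_ff hl)
  have c1 : ∀ {x : ℕ → E} {l : ℕ}, T.IsShift x → b + 4 * N ≤ l → Commute (x l) R₁ := by
    intro x l hx hl
    rw [← e1]
    exact (cb hx (by omega) p₁).mul_right (hx.commute_ff (by omega))
  have s1 : T.block (b + 4 * N) N N ^ p₂ * (T.block (b + 2 * N) N N ^ p₁ * (T.block b N N ^ p₀ *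
      (T.ff b N * (T.ff (b + 2 * N) N * (T.ff (b + 4 * N) N *
        (T.cups (b + 3 * N) N * (T.cups (b + N) N * T.cups b N))))))) =
      R₀ * (R₁ * R₂) * (T.cups (b + 3 * N) N * (T.cups (b + N) N * T.cups b N)) := by
    rw [← mul_assoc (T.block b N N ^ p₀), e0, ← mul_assoc _ R₀,
      ((c0 hb (by omega)).pow_left p₁).eq, mul_assoc R₀, ← mul_assoc _ (T.ff (b + 2 * N) N), e1,
      ← mul_assoc _ R₀, ((c0 hb (by omega)).pow_left p₂).eq, mul_assoc R₀, ← mul_assoc _ R₁,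
      ((c1 hb (by omega)).pow_left p₂).eq, mul_assoc R₁, ← mul_assoc _ (T.ff (b + 4 * N) N), e2]
    simp only [mul_assoc]
  have s2 : T.caps (b + 3 * N) N * (R₁ * R₂) * T.cups (b + 3 * N) N =
      T.rot (b + 2 * N) N ((T.ofSpec (T.spec N p₁ * T.spec N p₂) N) (b + 2 * N + N)) := by
    have := T.caps_mul_rot_mul_rot_mul_cups (b + 2 * N) N (F₁ (b + 2 * N + N)) (y := F₂)
      ((T.isShift_caps N).commute_ofSpec _ (by omega)) (T.isShift_ofSpec _ N)
    rw [← ofSpec_mul]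
    rw [show b + 2 * N + 2 * N = b + 4 * N by ring] at this
    rw [← this, show b + 2 * N + N = b + 3 * N by ring, hR₁, hR₂,
      show b + 2 * N + N = b + 3 * N by ring]
  have s3 : T.caps (b + N) N * (R₀ * T.rot (b + 2 * N) N
      ((T.ofSpec (T.spec N p₁ * T.spec N p₂) N) (b + 2 * N + N))) * T.cups (b + N) N =
      T.rot b N (T.ofSpec (T.spec N p₀ * (T.spec N p₁ * T.spec N p₂)) N (b + N)) := by
    rw [← T.ofSpec_mul (T.spec N p₀)]
    exact T.caps_mul_rot_mul_rot_mul_cups b N (F₀ (b + N)) ((T.isShift_caps N).commute_ofSpec _ (by omega))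
      (T.isShift_ofSpec _ N)
  calc _ = T.caps b N * (T.caps (b + N) N * (T.caps (b + 3 * N) N * R₀ * (R₁ * R₂) *
        T.cups (b + 3 * N) N) * T.cups (b + N) N) * T.cups b N := by
        rw [decorated_cups, s1]; simp only [mul_assoc]
    _ = T.caps b N * (T.caps (b + N) N * (R₀ * (T.caps (b + 3 * N) N * (R₁ * R₂) *
        T.cups (b + 3 * N) N)) * T.cups (b + N) N) * T.cups b N := by
        rw [(c0 (T.isShift_caps N) (by omega)).eq]; simp only [mul_assoc]
    _ = _ := by
        rw [s2, s3, caps_mul_rot_ofSpec_mul_cups]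
        simp only [Pi.mul_apply, mul_assoc]

end PlanarOps

end PretzelHead

namespace PretzelHead

/-! ### The colored bracket of a pretzel link -/

theorem A_ne_zero : A ≠ 0 := HahnSeries.single_ne_zero one_ne_zero

theorem A_pow (n : ℕ) : A ^ n = HahnSeries.single (n : ℤ) (1 : ℚ) := by
  rw [A, HahnSeries.single_pow, one_pow, nsmul_eq_mul, mul_one]

theorem A_pow_ne_one (n : ℕ) (hn : n ≠ 0) : A ^ n ≠ 1 := by
  rw [A_pow, ← HahnSeries.single_zero_one]
  intro h
  have := congrArg (fun x => x.coeff 0) h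
  simp only [HahnSeries.coeff_single_same] at this
  rw [HahnSeries.coeff_single_of_ne (by exact_mod_cast hn.symm)] at this
  exact zero_ne_one this

/-- The cups and caps of the pairings of `ℕ`. -/
def matchingOps : PlanarOps Coeff (Module.End Coeff MatchingSkein) where
  a := A
  cup := cupMatching
  cap := capMatching
  a_ne_zero := A_ne_zero
  a_pow_ne_one := A_pow_ne_one
  isCupCap := isCupCap_matching

theorem matchingOps_a : matchingOps.a = A := rfl

theorem matchingOps_q (n : ℕ) : matchingOps.q n = qInt n := rfl

theorem corresponds_tlOp {k i : ℕ} (h : i + 2 ≤ k) :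
    Corresponds k k (tlOp i) (matchingOps.U i) := by
  obtain ⟨k, rfl⟩ := Nat.exists_eq_add_of_le' (show 2 ≤ k by omega)
  exact (corresponds_cupOp (by omega)).mul (corresponds_capOp (by omega))

theorem corresponds_crossOp {k i : ℕ} (h : i + 2 ≤ k) :
    Corresponds k k (crossOp i .negative) (matchingOps.σ i) :=
  (Corresponds.one.smul _).add ((corresponds_tlOp h).smul _)

theorem corresponds_jonesWenzl {k b n : ℕ} (h : b + n ≤ k) :
    Corresponds k k (jonesWenzl b n) (matchingOps.jw b n) := by
  induction n using Nat.strong_induction_on with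
  | _ n ih =>
    match n, ih with
    | 0, _ => exact Corresponds.one
    | 1, _ => exact Corresponds.one
    | n + 2, ih =>
      have h1 := ih (n + 1) (by omega) (by omega)
      exact h1.add (((h1.mul (corresponds_tlOp (by omega))).mul h1).smul _)

theorem corresponds_cupOp_prod {k b n : ℕ} (h : b ≤ k) : Corresponds k (k + 2 * n)
    ((List.range n).map fun j => cupOp (b + (n - 1 - j))).prod (matchingOps.cups b n) := by
  induction n with
  | zero => simpa using Corresponds.one
  | succ n ih =>
    rw [List.range_succ_eq_map, List.map_cons, List.prod_cons, List.map_map]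
    have h1 : ((fun j => cupOp (b + (n + 1 - 1 - j))) ∘ Nat.succ) =
        fun j => cupOp (b + (n - 1 - j)) := by
      funext j; simp only [Function.comp_apply]; congr 2; omega
    rw [h1]
    exact (corresponds_cupOp (k := k + 2 * n) (by omega)).mul ih

theorem corresponds_capOp_prod {k b n : ℕ} (h : b ≤ k) : Corresponds (k + 2 * n) k
    ((List.range n).map fun j => capOp (b + j)).prod (matchingOps.caps b n) := by
  induction n with
  | zero => simpa using Corresponds.one
  | succ n ih =>
    simp only [List.range_succ, List.map_append, List.prod_append, List.map_cons, List.map_nil,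
      List.prod_cons, List.prod_nil, mul_one]
    exact ih.mul (corresponds_capOp (k := k + 2 * n) (by omega))

theorem corresponds_coloredSlice_cup {N k i : ℕ} (h : N * i ≤ k) :
    Corresponds k (k + 2 * N) (coloredSlice N (.cup i))
      (matchingOps.jw (N * i) N * matchingOps.cups (N * i) N) :=
  (corresponds_jonesWenzl (by omega)).mul (corresponds_cupOp_prod h)

theorem corresponds_coloredSlice_cap {N k i : ℕ} (h : N * i ≤ k) :
    Corresponds (k + 2 * N) k (coloredSlice N (.cap i)) (matchingOps.caps (N * i) N) :=
  corresponds_capOp_prod h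

theorem PlanarOps.row_eq_prod {K E : Type*} [Field K] [Ring E] [Algebra K E] (T : PlanarOps K E)
    (i m : ℕ) : T.row i m = ((List.range m).map fun s => T.σ (i + (m - 1 - s))).prod := by
  induction m with
  | zero => rfl
  | succ m ih =>
    rw [List.range_succ_eq_map, List.map_cons, List.prod_cons, List.map_map, row, ih]
    congr 3
    funext j
    simp only [Function.comp_apply]
    congr 2
    omega

theorem PlanarOps.block_eq_prod {K E : Type*} [Field K] [Ring E] [Algebra K E] (T : PlanarOps K E)
    (b m n : ℕ) : T.block b m n = ((List.range n).map fun r => T.row (b + r) m).prod := by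
  induction n with
  | zero => rfl
  | succ n ih => simp [block, List.range_succ, ih]

theorem corresponds_coloredSlice_cross {N k i : ℕ} (h : N * i + 2 * N ≤ k) :
    Corresponds k k (coloredSlice N (.cross i .negative)) (matchingOps.block (N * i) N N) := by
  rw [PlanarOps.block_eq_prod]
  refine Corresponds.prod_range N fun r hr => ?_
  rw [PlanarOps.row_eq_prod]
  exact Corresponds.prod_range N fun s hs => corresponds_crossOp (by omega)

theorem foldl_replicate (f : Slice → Module.End Coeff Skein) (s : Slice) (n : ℕ) (v : Skein) :
    (List.replicate n s).foldl (fun v s => f s v) v = (f s ^ n) v := by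
  induction n generalizing v with
  | zero => simp
  | succ n ih => rw [List.replicate_succ, List.foldl_cons, ih, pow_succ, Module.End.mul_apply]

theorem isPairing_id : IsPairing 0 id :=
  ⟨by simp, by simp, by simp, by simp⟩

theorem eq_smul_emptySkein {v : Skein} (hv : v ∈ pairingSkein 0) : v = v id • emptySkein := by
  have h1 : pairingSkein 0 ≤ Submodule.span Coeff {emptySkein} := by
    refine Submodule.span_mono ?_
    rintro _ ⟨π, hπ, rfl⟩
    rw [show π = id from funext fun j => hπ.fix j (Nat.zero_le j)]
    rfl
  obtain ⟨c, rfl⟩ := Submodule.mem_span_singleton.1 (h1 hv)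
  simp [emptySkein]

/-- Without boundary points the skein is spanned by the empty tangle, so a scalar found in the model
of pairings is the bracket. -/
theorem apply_emptySkein_of_corresponds {x : Module.End Coeff Skein} {c : Coeff}
    (h : Corresponds 0 0 x (c • 1)) : x emptySkein id = c := by
  obtain ⟨h1, h2⟩ := h emptySkein (single_mem_pairingSkein isPairing_id 1)
  rw [eq_smul_emptySkein h1, map_smul, LinearMap.smul_apply, Module.End.one_apply, emptySkein,
    padSkein_single isPairing_id, Finsupp.smul_single, Finsupp.smul_single] at h2
  have := Finsupp.single_injective _ h2
  simpa [emptySkein] using this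

theorem coloredBracket_pretzel (N : ℕ) (p : Fin 3 → ℕ) : coloredBracket N (pretzel p) =
    ∑ i ∈ Finset.range (N + 1), matchingOps.spec N (p 0) i * matchingOps.spec N (p 1) i *
      matchingOps.spec N (p 2) i * qInt (2 * (N - i) + 1) := by
  have h1 : coloredBracket N (pretzel p) = (coloredSlice N (.cap 0) * (coloredSlice N (.cap 1) *
      (coloredSlice N (.cap 3) * (coloredSlice N (.cross 4 .negative) ^ p 2 *
      (coloredSlice N (.cross 2 .negative) ^ p 1 * (coloredSlice N (.cross 0 .negative) ^ p 0 *
      (coloredSlice N (.cup 3) * (coloredSlice N (.cup 1) * coloredSlice N (.cup 0))))))))) 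
        emptySkein id := by
    rw [coloredBracket, pretzel]
    simp only [List.foldl_append, List.foldl_cons, List.foldl_nil, foldl_replicate,
      Module.End.mul_apply]
  rw [h1]
  apply apply_emptySkein_of_corresponds
  have h2 := matchingOps.pretzel_eq 0 N (p 0) (p 1) (p 2)
  simp only [matchingOps_q] at h2
  rw [← h2]
  have cup0 := corresponds_coloredSlice_cup (N := N) (k := 0) (i := 0) (by omega)
  have cup1 := corresponds_coloredSlice_cup (N := N) (k := 0 + 2 * N) (i := 1) (by omega)
  have cup3 := corresponds_coloredSlice_cup (N := N) (k := 0 + 2 * N + 2 * N) (i := 3) (by omega)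
  have cross0 := corresponds_coloredSlice_cross (N := N) (k := 0 + 2 * N + 2 * N + 2 * N) (i := 0)
    (by omega)
  have cross2 := corresponds_coloredSlice_cross (N := N) (k := 0 + 2 * N + 2 * N + 2 * N) (i := 2)
    (by omega)
  have cross4 := corresponds_coloredSlice_cross (N := N) (k := 0 + 2 * N + 2 * N + 2 * N) (i := 4)
    (by omega)
  have cap3 := corresponds_coloredSlice_cap (N := N) (k := 0 + 2 * N + 2 * N) (i := 3) (by omega)
  have cap1 := corresponds_coloredSlice_cap (N := N) (k := 0 + 2 * N) (i := 1) (by omega)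
  have cap0 := corresponds_coloredSlice_cap (N := N) (k := 0) (i := 0) (by omega)
  have e3 : 0 + 3 * N = N * 3 := by ring
  have e4 : 0 + 4 * N = N * 4 := by ring
  have e2 : 0 + 2 * N = N * 2 := by ring
  have e1 : 0 + N = N * 1 := by ring
  rw [e1, e2, e3, e4]
  exact cap0.mul (cap1.mul (cap3.mul ((cross4.pow _).mul ((cross2.pow _).mul ((cross0.pow _).mul
    (cup3.mul (cup1.mul cup0)))))))

end PretzelHead

namespace PretzelHead

/-! ### The `q`-Chu–Vandermonde sum -/

section

variable {K : Type*} [Field K]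

/-- The Gaussian binomial coefficients. -/
def gaussBinom (x : K) : ℕ → ℕ → K
  | _, 0 => 1
  | 0, _ + 1 => 0
  | n + 1, j + 1 => gaussBinom x n (j + 1) * x ^ (j + 1) + gaussBinom x n j

theorem gaussBinom_mul_prod (x : K) (n j : ℕ) :
    gaussBinom x n j * ∏ m ∈ Finset.range j, (1 - x ^ (m + 1)) =
      ∏ m ∈ Finset.range j, (1 - x ^ (n - m)) := by
  induction n generalizing j with
  | zero =>
    rcases j with - | j
    · simp [gaussBinom]
    · rw [gaussBinom, zero_mul, Finset.prod_eq_zero (i := 0) (by simp) (by simp)]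
  | succ n ih =>
    rcases j with - | j
    · simp [gaussBinom]
    · have h1 := ih j
      have h2 := ih (j + 1)
      rw [Finset.prod_range_succ, Finset.prod_range_succ _ j] at h2
      rw [gaussBinom, Finset.prod_range_succ, Finset.prod_range_succ' (fun m => 1 - x ^ (n + 1 - m))]
      simp only [Nat.add_sub_add_right, Nat.sub_zero]
      rcases Nat.lt_or_ge n j with h | h
      · have h0 : ∏ m ∈ Finset.range j, (1 - x ^ (n - m)) = 0 :=
          Finset.prod_eq_zero (Finset.mem_range.2 h) (by simp)
        rw [h0] at h1 h2 ⊢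
        linear_combination x ^ (j + 1) * h2 + (1 - x ^ (j + 1)) * h1
      · have h3 : x ^ (n + 1) = x ^ (j + 1) * x ^ (n - j) := by rw [← pow_add]; congr 1; omega
        rw [h3]
        linear_combination x ^ (j + 1) * h2 + (1 - x ^ (j + 1)) * h1

theorem gaussBinom_of_lt (x : K) {n j : ℕ} (h : n < j) : gaussBinom x n j = 0 := by
  induction n generalizing j with
  | zero =>
    obtain ⟨j, rfl⟩ := Nat.exists_eq_succ_of_ne_zero (by omega : j ≠ 0)
    rfl
  | succ n ih =>
    obtain ⟨j, rfl⟩ := Nat.exists_eq_succ_of_ne_zero (by omega : j ≠ 0)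
    rw [Nat.succ_eq_add_one, gaussBinom, ih (by omega), ih (by omega), zero_mul, add_zero]

/-- Induction on `n` with `c` replaced by `c * x⁻¹`. The Pascal rule makes the sum for `n + 1` a
difference of two sums for `n`, and shifting `c` changes the products by the quotient `(1 - c) / (1
- c * x⁻¹ ^ j)`, which produces the same difference (`e4`). -/
theorem sum_gaussBinom {x : K} (hx : x ≠ 0) (n : ℕ) (b c : K) (hc0 : c ≠ 0)
    (hc : ∀ m < n, 1 - c * x⁻¹ ^ m ≠ 0) :
    ∑ j ∈ Finset.range (n + 1), gaussBinom x n j * (-1) ^ j * x ^ (j.choose 2) *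
      ∏ m ∈ Finset.range j, ((1 - b * x⁻¹ ^ m) / (1 - c * x⁻¹ ^ m)) =
    ∏ m ∈ Finset.range n, ((c - b * x ^ m) / (c - x ^ m)) := by
  induction n generalizing c with
  | zero => simp [gaussBinom]
  | succ n ih =>
    have hc1 : 1 - c ≠ 0 := by simpa using hc 0 (by omega)
    have ih := ih (c * x⁻¹) (mul_ne_zero hc0 (inv_ne_zero hx)) fun m hm => by
      have := hc (m + 1) (by omega)
      rwa [pow_succ', ← mul_assoc] at this
    have h1 : ∏ m ∈ Finset.range (n + 1), ((c - b * x ^ m) / (c - x ^ m)) =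
        (b - c) / (1 - c) * ∏ m ∈ Finset.range n, ((c * x⁻¹ - b * x ^ m) / (c * x⁻¹ - x ^ m)) := by
      rw [Finset.prod_range_succ', mul_comm]
      congr 1
      · rw [pow_zero, mul_one, ← neg_sub b c, ← neg_sub 1 c, neg_div_neg_eq]
      · refine Finset.prod_congr rfl fun m _ => ?_
        rw [← mul_div_mul_right (c * x⁻¹ - b * x ^ m) (c * x⁻¹ - x ^ m) hx]
        congr 1
        · field_simp; ring
        · field_simp; ring
    rw [h1, ← ih, Finset.sum_range_succ']
    set t : ℕ → K := fun j => ∏ m ∈ Finset.range j, ((1 - b * x⁻¹ ^ m) / (1 - c * x⁻¹ ^ m)) with ht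
    have h2 : ∀ j ∈ Finset.range (n + 1), gaussBinom x (n + 1) (j + 1) * (-1) ^ (j + 1) *
        x ^ ((j + 1).choose 2) * t (j + 1) =
        gaussBinom x n (j + 1) * (-1) ^ (j + 1) * x ^ ((j + 1).choose 2) * x ^ (j + 1) * t (j + 1) -
          gaussBinom x n j * (-1) ^ j * x ^ (j.choose 2) * x ^ j * t (j + 1) := by
      intro j _
      rw [gaussBinom, Nat.choose_succ_succ' j 1, Nat.choose_one_right, pow_add x j]
      ring
    rw [Finset.sum_congr rfl h2, Finset.sum_sub_distrib]
    have h3 := Finset.sum_range_succ' (fun j =>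
      gaussBinom x n j * (-1) ^ j * x ^ (j.choose 2) * x ^ j * t j) (n + 1)
    rw [Finset.sum_range_succ, gaussBinom_of_lt x (Nat.lt_succ_self n)] at h3
    have h4 : ∀ j ∈ Finset.range (n + 1), (b - c) / (1 - c) * (gaussBinom x n j * (-1) ^ j *
        x ^ (j.choose 2) * ∏ m ∈ Finset.range j, ((1 - b * x⁻¹ ^ m) / (1 - c * x⁻¹ * x⁻¹ ^ m))) =
        gaussBinom x n j * (-1) ^ j * x ^ (j.choose 2) * x ^ j * t j -
        gaussBinom x n j * (-1) ^ j * x ^ (j.choose 2) * x ^ j * t (j + 1) := by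
      intro j hj
      have hj := Finset.mem_range.1 hj
      have e1 : ∏ m ∈ Finset.range j, ((1 - b * x⁻¹ ^ m) / (1 - c * x⁻¹ * x⁻¹ ^ m)) =
          t j * ((1 - c) / (1 - c * x⁻¹ ^ j)) := by
        have e2 : ∏ m ∈ Finset.range (j + 1), (1 - c * x⁻¹ ^ m) =
            (1 - c) * ∏ m ∈ Finset.range j, (1 - c * x⁻¹ * x⁻¹ ^ m) := by
          rw [Finset.prod_range_succ', mul_comm]
          simp [pow_succ', mul_assoc]
        rw [Finset.prod_range_succ] at e2
        have n1 : ∏ m ∈ Finset.range j, (1 - c * x⁻¹ ^ m) ≠ 0 :=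
          Finset.prod_ne_zero_iff.2 fun m hm => hc m (by have := Finset.mem_range.1 hm; omega)
        have n2 : ∏ m ∈ Finset.range j, (1 - c * x⁻¹ * x⁻¹ ^ m) ≠ 0 :=
          Finset.prod_ne_zero_iff.2 fun m hm => by
            have := hc (m + 1) (by have := Finset.mem_range.1 hm; omega)
            rwa [pow_succ', ← mul_assoc] at this
        have n3 := hc j (by omega)
        simp only [ht]
        rw [Finset.prod_div_distrib, Finset.prod_div_distrib, div_mul_div_comm, div_eq_div_iff n2
          (mul_ne_zero n1 n3)]
        linear_combination (∏ m ∈ Finset.range j, (1 - b * x⁻¹ ^ m)) * e2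
      have n3 := hc j (by omega)
      have e3 : t (j + 1) = t j * ((1 - b * x⁻¹ ^ j) / (1 - c * x⁻¹ ^ j)) :=
        Finset.prod_range_succ _ _
      have e4 : (b - c) / (1 - c) * ((1 - c) / (1 - c * x⁻¹ ^ j)) =
          x ^ j * (1 - (1 - b * x⁻¹ ^ j) / (1 - c * x⁻¹ ^ j)) := by
        have e5 : x ^ j * x⁻¹ ^ j = 1 := by rw [← mul_pow, mul_inv_cancel₀ hx, one_pow]
        rw [div_mul_div_cancel₀ hc1, one_sub_div n3, mul_div_assoc']
        congr 1
        linear_combination (c - b) * e5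
      rw [e1, e3]
      linear_combination (gaussBinom x n j * (-1) ^ j * x ^ (j.choose 2) * t j) * e4
    rw [Finset.mul_sum, Finset.sum_congr rfl h4, Finset.sum_sub_distrib]
    simp only [gaussBinom, pow_zero, mul_one, Nat.choose_zero_succ] at h3 ⊢
    linear_combination (-1) * h3

end

namespace PlanarOps

variable {K E : Type*} [Field K] [Ring E] [Algebra K E] (T : PlanarOps K E)

/-! ### The eigenvalues of a rotated half-twist -/

/-- The change of basis between the idempotents and their rotations. -/
def gram (N l i : ℕ) : K := ∑ j ∈ Finset.range (N + 1), T.coeffE N l j * T.eta N (N - j) i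

theorem spec_eq (N p i : ℕ) :
    T.spec N p i = ∑ l ∈ Finset.range (N + 1), T.twist N l ^ p * T.gram N l i := by
  simp only [spec, twistCoeff, gram, Finset.sum_mul, Finset.mul_sum]
  rw [Finset.sum_comm]
  simp only [mul_assoc]

/-- The symmetric Gaussian binomial coefficients. -/
def binom (N j : ℕ) : K := ∏ m ∈ Finset.range j, T.q (N - m) / T.q (m + 1)

theorem binom_symm {N j : ℕ} (hj : j ≤ N) : T.binom N (N - j) = T.binom N j := by
  have h : ∀ j ≤ N, T.binom N j * ((∏ m ∈ Finset.range j, T.q (m + 1)) *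
      ∏ m ∈ Finset.range (N - j), T.q (m + 1)) = ∏ m ∈ Finset.range N, T.q (m + 1) := by
    intro j hj
    induction j with
    | zero => simp [binom]
    | succ j ih =>
      rw [← ih (by omega), binom, binom, Finset.prod_range_succ, Finset.prod_range_succ,
        show N - j = N - (j + 1) + 1 by omega, Finset.prod_range_succ]
      have := T.q_ne_zero (Nat.succ_ne_zero j)
      simp only [Nat.succ_eq_add_one] at this
      field_simp
  have h1 := h j hj
  have h2 := h (N - j) (by omega)
  rw [Nat.sub_sub_self hj, ← h1, mul_comm (∏ m ∈ Finset.range (N - j), _)] at h2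
  refine mul_right_cancel₀ (mul_ne_zero ?_ ?_) h2 <;>
  exact Finset.prod_ne_zero_iff.2 fun m _ => T.q_ne_zero (Nat.succ_ne_zero m)

/-- The variable `y` is left open because both `y = a ^ 2` and `y = a⁻¹ ^ 2` are needed: the first
gives the coefficients of a half-twist, the second the eigenvalues of its rotation. -/
theorem sum_binom_mul_eta {y : K} (hy0 : y ≠ 0) (hy : ∀ n : ℕ, n ≠ 0 → 1 - (y ^ 2) ^ n ≠ 0)
    (hq : ∀ n, T.q n = (y ^ n - y⁻¹ ^ n) / (y - y⁻¹)) {N i : ℕ} (hi : i ≤ N) :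
    ∑ j ∈ Finset.range (N + 1), y ^ (N * j) * T.binom N j * T.eta N j i =
      ∏ m ∈ Finset.range i, -(y ^ 2) ^ (N - m) := by
  have hx : y ^ 2 ≠ 0 := pow_ne_zero _ hy0
  have hd : y - y⁻¹ ≠ 0 := by
    intro h
    have := T.q_ne_zero one_ne_zero
    rw [hq, h, div_zero] at this
    exact this rfl
  have hq' : ∀ n, T.q n = y⁻¹ ^ n * (1 - (y ^ 2) ^ n) / (y⁻¹ - y) := by
    intro n
    rw [hq, ← neg_sub y⁻¹ y, div_neg, ← neg_div]
    congr 1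
    have : y⁻¹ ^ n * y ^ n = 1 := by rw [← mul_pow, inv_mul_cancel₀ hy0, one_pow]
    rw [← pow_mul, mul_comm 2 n, pow_mul]
    linear_combination y ^ n * this
  have hd' : y⁻¹ - y ≠ 0 := by rw [← neg_sub]; exact neg_ne_zero.2 hd
  have hz : ∀ k m : ℕ, m ≤ k → (y ^ 2) ^ k * (y ^ 2)⁻¹ ^ m = (y ^ 2) ^ (k - m) := by
    intro k m h
    rw [inv_pow, ← div_eq_mul_inv, pow_sub₀ _ hx h, div_eq_mul_inv]
  rw [← Finset.sum_subset (Finset.range_mono (Nat.succ_le_succ hi)) fun j _ hj => by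
    rw [eta, newton_of_lt _ _ (by simpa using hj), mul_zero]]
  have hc : ∀ m < i, 1 - (y ^ 2) ^ N * (y ^ 2)⁻¹ ^ m ≠ 0 := fun m hm => by
    rw [hz _ _ (by omega)]; exact hy _ (by omega)
  -- The parameters come from the factors `[2 N + 1 - i - m]` and `[N - m]` of `eta_eq` and `binom`.
  have key := sum_gaussBinom hx i ((y ^ 2) ^ (2 * N + 1 - i)) ((y ^ 2) ^ N) (pow_ne_zero _ hx) hc
  have h1 : ∀ j ∈ Finset.range (i + 1), y ^ (N * j) * T.binom N j * T.eta N j i =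
      gaussBinom (y ^ 2) i j * (-1) ^ j * (y ^ 2) ^ (j.choose 2) * ∏ m ∈ Finset.range j,
        ((1 - (y ^ 2) ^ (2 * N + 1 - i) * (y ^ 2)⁻¹ ^ m) / (1 - (y ^ 2) ^ N * (y ^ 2)⁻¹ ^ m)) := by
    intro j hj
    have hj := Finset.mem_range_succ_iff.1 hj
    have e0 := gaussBinom_mul_prod (y ^ 2) i j
    have n0 : ∏ m ∈ Finset.range j, (1 - (y ^ 2) ^ (m + 1)) ≠ 0 :=
      Finset.prod_ne_zero_iff.2 fun m _ => hy _ (Nat.succ_ne_zero m)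
    rw [eq_div_of_mul_eq n0 e0, T.eta_eq hi hj, binom, ← Finset.prod_div_distrib]
    clear e0 n0
    induction j with
    | zero => simp
    | succ j ih =>
      have ih := ih (by simp; omega) (by omega)
      simp only [Finset.prod_range_succ]
      have n1 := hy (N - j) (by omega)
      have n2 := hy (j + 1) (by omega)
      have step : y ^ N * (T.q (N - j) / T.q (j + 1)) *
          -(T.q (i - j) * T.q (2 * N + 1 - i - j) / T.q (N - j) ^ 2) =
          (1 - (y ^ 2) ^ (i - j)) / (1 - (y ^ 2) ^ (j + 1)) * (-1) * (y ^ 2) ^ j *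
          ((1 - (y ^ 2) ^ (2 * N + 1 - i - j)) / (1 - (y ^ 2) ^ (N - j))) := by
        have e1 : y⁻¹ ^ (i - j) * y⁻¹ ^ (2 * N + 1 - i - j) =
            y⁻¹ ^ (N - j) * (y⁻¹ ^ (j + 1) * (y⁻¹ ^ N * y ^ (2 * j))) := by
          obtain ⟨d, hd⟩ : ∃ d, N = j + d := ⟨N - j, by omega⟩
          have : y⁻¹ ^ j * y ^ j = 1 := by rw [← mul_pow, inv_mul_cancel₀ hy0, one_pow]
          rw [← pow_add, show i - j + (2 * N + 1 - i - j) = d + d + 1 by omega,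
            show N - j = d by omega, hd]
          have e3 : y⁻¹ ^ (j + 1) * (y⁻¹ ^ (j + d) * y ^ (2 * j)) = y⁻¹ ^ (d + 1) * (y⁻¹ ^ j * y ^ j) ^ 2 := by
            ring
          rw [e3, this]
          ring
        have e2 : y ^ N * y⁻¹ ^ N = 1 := by rw [← mul_pow, mul_inv_cancel₀ hy0, one_pow]
        have n3 : y⁻¹ ^ (N - j) ≠ 0 := pow_ne_zero _ (inv_ne_zero hy0)
        have n4 : y⁻¹ ^ (j + 1) ≠ 0 := pow_ne_zero _ (inv_ne_zero hy0)
        simp only [hq']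
        rw [← pow_mul y 2 j]
        generalize y⁻¹ ^ (N - j) = A1 at *
        generalize y⁻¹ ^ (j + 1) = A2 at *
        generalize y⁻¹ ^ (i - j) = A3 at *
        generalize y⁻¹ ^ (2 * N + 1 - i - j) = A4 at *
        generalize 1 - (y ^ 2) ^ (N - j) = B1 at *
        generalize 1 - (y ^ 2) ^ (j + 1) = B2 at *
        generalize y⁻¹ ^ N = A5 at *
        generalize y ^ (2 * j) = A6 at *
        generalize y ^ N = A7 at *
        generalize y⁻¹ - y = D at *
        have : A3 * A4 * A7 = A1 * A2 * A6 := by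
          linear_combination A7 * e1 + A1 * A2 * A6 * e2
        field_simp
        linear_combination (-(1 - (y ^ 2) ^ (i - j)) * (1 - (y ^ 2) ^ (2 * N + 1 - i - j))) * this
      rw [hz _ _ (by omega), hz _ _ (by omega), Nat.choose_succ_succ' j 1, Nat.choose_one_right,
        pow_add _ j, pow_succ (-1 : K), mul_add N, pow_add, mul_one]
      linear_combination (y ^ N * (T.q (N - j) / T.q (j + 1)) *
          -(T.q (i - j) * T.q (2 * N + 1 - i - j) / T.q (N - j) ^ 2)) * ih +
        (∏ m ∈ Finset.range j, (1 - (y ^ 2) ^ (i - m)) / (1 - (y ^ 2) ^ (m + 1))) * (-1) ^ j *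
          (y ^ 2) ^ (j.choose 2) * (∏ m ∈ Finset.range j,
        ((1 - (y ^ 2) ^ (2 * N + 1 - i) * (y ^ 2)⁻¹ ^ m) / (1 - (y ^ 2) ^ N * (y ^ 2)⁻¹ ^ m))) * step
  rw [Finset.sum_congr rfl h1, key, Finset.prod_div_distrib, ← Finset.prod_range_reflect
    (fun m => (y ^ 2) ^ N - (y ^ 2) ^ (2 * N + 1 - i) * (y ^ 2) ^ m), ← Finset.prod_div_distrib]
  refine Finset.prod_congr rfl fun m hm => ?_
  have hm := Finset.mem_range.1 hm
  have n1 := hy (N - m) (by omega)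
  have e1 : (y ^ 2) ^ N = (y ^ 2) ^ (N - m) * (y ^ 2) ^ m := by rw [← pow_add]; congr 1; omega
  have e2 : (y ^ 2) ^ (2 * N + 1 - i) * (y ^ 2) ^ (i - 1 - m) = (y ^ 2) ^ N * (y ^ 2) ^ (N - m) := by
    rw [← pow_add, ← pow_add]; congr 1; omega
  have n2 : (y ^ 2) ^ N - (y ^ 2) ^ m ≠ 0 := by
    rw [e1, show (y ^ 2) ^ (N - m) * (y ^ 2) ^ m - (y ^ 2) ^ m =
      -((y ^ 2) ^ m * (1 - (y ^ 2) ^ (N - m))) by ring]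
    exact neg_ne_zero.2 (mul_ne_zero (pow_ne_zero _ hx) n1)
  rw [e2, div_eq_iff n2, e1]
  ring

/-- Coefficients with respect to the `h j` are determined by the eigenvalues, as the Newton matrix
is invertible. -/
theorem sum_twist_mul_eq {N : ℕ} {c : ℕ → K} (hc : ∀ i ≤ N, ∑ j ∈ Finset.range (N + 1), c j * T.eta N j i =
    T.twist N i) {j : ℕ} (hj : j ≤ N) : T.twistCoeff N 1 j = c j := by
  have h1 : ∀ i ∈ Finset.range (N + 1), T.twist N i ^ 1 * T.coeffE N i j =
      ∑ j' ∈ Finset.range (N + 1), c j' * (T.eta N j' i * T.coeffE N i j) := fun i hi => by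
    rw [pow_one, ← hc i (Finset.mem_range_succ_iff.1 hi), Finset.sum_mul]
    simp only [mul_assoc]
  rw [twistCoeff, Finset.sum_congr rfl h1, Finset.sum_comm]
  have h2 : ∀ j' ∈ Finset.range (N + 1), ∑ i ∈ Finset.range (N + 1),
      c j' * (T.eta N j' i * T.coeffE N i j) = if j = j' then c j' else 0 := by
    intro j' hj'
    have := sum_newton_mul_lagrange T.α_sub_α_ne_zero T.β_ne_zero (Finset.mem_range_succ_iff.1 hj') hj
    rw [← Finset.mul_sum,
      show ∑ i ∈ Finset.range (N + 1), T.eta N j' i * T.coeffE N i j = _ from this]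
    simp [eq_comm]
  rw [Finset.sum_congr rfl h2, Finset.sum_ite_eq, if_pos (Finset.mem_range_succ_iff.2 hj)]

theorem one_sub_pow_ne_zero {n : ℕ} (hn : n ≠ 0) : 1 - (T.a ^ 4) ^ n ≠ 0 := by
  rw [← pow_mul, sub_ne_zero]
  exact (T.a_pow_ne_one _ (by omega)).symm

theorem twistCoeff_one {N j : ℕ} (hj : j ≤ N) :
    T.twistCoeff N 1 j = T.a⁻¹ ^ (N * N) * ((T.a ^ 2) ^ (N * j) * T.binom N j) := by
  have h0 := T.a_ne_zero
  refine T.sum_twist_mul_eq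
    (c := fun j => T.a⁻¹ ^ (N * N) * ((T.a ^ 2) ^ (N * j) * T.binom N j)) (fun i hi => ?_) hj
  simp only [mul_assoc, ← Finset.mul_sum]
  have h1 := T.sum_binom_mul_eta (y := T.a ^ 2) (pow_ne_zero _ h0) (fun n hn => by
    rw [← pow_mul T.a 2 2]; exact T.one_sub_pow_ne_zero hn) (fun n => by
      rw [q, quantumInt, zpow_neg, zpow_neg, zpow_mul, zpow_natCast, inv_pow]; norm_cast) hi
  simp only [mul_assoc] at h1
  rw [h1, twist]
  clear h1
  induction i with
  | zero => simp
  | succ i ih =>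
    rw [Finset.prod_range_succ, ← mul_assoc, ih (by omega)]
    obtain ⟨d, rfl⟩ : ∃ d, N = d + (i + 1) := ⟨N - (i + 1), by omega⟩
    rw [show d + (i + 1) - i = d + 1 by omega, show d + (i + 1) - (i + 1) = d by omega]
    have h2 : T.a⁻¹ ^ ((d + 1) * (d + 1)) * T.a ^ (2 * d + 1) = T.a⁻¹ ^ (d * d) := by
      rw [show (d + 1) * (d + 1) = d * d + (2 * d + 1) by ring, pow_add, mul_assoc, ← mul_pow,
        inv_mul_cancel₀ h0, one_pow, mul_one]
    rw [← h2]
    ring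

/-- The quarter turn of a half-twist is a half-twist of the other type. In formulas, reversing the
sum and the symmetry of `binom` replace `a ^ 2` by `a⁻¹ ^ 2`. -/
theorem spec_one {N i : ℕ} (hi : i ≤ N) :
    T.spec N 1 i = T.a ^ (N * N) * ∏ m ∈ Finset.range i, -(T.a⁻¹ ^ 4) ^ (N - m) := by
  have h0 := T.a_ne_zero
  have h0' := inv_ne_zero h0
  have hn : ∀ n : ℕ, n ≠ 0 → 1 - (T.a⁻¹ ^ 4) ^ n ≠ 0 := by
    intro n hn h
    refine T.a_pow_ne_one (4 * n) (by omega) ?_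
    rw [← pow_mul, inv_pow, sub_eq_zero] at h
    exact inv_eq_one.1 h.symm
  have h1 := T.sum_binom_mul_eta (y := T.a⁻¹ ^ 2) (pow_ne_zero _ h0') (fun n hn' => by
    rw [← pow_mul T.a⁻¹ 2 2]; exact hn n hn') (fun n => by
      rw [q, quantumInt, ← neg_div_neg_eq, neg_sub, neg_sub, zpow_neg, zpow_neg, zpow_mul,
        zpow_natCast, inv_pow, inv_inv, inv_pow]; norm_cast) hi
  rw [← pow_mul] at h1
  rw [← h1, spec, ← Finset.sum_range_reflect, Finset.mul_sum]
  refine Finset.sum_congr rfl fun j hj => ?_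
  have hj := Finset.mem_range_succ_iff.1 hj
  rw [T.twistCoeff_one (by omega), show N + 1 - 1 - j = N - j by omega, T.binom_symm hj,
    Nat.sub_sub_self hj]
  have h2 : T.a⁻¹ ^ (N * N) * (T.a ^ 2) ^ (N * (N - j)) = T.a ^ (N * N) * (T.a⁻¹ ^ 2) ^ (N * j) := by
    have h3 : N * (N - j) + N * j = N * N := by rw [← mul_add, Nat.sub_add_cancel hj]
    rw [← pow_mul, ← pow_mul, inv_pow, inv_pow, eq_comm, ← div_eq_mul_inv, mul_comm _ (T.a ^ (2 * _)),
      ← div_eq_mul_inv, div_eq_div_iff (pow_ne_zero _ h0) (pow_ne_zero _ h0), ← pow_add, ← pow_add]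
    congr 1
    omega
  rw [← mul_assoc, h2]
  ring

/-! ### The first row of the change of basis -/

theorem unknot_mul_gram_top {N l : ℕ} (hl : l ≤ N) :
    T.unknot N * T.gram N l N = T.q (2 * (N - l) + 1) := by
  have h1 : ∀ j ∈ Finset.range (N + 1), T.unknot N * (T.coeffE N l j * T.eta N (N - j) N) =
      ∑ i ∈ Finset.range (N + 1), T.q (2 * (N - i) + 1) * (T.coeffE N l j * T.eta N j i) := by
    intro j hj
    rw [mul_left_comm, ← T.sum_q_mul_eta (Finset.mem_range_succ_iff.1 hj), Finset.mul_sum]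
    exact Finset.sum_congr rfl fun i _ => by ring
  rw [gram, Finset.mul_sum, Finset.sum_congr rfl h1, Finset.sum_comm]
  have h3 : ∀ i ∈ Finset.range (N + 1), ∑ j ∈ Finset.range (N + 1),
      T.q (2 * (N - i) + 1) * (T.coeffE N l j * T.eta N j i) =
      if l = i then T.q (2 * (N - i) + 1) else 0 := by
    intro i hi
    have := sum_lagrange_mul_newton T.α_sub_α_ne_zero T.β_ne_zero hl (Finset.mem_range_succ_iff.1 hi)
    rw [← Finset.mul_sum,
      show ∑ j ∈ Finset.range (N + 1), T.coeffE N l j * T.eta N j i = _ from this]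
    simp
  rw [Finset.sum_congr rfl h3, Finset.sum_ite_eq, if_pos (Finset.mem_range_succ_iff.2 hl)]

theorem eta_pred {N d n : ℕ} (hd : d + 1 ≤ N) (hn : n ≤ d + 1) :
    T.eta N n d * (T.q (d + 1) * T.q (2 * N + 1 - d - n)) =
      T.eta N n (d + 1) * (T.q (d + 1 - n) * T.q (2 * N + 1 - d)) := by
  induction n with
  | zero => simp [eta]
  | succ n ih =>
    have ih := ih (by omega)
    rw [eta, eta, newton_succ, newton_succ, ← eta, ← eta, T.α_sub_α (by omega) (by omega),
      T.α_sub_α hd (by omega), show 2 * N + 1 - d - (n + 1) = 2 * N + 1 - (d + 1) - n by omega,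
      show d + 1 - (n + 1) = d - n by omega]
    linear_combination (-(T.q (d - n) * T.q (2 * N + 1 - (d + 1) - n)) / T.q N ^ 2 / T.β N n) * ih

/-- The identity that carries the induction step of `gram_partial_sum`, in parameters without
subtraction. -/
theorem q_identity (k s r : ℕ) :
    T.q (k + 1) * (T.q s * T.q (2 * k + s + r + 2) ^ 2 + T.q (s + r) ^ 2 * T.q (2 * k + s + 2)) =
      T.q (2 * k + 2) * (T.q (k + s + 1) * T.q r ^ 2 +
        T.q (k + s + 2 * r + 1) * T.q s * T.q (2 * k + s + 2)) := by
  have h0 := T.a_ne_zero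
  have hd := T.den_ne_zero
  have hq : ∀ n, T.q n = ((T.a ^ 2) ^ n - ((T.a ^ 2) ^ n)⁻¹) / (T.a ^ (2 : ℤ) - T.a ^ (-2 : ℤ)) := by
    intro n
    rw [q, quantumInt, zpow_neg _ (2 * (n : ℤ)), zpow_mul, zpow_natCast]; norm_cast
  simp only [hq]
  generalize T.a ^ (2 : ℤ) - T.a ^ (-2 : ℤ) = D at *
  have hb : T.a ^ 2 ≠ 0 := pow_ne_zero _ h0
  generalize T.a ^ 2 = b at *
  simp only [pow_add, pow_mul', pow_one]
  have hk := pow_ne_zero k hb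
  have hs := pow_ne_zero s hb
  have hr := pow_ne_zero r hb
  generalize b ^ k = x at *
  generalize b ^ s = y at *
  generalize b ^ r = z at *
  field_simp
  ring

end PlanarOps

end PretzelHead

namespace PretzelHead

namespace PlanarOps

variable {K E : Type*} [Field K] [Ring E] [Algebra K E] (T : PlanarOps K E)

theorem coeffE_zero_succ {N n : ℕ} (hn : n < N) :
    T.coeffE N 0 (n + 1) * (T.q (n + 1) * T.q (2 * N - n)) = T.coeffE N 0 n * T.q (N - n) ^ 2 := by
  have h1 := lagrange_succ (β := T.β N) T.α_sub_α_ne_zero (i := 0) hn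
  have hq := T.q_ne_zero (show N ≠ 0 by omega)
  rw [← neg_sub, T.α_sub_α (by omega) (by omega), Nat.sub_zero, Nat.sub_zero,
    show 2 * N + 1 - (n + 1) = 2 * N - n by omega, ← coeffE, ← coeffE, β] at h1
  field_simp at h1
  linear_combination h1

theorem eta_succ_left {N n i : ℕ} (hi : i ≤ N) (hn : n ≤ i) (hN : n < N) :
    T.eta N (n + 1) i * T.q (N - n) ^ 2 =
      -(T.eta N n i * (T.q (i - n) * T.q (2 * N + 1 - i - n))) := by
  have hq := T.q_ne_zero (show N ≠ 0 by omega)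
  have hq' := T.q_ne_zero (show N - n ≠ 0 by omega)
  rw [eta, newton_succ, ← eta, T.α_sub_α hi hn, β]
  field_simp

theorem eta_of_lt {N j i : ℕ} (h : i < j) : T.eta N j i = 0 := newton_of_lt _ _ h

/-- The partial sums in the recurrence for the first row of the change of basis. -/
theorem gram_partial_sum {N k n : ℕ} (hk : k < N) (hkn : k ≤ n) (hn : n ≤ N) :
    (∑ j ∈ Finset.range (n + 1), T.coeffE N 0 j * (T.eta N (N - j) (N - (k + 1)) * T.q (N + k + 2) +
      T.eta N (N - j) (N - k) * T.q (N - k))) * (T.q (N - k) * T.q (k + 1) * T.q (n + k + 2)) =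
      T.q (2 * k + 2) * (T.coeffE N 0 n * T.eta N (N - n) (N - k)) * (T.q (n + 1) * T.q (N - n) ^ 2) := by
  induction n, hkn using Nat.le_induction with
  | base =>
    rw [Finset.sum_range_succ, Finset.sum_eq_zero fun j hj => by
      have := Finset.mem_range.1 hj
      rw [T.eta_of_lt (by omega), T.eta_of_lt (by omega)]; simp]
    rw [T.eta_of_lt (by omega : N - (k + 1) < N - k), show k + k + 2 = 2 * k + 2 by ring]
    ring
  | succ n hkn ih =>
    have ih := ih (by omega)
    have h1 := T.coeffE_zero_succ (N := N) (n := n) (by omega)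
    have h2 := T.eta_succ_left (N := N) (n := N - (n + 1)) (i := N - k) (by omega) (by omega) (by omega)
    have h3 := T.eta_pred (N := N) (d := N - (k + 1)) (n := N - (n + 1)) (by omega) (by omega)
    have h4 := T.q_identity k (n + 1 - k) (N - (n + 1))
    rw [show N - (n + 1) + 1 = N - n by omega, show N - (N - (n + 1)) = n + 1 by omega,
      show N - k - (N - (n + 1)) = n + 1 - k by omega,
      show 2 * N + 1 - (N - k) - (N - (n + 1)) = n + k + 2 by omega] at h2
    rw [show N - (k + 1) + 1 = N - k by omega, show N - k - (N - (n + 1)) = n + 1 - k by omega,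
      show 2 * N + 1 - (N - (k + 1)) - (N - (n + 1)) = n + 1 + k + 2 by omega,
      show 2 * N + 1 - (N - (k + 1)) = N + k + 2 by omega] at h3
    rw [show 2 * k + (n + 1 - k) + (N - (n + 1)) + 2 = N + k + 2 by omega,
      show n + 1 - k + (N - (n + 1)) = N - k by omega,
      show 2 * k + (n + 1 - k) + 2 = n + 1 + k + 2 by omega,
      show k + (n + 1 - k) + 1 = n + 2 by omega,
      show k + (n + 1 - k) + 2 * (N - (n + 1)) + 1 = 2 * N - n by omega] at h4
    rw [Finset.sum_range_succ]
    set S := ∑ j ∈ Finset.range (n + 1), T.coeffE N 0 j *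
      (T.eta N (N - j) (N - (k + 1)) * T.q (N + k + 2) + T.eta N (N - j) (N - k) * T.q (N - k))
    have n1 := T.q_ne_zero (show n + k + 2 ≠ 0 by omega)
    have n2 := T.q_ne_zero (show n + 1 ≠ 0 by omega)
    have h5 : S * (T.q (N - k) * T.q (k + 1)) = -(T.q (2 * k + 2) *
        (T.coeffE N 0 (n + 1) * T.eta N (N - (n + 1)) (N - k)) *
        (T.q (2 * N - n) * T.q (n + 1 - k))) := by
      refine mul_right_cancel₀ (mul_ne_zero n1 n2) ?_
      linear_combination T.q (n + 1) * ih + T.q (2 * k + 2) * T.coeffE N 0 n * T.q (N - n) ^ 2 * h2 +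
        T.q (2 * k + 2) * T.eta N (N - (n + 1)) (N - k) * (T.q (n + 1 - k) * T.q (n + k + 2)) * h1
    linear_combination T.q (n + 1 + k + 2) * h5 +
      T.coeffE N 0 (n + 1) * T.q (N + k + 2) * T.q (k + 1) * h3 +
      T.coeffE N 0 (n + 1) * T.eta N (N - (n + 1)) (N - k) * h4

/-- For `n = N` the closed form in `gram_partial_sum` contains the factor `q 0`, so the whole sum
vanishes; this is a first-order recurrence along the row. -/
theorem gram_zero_succ {N k : ℕ} (hk : k < N) :
    T.gram N 0 (N - (k + 1)) * T.q (N + k + 2) = -(T.gram N 0 (N - k) * T.q (N - k)) := by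
  have h1 := T.gram_partial_sum hk hk.le le_rfl
  have n1 := T.q_ne_zero (show N - k ≠ 0 by omega)
  have n2 := T.q_ne_zero (show k + 1 ≠ 0 by omega)
  have n3 := T.q_ne_zero (show N + k + 2 ≠ 0 by omega)
  rw [Nat.sub_self, q_zero, zero_pow two_ne_zero, mul_zero, mul_zero] at h1
  have h2 := (mul_eq_zero.1 h1).resolve_right (mul_ne_zero (mul_ne_zero n1 n2) n3)
  simp only [mul_add, Finset.sum_add_distrib, ← mul_assoc, ← Finset.sum_mul] at h2
  rw [gram, gram]
  linear_combination h2

theorem gram_zero {N k : ℕ} (hk : k ≤ N) : T.gram N 0 (N - k) =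
    (-1) ^ (N + k) * (T.q (2 * N + 1) / T.q (N + 1)) *
      ∏ m ∈ Finset.range k, T.q (N - m) / T.q (N + 2 + m) := by
  induction k with
  | zero =>
    have h1 := T.unknot_mul_gram_top (N := N) (Nat.zero_le N)
    have n1 := T.q_ne_zero (show N + 1 ≠ 0 by omega)
    have h2 : ((-1) ^ N * (-1) ^ N : K) = 1 := by rw [← mul_pow]; simp
    rw [unknot, Nat.sub_zero] at h1
    simp only [Nat.sub_zero, add_zero, Finset.range_zero, Finset.prod_empty, mul_one]
    rw [← h1]
    field_simp
    linear_combination (-T.gram N 0 N) * h2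
  | succ k ih =>
    have h1 := T.gram_zero_succ (show k < N by omega)
    have n3 := T.q_ne_zero (show N + k + 2 ≠ 0 by omega)
    rw [ih (by omega)] at h1
    rw [Finset.prod_range_succ, show N + 2 + k = N + k + 2 by ring, ← add_assoc, pow_succ]
    refine mul_right_cancel₀ n3 (h1.trans ?_)
    field_simp

end PlanarOps

end PretzelHead

namespace PretzelHead

open PowerSeries

/-! ### Power series in `q⁻¹ = A⁴` as Laurent series in `A` -/

/-- The substitution of `A⁴` for `X`. -/
def ofX : ℚ⟦X⟧ →+* Coeff :=
  (HahnSeries.embDomainRingHom (Γ' := ℤ) ((AddMonoidHom.mulLeft (4 : ℤ)).comp (Nat.castAddMonoidHom ℤ))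
    (fun a b h => by simpa using h) (fun a b => by simp)).comp
    (HahnSeries.toPowerSeries (R := ℚ)).symm.toRingHom

theorem coeff_ofX (P : ℚ⟦X⟧) (k : ℕ) : (ofX P).coeff (4 * k) = coeff k P := by
  have := HahnSeries.embDomain_coeff (f := (⟨⟨(AddMonoidHom.mulLeft (4 : ℤ)).comp
    (Nat.castAddMonoidHom ℤ), fun a b h => by simpa using h⟩, by simp⟩ : ℕ ↪o ℤ))
    (x := (HahnSeries.toPowerSeries (R := ℚ)).symm P) (a := k)
  rw [HahnSeries.coeff_toPowerSeries_symm] at this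
  exact this

theorem coeff_ofX_eq_zero (P : ℚ⟦X⟧) {j : ℤ} (h : ∀ k : ℕ, j ≠ 4 * k) : (ofX P).coeff j = 0 := by
  refine HahnSeries.embDomain_of_notMem_range ?_
  rintro ⟨k, hk⟩
  exact h k hk.symm

theorem ofX_injective : Function.Injective ofX := by
  intro P Q h
  ext k
  rw [← coeff_ofX, h, coeff_ofX]

theorem ofX_X : ofX X = A ^ 4 := by
  ext j
  by_cases h : ∃ k : ℕ, j = 4 * k
  · obtain ⟨k, rfl⟩ := h
    rw [coeff_ofX, coeff_X, A_pow, HahnSeries.coeff_single]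
    congr 1
    rw [eq_iff_iff]
    push_cast
    omega
  · push Not at h
    rw [coeff_ofX_eq_zero _ h, A_pow, HahnSeries.coeff_single_of_ne]
    exact fun hj => h 1 (by simpa using hj)

theorem ofX_X_pow (n : ℕ) : ofX (X ^ n) = A ^ (4 * n : ℤ) := by
  rw [map_pow, ofX_X, ← pow_mul]
  norm_cast

theorem ofX_inv {P : ℚ⟦X⟧} (h : constantCoeff P ≠ 0) : ofX P⁻¹ = (ofX P)⁻¹ := by
  refine eq_inv_of_mul_eq_one_left ?_
  rw [← map_mul, PowerSeries.inv_mul_cancel _ h, map_one]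

theorem ofX_ne_zero {P : ℚ⟦X⟧} (h : constantCoeff P ≠ 0) : ofX P ≠ 0 := by
  rw [Ne, map_eq_zero_iff _ ofX_injective]
  rintro rfl
  exact h (map_zero _)

theorem qInt_eq (n : ℕ) :
    qInt n = A ^ (2 - 2 * n : ℤ) * ofX (1 - X ^ n) / ofX (1 - X) := by
  have h0 := A_ne_zero
  have h1 : ofX (1 - X) ≠ 0 := ofX_ne_zero (by simp)
  have h2 := matchingOps.den_ne_zero
  rw [matchingOps_a] at h2
  rw [qInt, div_eq_div_iff h2 h1, map_sub, map_sub, map_one, ofX_X, ofX_X_pow, zpow_sub₀ h0,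
    zpow_neg, zpow_neg, zpow_mul, zpow_mul]
  have e : (A ^ (4 : ℤ)) = A ^ (2 : ℤ) * A ^ (2 : ℤ) := by rw [← zpow_add₀ h0]; norm_num
  have e2 : A ^ 4 = A ^ (2 : ℤ) * A ^ (2 : ℤ) := by rw [← e]; norm_cast
  rw [e, e2, mul_zpow]
  have h3 : A ^ (2 : ℤ) ≠ 0 := zpow_ne_zero _ h0
  generalize A ^ (2 : ℤ) = b at *
  simp only [zpow_natCast]
  field_simp
  ring

/-- `y` is `A ^ e` times a power series in `A⁴`. -/
def IsSeries (e : ℤ) (y : Coeff) : Prop := ∃ P : ℚ⟦X⟧, y = A ^ e * ofX P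

/-- `y` is `A ^ e` times an invertible power series in `A⁴`. -/
def HasOrder (e : ℤ) (y : Coeff) : Prop :=
  ∃ P : ℚ⟦X⟧, constantCoeff P ≠ 0 ∧ y = A ^ e * ofX P

namespace HasOrder

variable {e e' : ℤ} {y y' : Coeff}

theorem ne_zero (h : HasOrder e y) : y ≠ 0 := by
  obtain ⟨P, hP, rfl⟩ := h
  exact mul_ne_zero (zpow_ne_zero _ A_ne_zero) (ofX_ne_zero hP)

theorem one : HasOrder 0 1 := ⟨1, by simp, by simp⟩

theorem mul (h : HasOrder e y) (h' : HasOrder e' y') : HasOrder (e + e') (y * y') := by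
  obtain ⟨P, hP, rfl⟩ := h
  obtain ⟨P', hP', rfl⟩ := h'
  refine ⟨P * P', by rw [map_mul]; exact mul_ne_zero hP hP', ?_⟩
  rw [zpow_add₀ A_ne_zero, map_mul]
  ring

theorem neg (h : HasOrder e y) : HasOrder e (-y) := by
  obtain ⟨P, hP, rfl⟩ := h
  exact ⟨-P, by simpa using hP, by rw [map_neg, mul_neg]⟩

theorem inv (h : HasOrder e y) : HasOrder (-e) y⁻¹ := by
  obtain ⟨P, hP, rfl⟩ := h
  refine ⟨P⁻¹, by rw [PowerSeries.constantCoeff_inv]; exact inv_ne_zero hP, ?_⟩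
  rw [mul_inv, ofX_inv hP, zpow_neg]

theorem div (h : HasOrder e y) (h' : HasOrder e' y') : HasOrder (e - e') (y / y') := by
  rw [div_eq_mul_inv, sub_eq_add_neg]; exact h.mul h'.inv

theorem sq (h : HasOrder e y) : HasOrder (2 * e) (y ^ 2) := by
  rw [two_mul, pow_two]; exact h.mul h

theorem isSeries (h : HasOrder e y) {e' : ℤ} {k : ℕ} (he : e = e' + 4 * k) : IsSeries e' y := by
  obtain ⟨P, _, rfl⟩ := h
  refine ⟨X ^ k * P, ?_⟩
  rw [he, map_mul, ofX_X_pow, zpow_add₀ A_ne_zero, mul_assoc]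

end HasOrder

theorem hasOrder_qInt {n : ℕ} (hn : n ≠ 0) : HasOrder (2 - 2 * n) (qInt n) := by
  refine ⟨(1 - X ^ n) * (1 - X)⁻¹, ?_, ?_⟩
  · rw [map_mul, PowerSeries.constantCoeff_inv]
    simp [hn]
  · rw [qInt_eq, map_mul, ofX_inv (by simp), div_eq_mul_inv, mul_assoc]

theorem IsSeries.sum {ι : Type*} {s : Finset ι} {e : ℤ} {y : ι → Coeff}
    (h : ∀ i ∈ s, IsSeries e (y i)) : IsSeries e (∑ i ∈ s, y i) := by
  classical
  induction s using Finset.induction_on with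
  | empty => exact ⟨0, by simp⟩
  | insert i s hi ih =>
    obtain ⟨P, hP⟩ := h i (by simp)
    obtain ⟨Q, hQ⟩ := ih fun j hj => h j (by simp [hj])
    exact ⟨P + Q, by rw [Finset.sum_insert hi, hP, hQ, map_add, mul_add]⟩

/-! ### Orders of the coefficients -/

theorem hasOrder_α_sub_α {N i m : ℕ} (hi : i ≤ N) (hm : m < i) :
    HasOrder (4 * m - 2) (matchingOps.α N i - matchingOps.α N m) := by
  rw [matchingOps.α_sub_α hi hm.le]
  simp only [matchingOps_q]
  have := ((hasOrder_qInt (n := i - m) (by omega)).mul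
    (hasOrder_qInt (n := 2 * N + 1 - i - m) (by omega))).neg.div (hasOrder_qInt (n := N) (by omega)).sq
  convert this using 1
  rw [Nat.cast_sub hm.le, Nat.cast_sub (by omega), Nat.cast_sub (by omega)]
  push_cast
  ring

theorem hasOrder_β {N m : ℕ} (hm : m < N) : HasOrder (4 * m) (matchingOps.β N m) := by
  have := ((hasOrder_qInt (n := N - m) (by omega)).div (hasOrder_qInt (n := N) (by omega))).sq
  convert this using 1
  · rw [Nat.cast_sub hm.le]
    ring
  · rfl

theorem hasOrder_eta {N n i : ℕ} (hi : i ≤ N) (hn : n ≤ i) :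
    HasOrder (-2 * n) (matchingOps.eta N n i) := by
  induction n with
  | zero => simpa [PlanarOps.eta] using HasOrder.one
  | succ n ih =>
    rw [PlanarOps.eta, newton_succ, ← PlanarOps.eta]
    have := (ih (by omega)).mul ((hasOrder_α_sub_α hi (m := n) (by omega)).div
      (hasOrder_β (N := N) (m := n) (by omega)))
    convert this using 1
    push_cast
    ring

theorem hasOrder_coeffE {N l s : ℕ} (hs : l + s ≤ N) :
    HasOrder (2 * s ^ 2 + 2 * l) (matchingOps.coeffE N l (l + s)) := by
  induction s with
  | zero =>
    have h1 : matchingOps.coeffE N l l * matchingOps.eta N l l = 1 :=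
      lagrange_mul_newton_self matchingOps.α_sub_α_ne_zero matchingOps.β_ne_zero (by omega)
    have h2 := hasOrder_eta (N := N) (n := l) (i := l) (by omega) le_rfl
    have h3 := h2.inv
    rw [← eq_inv_of_mul_eq_one_left h1] at h3
    convert h3 using 1
    · push_cast
      ring
    · rfl
  | succ s ih =>
    have h1 := lagrange_succ (β := matchingOps.β N) matchingOps.α_sub_α_ne_zero (i := l)
      (show l + s < N by omega)
    have h2 := (hasOrder_α_sub_α (N := N) (i := l + s + 1) (m := l) (by omega) (by omega)).neg
    rw [neg_sub] at h2
    have h3 := ((ih (by omega)).mul (hasOrder_β (N := N) (m := l + s) (by omega))).div h2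
    rw [PlanarOps.coeffE, ← h1, mul_div_cancel_right₀ _ h2.ne_zero, ← PlanarOps.coeffE] at h3
    convert h3 using 1
    · push_cast
      ring
    · rfl

/-- With `j = l + s`, the orders of the two factors of a term add up to `2 s² + 2 l - 2 (N - l - s)
= -2 N + 4 l + 2 s (s + 1)`, and `2 s (s + 1)` is a nonnegative multiple of `4`. -/
theorem isSeries_gram {N l i : ℕ} (hi : i ≤ N) :
    IsSeries (-2 * N + 4 * l) (matchingOps.gram N l i) := by
  refine IsSeries.sum fun j hj => ?_
  have hj := Finset.mem_range_succ_iff.1 hj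
  rcases Nat.lt_or_ge j l with h | h
  · rw [PlanarOps.coeffE, lagrange_of_lt _ _ h, zero_mul]; exact ⟨0, by simp⟩
  rcases Nat.lt_or_ge i (N - j) with h' | h'
  · rw [PlanarOps.eta_of_lt _ h', mul_zero]; exact ⟨0, by simp⟩
  obtain ⟨s, rfl⟩ := Nat.exists_eq_add_of_le h
  have h1 := (hasOrder_coeffE hj).mul (hasOrder_eta hi h')
  refine h1.isSeries (k := (s + 1).choose 2 + 0) ?_
  have h2 : (s + 1) * s = 2 * (s + 1).choose 2 := by
    rw [Nat.choose_two_right, Nat.mul_div_cancel' (Nat.even_mul_pred_self _).two_dvd]; rfl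
  have h3 : ((s : ℤ) + 1) * s = 2 * ((s + 1).choose 2 : ℕ) := by exact_mod_cast h2
  rw [Nat.cast_sub hj]
  push_cast
  linear_combination 2 * h3

end PretzelHead

namespace PretzelHead

open PowerSeries

/-! ### The eigenvalues as power series -/

/-- The exponents of the twist eigenvalues. -/
def twistExp (N l : ℕ) : ℕ := ∑ m ∈ Finset.range l, (N - m)

theorem twistExp_succ (N l : ℕ) : twistExp N (l + 1) = twistExp N l + (N - l) :=
  Finset.sum_range_succ _ _

theorem twistExp_add_choose {N l : ℕ} (hl : l ≤ N) :
    twistExp N l + (N - l + 1).choose 2 = (N + 1).choose 2 := by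
  induction l with
  | zero => simp [twistExp]
  | succ l ih =>
    have h1 : (N - l + 1).choose 2 = (N - (l + 1) + 1) + (N - (l + 1) + 1).choose 2 := by
      rw [show N - l + 1 = N - (l + 1) + 1 + 1 by omega,
        Nat.choose_succ_succ' (N - (l + 1) + 1) 1, Nat.choose_one_right]
    rw [← ih (by omega), twistExp_succ, h1]
    omega

theorem two_mul_choose_two (N : ℕ) : 2 * ((N + 1).choose 2 : ℤ) = (N + 1) * N := by
  have h2 : (N + 1) * N = 2 * (N + 1).choose 2 := by
    rw [Nat.choose_two_right, Nat.mul_div_cancel' (Nat.even_mul_pred_self _).two_dvd]; rfl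
  exact_mod_cast h2.symm

theorem A_zpow_mul (m n : ℤ) : A ^ m * A ^ n = A ^ (m + n) := (zpow_add₀ A_ne_zero m n).symm

theorem twist_eq {N l : ℕ} (hl : l ≤ N) :
    matchingOps.twist N l = A ^ (-(N ^ 2 : ℤ)) * ofX ((-1) ^ l * X ^ twistExp N l) := by
  have h1 := twistExp_add_choose hl
  have h2 := two_mul_choose_two N
  have h3 := two_mul_choose_two (N - l)
  rw [map_mul, map_pow, map_neg, map_one, ofX_X_pow, PlanarOps.twist, matchingOps_a, inv_pow,
    mul_left_comm, mul_assoc, A_zpow_mul]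
  congr 1
  rw [← zpow_natCast, ← zpow_natCast, ← zpow_neg, A_zpow_mul]
  congr 1
  have h4 : (twistExp N l : ℤ) = (N + 1).choose 2 - (N - l + 1).choose 2 := by omega
  push_cast [Nat.cast_sub hl] at h3 ⊢
  linear_combination (-4) * h4 + (-2) * h2 + 2 * h3

/-- The ratio of the first row of the change of basis to its leading term. -/
def ratio (N k : ℕ) : ℚ⟦X⟧ :=
  (1 - X ^ (2 * N + 1)) * (1 - X ^ (N + 1))⁻¹ *
    ∏ m ∈ Finset.range k, (1 - X ^ (N - m)) * (1 - X ^ (N + 2 + m))⁻¹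

theorem qInt_div_qInt (m n : ℕ) (hn : n ≠ 0) : qInt m / qInt n =
    A ^ (2 * n - 2 * m : ℤ) * ofX ((1 - X ^ m) * (1 - X ^ n)⁻¹) := by
  have h1 : ofX (1 - X) ≠ 0 := ofX_ne_zero (by simp)
  have h2 : ofX (1 - X ^ n) ≠ 0 := ofX_ne_zero (by simp [hn])
  have h3 : A ^ (2 - 2 * m : ℤ) = A ^ (2 * n - 2 * m : ℤ) * A ^ (2 - 2 * n : ℤ) := by
    rw [A_zpow_mul]; congr 1; ring
  have h4 : A ^ (2 - 2 * n : ℤ) ≠ 0 := zpow_ne_zero _ A_ne_zero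
  rw [qInt_eq, qInt_eq, map_mul, ofX_inv (by simp [hn]), h3]
  field_simp

theorem gram_zero_eq {N k : ℕ} (hk : k ≤ N) : matchingOps.gram N 0 (N - k) =
    (-1) ^ N * A ^ (-2 * N : ℤ) * ofX ((-1) ^ k * X ^ ((k + 1).choose 2) * ratio N k) := by
  rw [matchingOps.gram_zero hk]
  simp only [matchingOps_q]
  rw [qInt_div_qInt _ _ (Nat.succ_ne_zero N), ratio]
  have h1 : ∏ m ∈ Finset.range k, qInt (N - m) / qInt (N + 2 + m) =
      ofX (X ^ ((k + 1).choose 2) * ∏ m ∈ Finset.range k, (1 - X ^ (N - m)) * (1 - X ^ (N + 2 + m))⁻¹) := by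
    induction k with
    | zero => simp
    | succ k ih =>
      have h3 : (X ^ (k + 1 + 1).choose 2 : ℚ⟦X⟧) = X ^ (k + 1) * X ^ (k + 1).choose 2 := by
        rw [Nat.choose_succ_succ' (k + 1) 1, Nat.choose_one_right, pow_add X (k + 1)]
      rw [Finset.prod_range_succ, ih (by omega), qInt_div_qInt _ _ (by omega), Finset.prod_range_succ,
        h3, map_mul ofX (X ^ (k + 1).choose 2), map_mul ofX (_ * _) (_ * _), map_mul ofX (X ^ (k + 1)),
        map_mul ofX (∏ m ∈ _, _), ofX_X_pow (k + 1)]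
      rw [show (2 * ((N + 2 + k : ℕ) : ℤ) - 2 * ((N - k : ℕ) : ℤ)) = 4 * ((k + 1 : ℕ) : ℤ) by
        rw [Nat.cast_sub (by omega)]; push_cast; ring]
      ring
  rw [h1, show (2 * ((N + 1 : ℕ) : ℤ) - 2 * ((2 * N + 1 : ℕ) : ℤ)) = -2 * N by push_cast; ring]
  simp only [map_mul, map_pow, map_neg, map_one]
  ring

theorem exists_gram_eq {N i : ℕ} (hi : i ≤ N) : ∃ Γ : ℕ → ℚ⟦X⟧, ∀ l,
    matchingOps.gram N l i = (-1) ^ N * A ^ (-2 * N : ℤ) * ofX (X ^ l * Γ l) := by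
  choose P hP using fun l => isSeries_gram (N := N) (l := l) hi
  refine ⟨fun l => (-1) ^ N * P l, fun l => ?_⟩
  have h1 : ((-1) ^ N * (-1) ^ N : Coeff) = 1 := by rw [← mul_pow]; simp
  rw [hP, map_mul ofX (X ^ l), map_mul ofX, map_pow ofX (-1), map_neg, map_one, ofX_X_pow,
    zpow_add₀ A_ne_zero]
  linear_combination (-A ^ (-2 * N : ℤ) * A ^ (4 * l : ℤ) * ofX (P l)) * h1

/-- The eigenvalues of a rotated column of half-twists, as power series. -/
def specSeries (N p : ℕ) (Γ : ℕ → ℚ⟦X⟧) : ℚ⟦X⟧ :=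
  ∑ l ∈ Finset.range (N + 1), ((-1) ^ l * X ^ twistExp N l) ^ p * (X ^ l * Γ l)

theorem spec_eq_specSeries {N i : ℕ} {Γ : ℕ → ℚ⟦X⟧} (hΓ : ∀ l,
    matchingOps.gram N l i = (-1) ^ N * A ^ (-2 * N : ℤ) * ofX (X ^ l * Γ l)) (p : ℕ) :
    matchingOps.spec N p i =
      (-1) ^ N * A ^ (-2 * N : ℤ) * (A ^ (-(N ^ 2 : ℤ))) ^ p * ofX (specSeries N p Γ) := by
  rw [matchingOps.spec_eq, specSeries, map_sum, Finset.mul_sum]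
  refine Finset.sum_congr rfl fun l hl => ?_
  rw [twist_eq (Finset.mem_range_succ_iff.1 hl), hΓ, map_mul ofX (_ ^ p),
    map_pow ofX (_ * _) p]
  ring

theorem spec_one_eq {N k : ℕ} (hk : k ≤ N) : matchingOps.spec N 1 (N - k) =
    (-1) ^ N * A ^ (-2 * N : ℤ) * A ^ (-(N ^ 2 : ℤ)) * ofX ((-1) ^ k * X ^ ((k + 1).choose 2)) := by
  have h1 : ∀ i, ∏ m ∈ Finset.range i, -(A⁻¹ ^ 4) ^ (N - m) =
      (-1) ^ i * A ^ (-(4 * twistExp N i : ℤ)) := by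
    intro i
    induction i with
    | zero => simp [twistExp]
    | succ i ih =>
      rw [Finset.prod_range_succ, ih, twistExp_succ, ← pow_mul, inv_pow, ← zpow_natCast A, ← zpow_neg,
        Nat.cast_add, mul_add, neg_add, zpow_add₀ A_ne_zero, pow_succ]
      push_cast
      ring
  have h2 := twistExp_add_choose (Nat.sub_le N k)
  rw [Nat.sub_sub_self hk] at h2
  have h3 := two_mul_choose_two N
  have h4 : ((-1) ^ (N - k) : Coeff) = (-1) ^ N * (-1) ^ k := by
    rw [← pow_add, show N + k = N - k + 2 * k by omega, pow_add, pow_mul]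
    simp
  rw [matchingOps.spec_one (Nat.sub_le N k), matchingOps_a, h1, h4, map_mul, map_pow, map_neg, map_one,
    ofX_X_pow, ← zpow_natCast]
  have h5 : A ^ ((N * N : ℕ) : ℤ) * A ^ (-(4 * twistExp N (N - k) : ℤ)) =
      A ^ (-2 * N : ℤ) * A ^ (-(N ^ 2 : ℤ)) * A ^ (4 * ((k + 1).choose 2 : ℕ) : ℤ) := by
    rw [A_zpow_mul, A_zpow_mul, A_zpow_mul]
    congr 1
    have h6 : (twistExp N (N - k) : ℤ) = (N + 1).choose 2 - (k + 1).choose 2 := by omega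
    rw [h6]
    push_cast
    linear_combination (-2) * h3
  linear_combination (-1) ^ N * (-1) ^ k * h5

/-- The weight of the deviation from the case of a single half-twist. -/
def devWeight (N : ℕ) : ℕ → ℚ⟦X⟧
  | 0 => 0
  | 1 => 0
  | 2 => 1 + X ^ N
  | _ => 1

theorem le_twistExp {N l : ℕ} (hl : 1 ≤ l) : N ≤ twistExp N l := by
  obtain ⟨l, rfl⟩ := Nat.exists_eq_add_of_le' hl
  induction l with
  | zero => simp [twistExp]
  | succ l ih => rw [twistExp_succ]; have := ih (by omega); omega

theorem le_twistExp' {N l : ℕ} (hl : 2 ≤ l) : 2 * N - 1 ≤ twistExp N l := by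
  obtain ⟨l, rfl⟩ := Nat.exists_eq_add_of_le' hl
  induction l with
  | zero => simp [twistExp, Finset.sum_range_succ]; omega
  | succ l ih => rw [twistExp_succ]; have := ih (by omega); omega

/-- Row `0` equals the value for `p = 1` times `ratio N k`, so `ratio N k - 1` measures the
deviation from one half-twist. The other rows are negligible or, for `p = 2`, can be eliminated. -/
theorem dvd_specSeries_sub {N k : ℕ} {Γ : ℕ → ℚ⟦X⟧}
    (h0 : Γ 0 = (-1) ^ k * X ^ ((k + 1).choose 2) * ratio N k)
    (h1 : specSeries N 1 Γ = (-1) ^ k * X ^ ((k + 1).choose 2)) {p : ℕ} (hp : 1 ≤ p) :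
    X ^ (3 * N + 1) ∣ specSeries N p Γ -
      (-1) ^ k * X ^ ((k + 1).choose 2) * (1 + (ratio N k - 1) * devWeight N p) := by
  match p, hp with
  | 1, _ => rw [h1]; simp [devWeight]
  | 2, _ =>
    -- The twist for `l = 1` is `-X ^ N`, so adding `X ^ N` times the series for `p = 1` cancels the
    -- row `l = 1`.
    have e1 : specSeries N 2 Γ + X ^ N * specSeries N 1 Γ =
        (1 + X ^ N) * Γ 0 + ∑ l ∈ Finset.range N, ((-1) ^ (l + 1) * X ^ twistExp N (l + 1)) *
          ((-1) ^ (l + 1) * X ^ twistExp N (l + 1) + X ^ N) * (X ^ (l + 1) * Γ (l + 1)) := by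
      rw [specSeries, specSeries, Finset.mul_sum, ← Finset.sum_add_distrib, Finset.sum_range_succ',
        add_comm]
      congr 1
      · simp [twistExp]; ring
      · refine Finset.sum_congr rfl fun l _ => ?_
        ring
    have e2 : X ^ (3 * N + 1) ∣ ∑ l ∈ Finset.range N, ((-1) ^ (l + 1) * X ^ twistExp N (l + 1)) *
          ((-1) ^ (l + 1) * X ^ twistExp N (l + 1) + X ^ N) * (X ^ (l + 1) * Γ (l + 1)) := by
      refine Finset.dvd_sum fun l hl => ?_
      have hl := Finset.mem_range.1 hl
      rcases l with - | l
      · simp [twistExp]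
      · have h3 := le_twistExp' (N := N) (l := l + 1 + 1) (by omega)
        obtain ⟨c, hc⟩ := Nat.exists_eq_add_of_le h3
        obtain ⟨M, rfl⟩ : ∃ M, N = M + (l + 2) := ⟨N - (l + 2), by omega⟩
        rw [hc, show 2 * (M + (l + 2)) - 1 + c = (M + (l + 2)) + (M + (l + 1) + c) by omega]
        refine ⟨(-1) ^ (l + 1 + 1) * X ^ (l + c) *
          ((-1) ^ (l + 1 + 1) * X ^ (M + (l + 1) + c) + 1) * Γ (l + 1 + 1), ?_⟩
        ring
    rw [h1] at e1
    rw [show specSeries N 2 Γ - (-1) ^ k * X ^ ((k + 1).choose 2) *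
      (1 + (ratio N k - 1) * devWeight N 2) = ∑ l ∈ Finset.range N,
      ((-1) ^ (l + 1) * X ^ twistExp N (l + 1)) *
          ((-1) ^ (l + 1) * X ^ twistExp N (l + 1) + X ^ N) * (X ^ (l + 1) * Γ (l + 1)) by
      rw [devWeight]
      rw [h0] at e1
      linear_combination e1]
    exact e2
  | p + 3, _ =>
    have e1 : specSeries N (p + 3) Γ - (-1) ^ k * X ^ ((k + 1).choose 2) *
        (1 + (ratio N k - 1) * devWeight N (p + 3)) = ∑ l ∈ Finset.range N,
          ((-1) ^ (l + 1) * X ^ twistExp N (l + 1)) ^ (p + 3) * (X ^ (l + 1) * Γ (l + 1)) := by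
      rw [specSeries, Finset.sum_range_succ', h0, devWeight]
      · simp [twistExp]
      all_goals omega
    rw [e1]
    refine Finset.dvd_sum fun l hl => ?_
    -- Three twists contribute `3 * N`, and the row number contributes the missing `1`.
    obtain ⟨c, hc⟩ := Nat.exists_eq_add_of_le (le_twistExp (N := N) (l := l + 1) (by omega))
    rw [hc]
    refine ⟨(-1) ^ ((l + 1) * (p + 3)) * X ^ (c * 3 + l) * X ^ ((N + c) * p) * Γ (l + 1), ?_⟩
    rw [mul_pow, ← pow_mul, ← pow_mul]
    ring

/-- Splitting off `X ^ k` costs `k` in the precision; the factor `X ^ (2 * k)` in the bracket makes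
up for it. -/
theorem exists_spec_eq {N k : ℕ} (hk : k ≤ N) : ∃ Q : ℕ → ℚ⟦X⟧,
    (∀ p, 1 ≤ p → X ^ (3 * N + 1 - k) ∣
      Q p - (-1) ^ k * X ^ (k.choose 2) * (1 + (ratio N k - 1) * devWeight N p)) ∧
    ∀ p, 1 ≤ p → matchingOps.spec N p (N - k) =
      (-1) ^ N * A ^ (-2 * N : ℤ) * (A ^ (-(N ^ 2 : ℤ))) ^ p * ofX (X ^ k * Q p) := by
  obtain ⟨Γ, hΓ⟩ := exists_gram_eq (Nat.sub_le N k)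
  have hne : ((-1) ^ N * A ^ (-2 * N : ℤ) : Coeff) ≠ 0 :=
    mul_ne_zero (pow_ne_zero _ (by simp)) (zpow_ne_zero _ A_ne_zero)
  have h0 : Γ 0 = (-1) ^ k * X ^ ((k + 1).choose 2) * ratio N k := by
    have := (hΓ 0).symm.trans (gram_zero_eq hk)
    have := ofX_injective (mul_left_cancel₀ hne this)
    simpa using this
  have h1 : specSeries N 1 Γ = (-1) ^ k * X ^ ((k + 1).choose 2) := by
    have := (spec_eq_specSeries hΓ 1).symm.trans (spec_one_eq hk)
    rw [pow_one] at this
    exact ofX_injective (mul_left_cancel₀ (mul_ne_zero hne (zpow_ne_zero _ A_ne_zero)) this)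
  have h2 : ∀ p, 1 ≤ p → ∃ Q, specSeries N p Γ = X ^ k * Q ∧ X ^ (3 * N + 1 - k) ∣
      Q - (-1) ^ k * X ^ (k.choose 2) * (1 + (ratio N k - 1) * devWeight N p) := by
    intro p hp
    obtain ⟨D, hD⟩ := dvd_specSeries_sub h0 h1 hp
    refine ⟨(-1) ^ k * X ^ (k.choose 2) * (1 + (ratio N k - 1) * devWeight N p) +
      X ^ (3 * N + 1 - k) * D, ?_, by simp⟩
    rw [sub_eq_iff_eq_add.1 hD, show 3 * N + 1 = k + (3 * N + 1 - k) by omega, pow_add,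
      Nat.choose_succ_succ' k 1, Nat.choose_one_right, Nat.add_sub_cancel_left]
    ring
  choose! Q hQ hQ' using h2
  exact ⟨Q, hQ', fun p hp => by rw [spec_eq_specSeries hΓ, hQ p hp]⟩

theorem column_product_eq {K : Type*} [Field K] {s t x y : K} (hs : s * s = 1)
    (hy : t * (x * x * x) = y) (c d e z q₀ q₁ q₂ : K) (p₀ p₁ p₂ : ℕ) :
    s * c * e ^ p₀ * (x * q₀) * (s * c * e ^ p₁ * (x * q₁)) * (s * c * e ^ p₂ * (x * q₂)) *
      (t * z / d) = s * (c * c * c) * e ^ (p₀ + p₁ + p₂) / d * (y * z * (q₀ * q₁ * q₂)) := by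
  rw [← hy]
  linear_combination (s * c * c * c * e ^ (p₀ + p₁ + p₂) / d * t * x ^ 3 * z * q₀ * q₁ * q₂) * hs

theorem framing_product_eq {K : Type*} [Field K] {a t b c e u : K} (hu : u ≠ 0)
    (h : a * t = b * (c * e)) (ε s d B : K) :
    ε * b * (s * c * e / d * B) = ε * a * (u⁻¹ * B) * (s * (t * u / d)) := by
  have h1 : u⁻¹ * u = 1 := inv_mul_cancel₀ hu
  linear_combination (-(ε * s * B / d)) * h - (ε * a * B * s * t / d) * h1

/-- The normalized colored Jones polynomial as a power series, up to a power of `A`. -/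
theorem exists_normalizedColoredJones_eq (N : ℕ) {p : Fin 3 → ℕ} (hp : ∀ i, 1 ≤ p i) (w : ℤ) :
    ∃ Q : Fin 3 → ℕ → ℚ⟦X⟧, (∀ i, ∀ k ≤ N, X ^ (3 * N + 1 - k) ∣
      Q i k - (-1) ^ k * X ^ (k.choose 2) * (1 + (ratio N k - 1) * devWeight N (p i))) ∧
    ∃ (ε : ℤˣ) (s : ℤ), normalizedColoredJones N (pretzel p) w = ((ε : ℤ) : Coeff) * A ^ s *
      ofX ((1 - X ^ (N + 1))⁻¹ * ∑ k ∈ Finset.range (N + 1),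
        X ^ (2 * k) * (1 - X ^ (2 * k + 1)) * (Q 0 k * Q 1 k * Q 2 k)) := by
  choose! Q hQ hQ' using fun k (hk : k ≤ N) => exists_spec_eq hk
  refine ⟨fun i k => Q k (p i), fun i k hk => hQ k hk _ (hp i), ?_⟩
  have h1 : ofX (1 - X) ≠ 0 := ofX_ne_zero (by simp)
  have h2 : ofX (1 - X ^ (N + 1)) ≠ 0 := ofX_ne_zero (by simp)
  have h3 : ∀ k ∈ Finset.range (N + 1), matchingOps.spec N (p 0) (N - k) *
      matchingOps.spec N (p 1) (N - k) * matchingOps.spec N (p 2) (N - k) * qInt (2 * k + 1) =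
      (-1) ^ N * A ^ (-6 * N : ℤ) * (A ^ (-(N ^ 2 : ℤ))) ^ (p 0 + p 1 + p 2) / ofX (1 - X) *
        ofX (X ^ (2 * k) * (1 - X ^ (2 * k + 1)) * (Q k (p 0) * Q k (p 1) * Q k (p 2))) := by
    intro k hk
    have hk := Finset.mem_range_succ_iff.1 hk
    -- Three columns give `X ^ (3 * k)`, and the leading power of `[2 k + 1]` is `X ^ (-k)` up to
    -- the common denominator `1 - X`.
    have e1 : A ^ (2 - 2 * ((2 * k + 1 : ℕ) : ℤ)) * ofX (X ^ k * X ^ k * X ^ k) = ofX (X ^ (2 * k)) := by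
      rw [← pow_add, ← pow_add, ofX_X_pow, ofX_X_pow, A_zpow_mul]
      congr 1
      push_cast
      ring
    have e2 : ((-1) ^ N * (-1) ^ N : Coeff) = 1 := by rw [← mul_pow]; simp
    have e3 : A ^ (-6 * N : ℤ) = A ^ (-2 * N : ℤ) * A ^ (-2 * N : ℤ) * A ^ (-2 * N : ℤ) := by
      rw [A_zpow_mul, A_zpow_mul]; congr 1; ring
    rw [hQ' k hk _ (hp 0), hQ' k hk _ (hp 1), hQ' k hk _ (hp 2), qInt_eq, e3]
    simp only [map_mul] at e1 ⊢
    exact column_product_eq e2 e1 _ _ _ _ _ _ _ _ _ _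
  have h4 : coloredBracket N (pretzel p) = (-1) ^ N * A ^ (-6 * N : ℤ) *
      (A ^ (-(N ^ 2 : ℤ))) ^ (p 0 + p 1 + p 2) / ofX (1 - X) * ofX (∑ k ∈ Finset.range (N + 1),
        X ^ (2 * k) * (1 - X ^ (2 * k + 1)) * (Q k (p 0) * Q k (p 1) * Q k (p 2))) := by
    rw [coloredBracket_pretzel, map_sum, Finset.mul_sum, ← Finset.sum_congr rfl h3,
      ← Finset.sum_range_reflect]
    refine Finset.sum_congr rfl fun k hk => ?_
    have := Finset.mem_range_succ_iff.1 hk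
    rw [show N + 1 - 1 - k = N - k by omega, show N - (N - k) = k by omega]
  -- The columns contribute `-6 N` and the unknot takes back `-2 N`; their signs cancel, and only
  -- the sign of the framing remains.
  refine ⟨((-1) ^ N) ^ (-w), (N ^ 2 + 2 * N) * (-w) + (-4 * N) - N ^ 2 * (p 0 + p 1 + p 2), ?_⟩
  have h5 : ((-1) ^ N * A ^ (N ^ 2 + 2 * N) : Coeff) ^ (-w) =
      (((((-1 : ℤˣ) ^ N) ^ (-w) : ℤˣ) : ℤ) : Coeff) * A ^ ((N ^ 2 + 2 * N : ℤ) * (-w)) := by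
    rw [mul_zpow, zpow_mul]
    congr 1
    · rcases Nat.even_or_odd N with h | h
      · simp [h.neg_one_pow]
      · rcases Int.even_or_odd w with h' | h'
        · simp [h.neg_one_pow, h'.neg.neg_one_zpow]
        · simp [h.neg_one_pow, h'.neg.neg_one_zpow]
  have e2 : ((-1) ^ N * (-1) ^ N : Coeff) = 1 := by rw [← mul_pow]; simp
  have h6 : A ^ ((N ^ 2 + 2 * N : ℤ) * (-w) + (-4 * N) - N ^ 2 * (p 0 + p 1 + p 2)) *
      A ^ (2 - 2 * ((N + 1 : ℕ) : ℤ)) = A ^ ((N ^ 2 + 2 * N : ℤ) * (-w)) *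
        (A ^ (-6 * N : ℤ) * (A ^ (-(N ^ 2 : ℤ))) ^ (p 0 + p 1 + p 2)) := by
    rw [← zpow_natCast (A ^ _), ← zpow_mul, A_zpow_mul, A_zpow_mul, A_zpow_mul]
    congr 1
    push_cast
    ring
  have h7 : A ^ (2 - 2 * ((N + 1 : ℕ) : ℤ)) ≠ 0 := zpow_ne_zero _ A_ne_zero
  have h8 : ((-1) ^ N : Coeff) ≠ 0 := pow_ne_zero _ (by simp)
  rw [normalizedColoredJones, coloredJones, unknotValue, h4, h5, qInt_eq, map_mul ofX (_)⁻¹,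
    ofX_inv (by simp)]
  rw [div_eq_iff (mul_ne_zero h8 (div_ne_zero (mul_ne_zero h7 h2) h1))]
  exact framing_product_eq h2 h6 _ _ _ _
  

end PretzelHead

namespace PretzelHead

open PowerSeries

/-! ### The expansion of the summands to third order -/

theorem one_sub_X_mul_inv : (1 - X : ℚ⟦X⟧) * (1 - X)⁻¹ = 1 := PowerSeries.mul_inv_cancel _ (by simp)

theorem one_sub_X_sq_mul_inv : (1 - X ^ 2 : ℚ⟦X⟧) * (1 - X ^ 2)⁻¹ = 1 :=
  PowerSeries.mul_inv_cancel _ (by simp)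

theorem inv_one_sub_X : (1 - X : ℚ⟦X⟧)⁻¹ = (1 - X ^ 2)⁻¹ * (1 + X) := by
  have h1 := one_sub_X_mul_inv
  have h2 := one_sub_X_sq_mul_inv
  linear_combination (1 - X)⁻¹ * (-h2) + (1 - X ^ 2 : ℚ⟦X⟧)⁻¹ * (1 + X) * h1

/-- The first-order coefficient of `ratio`. -/
def linCoeff (k : ℕ) : ℚ⟦X⟧ := (2 * X ^ k - 1 - X * (X ^ k) ^ 2) * (1 - X)⁻¹

/-- The second-order coefficient of `ratio`. -/
def quadCoeff (k : ℕ) : ℚ⟦X⟧ :=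
  X * (X ^ 3 * (X ^ k) ^ 4 - 2 * X * (1 + X) * (X ^ k) ^ 3 + (3 + 2 * X + X ^ 2) * (X ^ k) ^ 2 -
    2 * (1 + X) * X ^ k + X) * ((1 - X)⁻¹ * (1 - X ^ 2)⁻¹) - (X ^ k) ^ 2

/-- The first-order part of passing from `ratio N k` to `ratio N (k + 1)`; `quadCoeff_succ` is the
second-order part. -/
theorem linCoeff_succ (k : ℕ) :
    linCoeff (k + 1) = X * linCoeff k - 1 + X ^ 2 * (X ^ k) ^ 2 := by
  rw [linCoeff, linCoeff, pow_succ X k]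
  linear_combination (X ^ 2 * (X ^ k) ^ 2 - 1 : ℚ⟦X⟧) * one_sub_X_mul_inv

theorem quadCoeff_succ (k : ℕ) :
    quadCoeff (k + 1) = X ^ 2 * quadCoeff k + X ^ 2 * linCoeff k * (X ^ 2 * (X ^ k) ^ 2 - 1) -
      X ^ 3 * (X ^ k) ^ 2 + X ^ 5 * (X ^ k) ^ 4 := by
  have h2 := one_sub_X_sq_mul_inv
  rw [quadCoeff, quadCoeff, linCoeff, pow_succ X k, inv_one_sub_X]
  generalize (X ^ k : ℚ⟦X⟧) = z
  generalize (1 - X ^ 2 : ℚ⟦X⟧)⁻¹ = j at h2 ⊢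
  linear_combination (X ^ 2 * (2 * z - 1 - X * z ^ 2) * (1 + X) * (X ^ 2 * z ^ 2 - 1) * j -
    (X ^ 3 * z ^ 2 - X ^ 5 * z ^ 4) * ((1 - X ^ 2) * j + 1)) * h2

theorem exists_ratio_eq {N k : ℕ} (hk : k ≤ N) : ∃ r, ratio N k = 1 + X ^ (N - k) * X * linCoeff k +
    (X ^ (N - k)) ^ 2 * X * quadCoeff k + (X ^ (N - k)) ^ 3 * X ^ 2 * r := by
  induction k with
  | zero =>
    have h1 : (1 - X ^ (N + 1) : ℚ⟦X⟧) * (1 - X ^ (N + 1))⁻¹ = 1 :=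
      PowerSeries.mul_inv_cancel _ (by simp)
    have h2 : linCoeff 0 = 1 := by rw [linCoeff]; linear_combination one_sub_X_mul_inv
    have h3 : quadCoeff 0 = X - 1 := by
      rw [quadCoeff]
      linear_combination X * one_sub_X_sq_mul_inv * (1 - X) * (1 - X)⁻¹ + X * one_sub_X_mul_inv
    rw [ratio, h2, h3, Nat.sub_zero, Finset.range_zero, Finset.prod_empty, two_mul, pow_succ X (N + N),
      pow_succ X N, pow_add]
    rw [pow_succ] at h1
    set e : ℚ⟦X⟧ := X ^ N
    set g := (1 - e * X)⁻¹
    refine ⟨X * g - 1 - X * e - X ^ 2 * e ^ 2 * g, ?_⟩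
    linear_combination (1 - X * e ^ 2) * (1 + e * X + e ^ 2 * X ^ 2) * h1
  | succ k ih =>
    obtain ⟨r, hr⟩ := ih (by omega)
    obtain ⟨j, rfl⟩ := Nat.exists_eq_add_of_le hk
    have h1 : (1 - X ^ (k + 1 + j + 2 + k) : ℚ⟦X⟧) * (1 - X ^ (k + 1 + j + 2 + k))⁻¹ = 1 :=
      PowerSeries.mul_inv_cancel _ (by simp)
    rw [ratio, Finset.prod_range_succ, ← mul_assoc, ← ratio, linCoeff_succ, quadCoeff_succ]
    rw [show k + 1 + j - k = j + 1 by omega, pow_succ] at hr ⊢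
    rw [show k + 1 + j + 2 + k = j + 3 + k + k by omega, pow_add, pow_add, pow_add] at h1 ⊢
    rw [Nat.add_sub_cancel_left]
    generalize ratio (k + 1 + j) k = R at hr ⊢
    generalize linCoeff k = a at hr ⊢
    generalize quadCoeff k = b at hr ⊢
    set e : ℚ⟦X⟧ := X ^ j
    set z : ℚ⟦X⟧ := X ^ k
    set g := (1 - e * X ^ 3 * z * z)⁻¹
    refine ⟨X ^ 5 * z ^ 4 * (X ^ 2 * z ^ 2 - 1) * g * R + X ^ 2 * (b + e * X ^ 2 * r) *
      (X ^ 2 * z ^ 2 - 1) * (1 + e * X ^ 3 * z ^ 2) + X ^ 4 * z ^ 2 * a * (X ^ 2 * z ^ 2 - 1) +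
      X ^ 3 * r, ?_⟩
    -- The new factor `(1 - X ^ (N - k)) / (1 - X ^ (N + 2 + k))`, expanded as a geometric series
    -- with exact third-order remainder.
    have h3 : (1 - e * X) * g = 1 + e * X * (X ^ 2 * z ^ 2 - 1) * (1 + e * X ^ 3 * z ^ 2) +
        e ^ 3 * X ^ 7 * z ^ 4 * (X ^ 2 * z ^ 2 - 1) * g := by
      linear_combination (1 + e * X * (X ^ 2 * z ^ 2 - 1) * (1 + e * X ^ 3 * z ^ 2)) * h1
    rw [h3]
    linear_combination (1 + e * X * (X ^ 2 * z ^ 2 - 1) * (1 + e * X ^ 3 * z ^ 2)) * hr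

/-- In the application `e = X ^ (N - k)`, `z = u = X ^ k`, and `g` comes from dividing by the
unknot. The remainder must carry an extra `x` or `z`: with `e ^ 3 * x` alone, the summand `k = 1`
would be known only modulo `X ^ (3 * N)`. -/
theorem product_third_order {R : Type*} [CommRing R] (x e z a b r g u : R) (α β : Fin 3 → R)
    (hg : (1 - e * x * u) * g = 1) : ∃ U V : R,
    g * ((1 + (e * x * a + e ^ 2 * x * b + e ^ 3 * x ^ 2 * r) * (α 0 + β 0 * (e * z))) *
      (1 + (e * x * a + e ^ 2 * x * b + e ^ 3 * x ^ 2 * r) * (α 1 + β 1 * (e * z))) *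
      (1 + (e * x * a + e ^ 2 * x * b + e ^ 3 * x ^ 2 * r) * (α 2 + β 2 * (e * z)))) =
    1 + e * x * u + (e * x * u) ^ 2 + (1 + e * x * u) * (∑ i, α i) * (e * x * a) +
      (∑ i, β i) * (e * z) * (e * x * a) + (∑ i, α i) * (e ^ 2 * x * b) +
      (α 0 * α 1 + α 0 * α 2 + α 1 * α 2) * (e * x * a) ^ 2 +
      e ^ 3 * x * (x * U + z * V) := by
  rw [Fin.sum_univ_three, Fin.sum_univ_three]
  generalize α 0 = α₀, α 1 = α₁, α 2 = α₂, β 0 = β₀, β 1 = β₁, β 2 = β₂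
  obtain ⟨σ, hσ⟩ : ∃ σ, σ = α₀ * α₁ + α₀ * α₂ + α₁ * α₂ := ⟨_, rfl⟩
  obtain ⟨F, hF⟩ : ∃ F, F = z * (α₀ * β₁ + α₁ * β₀ + α₀ * β₂ + α₂ * β₀ + α₁ * β₂ + α₂ * β₁) +
    e * z ^ 2 * (β₀ * β₁ + β₀ * β₂ + β₁ * β₂) := ⟨_, rfl⟩
  obtain ⟨e₁, he₁⟩ : ∃ e₁, e₁ = α₀ + α₁ + α₂ + (β₀ + β₁ + β₂) * (e * z) := ⟨_, rfl⟩
  obtain ⟨e₃, he₃⟩ : ∃ e₃, e₃ =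
    (α₀ + β₀ * (e * z)) * (α₁ + β₁ * (e * z)) * (α₂ + β₂ * (e * z)) := ⟨_, rfl⟩
  obtain ⟨h, hh⟩ : ∃ h, h = b + e * x * r := ⟨_, rfl⟩
  have hP : (1 + (e * x * a + e ^ 2 * x * b + e ^ 3 * x ^ 2 * r) * (α₀ + β₀ * (e * z))) *
      (1 + (e * x * a + e ^ 2 * x * b + e ^ 3 * x ^ 2 * r) * (α₁ + β₁ * (e * z))) *
      (1 + (e * x * a + e ^ 2 * x * b + e ^ 3 * x ^ 2 * r) * (α₂ + β₂ * (e * z))) =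
      1 + e * x * (a + e * h) * e₁ + (e * x * (a + e * h)) ^ 2 * (σ + e * F) +
        (e * x * (a + e * h)) ^ 3 * e₃ := by
    rw [he₁, he₃, hσ, hF, hh]; ring
  obtain ⟨W, hW⟩ : ∃ W, W = (2 * a * h + e * h ^ 2) * (σ + e * F) + a ^ 2 * F +
    x * (a + e * h) ^ 3 * e₃ + r * e₁ := ⟨_, rfl⟩
  obtain ⟨M, hM⟩ : ∃ M, M = α₀ + α₁ + α₂ := ⟨_, rfl⟩
  obtain ⟨n, hn⟩ : ∃ n, n = β₀ + β₁ + β₂ := ⟨_, rfl⟩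
  obtain ⟨T, hT⟩ : ∃ T, T = M * b + n * z * a + σ * x * a ^ 2 + e * (z * n * b + x * W) := ⟨_, rfl⟩
  have hP' : 1 + e * x * (a + e * h) * e₁ + (e * x * (a + e * h)) ^ 2 * (σ + e * F) +
        (e * x * (a + e * h)) ^ 3 * e₃ = 1 + e * x * (M * a) + e ^ 2 * x * T := by
    rw [hT, hW, he₁, ← hM, ← hn, hh]; ring
  rw [hP, hP', ← hσ, ← hM, ← hn]
  refine ⟨x * u ^ 3 * g + x * (M * a + e * T) * u ^ 2 * g + u * T + W, n * b, ?_⟩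
  linear_combination (1 + e * x * u + (e * x * u) ^ 2 +
    (e * x * (M * a) + e ^ 2 * x * T) * (1 + e * x * u)) * hg + e ^ 2 * x * hT

end PretzelHead

namespace PretzelHead

open PowerSeries

/-! ### The partial theta series -/

/-- The terms of the partial theta series common to all the sums below. -/
def thetaTerm (k : ℕ) : ℚ⟦X⟧ := (-1) ^ k * X ^ (3 * k.choose 2)

theorem thetaTerm_succ (k : ℕ) : thetaTerm (k + 1) = -(thetaTerm k * (X ^ k) ^ 3) := by
  rw [thetaTerm, thetaTerm, Nat.choose_succ_succ' k 1, Nat.choose_one_right]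
  ring

/-- Partial sums of the pentagonal number series. -/
def pentagonalSum (N : ℕ) : ℚ⟦X⟧ :=
  ∑ k ∈ Finset.range N, thetaTerm k * ((X ^ k) ^ 2 - X * (X ^ k) ^ 4)

/-- The difference from the pentagonal summands telescopes, and likewise in `sum_theta_two`. So
every sum that occurs is a multiple of the pentagonal series up to a boundary term. -/
theorem sum_theta_one (N : ℕ) : ∑ k ∈ Finset.range N, thetaTerm k * (X ^ k - X ^ 2 * (X ^ k) ^ 5) =
    pentagonalSum N + thetaTerm N * ((X ^ N) ^ 2 - X ^ N) := by
  induction N with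
  | zero => simp [pentagonalSum]
  | succ N ih =>
    rw [Finset.sum_range_succ, ih, pentagonalSum, pentagonalSum, Finset.sum_range_succ,
      thetaTerm_succ]
    ring

theorem sum_theta_two (N : ℕ) : ∑ k ∈ Finset.range N, thetaTerm k *
      (1 + X ^ 2 * (X ^ k) ^ 4 - X * (X ^ k) ^ 2 - X ^ 3 * (X ^ k) ^ 6) =
    -X * pentagonalSum N - (thetaTerm N + thetaTerm (N + 1)) := by
  induction N with
  | zero => simp [pentagonalSum, thetaTerm]
  | succ N ih =>
    rw [Finset.sum_range_succ, ih, pentagonalSum, pentagonalSum, Finset.sum_range_succ,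
      thetaTerm_succ (N + 1), thetaTerm_succ N]
    ring

theorem two_mul_choose_two' (k : ℕ) : 2 * (k.choose 2 : ℤ) = k * (k - 1) := by
  rcases k with - | k
  · simp
  · rw [two_mul_choose_two]; push_cast; ring

/-- Euler's pentagonal number theorem, cut off: the omitted terms `k ≥ N + 1` have exponents at
least `3 * k.choose 2 + 2 * k`, which exceeds `3 * N`. -/
theorem X_pow_dvd_eulerProduct_sub (N : ℕ) :
    X ^ (3 * N + 1) ∣ eulerProduct - pentagonalSum (N + 1) := by
  have h1 : ∀ k : ℕ, ((-1) ^ k * (X ^ pentagonal (-k) - X ^ pentagonal (k + 1)) : ℚ⟦X⟧) =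
      thetaTerm k * ((X ^ k) ^ 2 - X * (X ^ k) ^ 4) := by
    intro k
    have h2 := two_mul_choose_two' k
    have h3 : pentagonal (-k) = 3 * k.choose 2 + 2 * k := by
      rw [pentagonal_neg, show (k : ℤ) * (3 * k + 1) = 2 * ((3 * k.choose 2 + 2 * k : ℕ) : ℤ) by
        push_cast; linear_combination (-3) * h2, Int.mul_ediv_cancel_left _ two_ne_zero,
        Int.toNat_natCast]
    have h4 : pentagonal (k + 1) = 3 * k.choose 2 + 4 * k + 1 := by
      rw [pentagonal_def, show (k + 1 : ℤ) * (3 * (k + 1) - 1) =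
        2 * ((3 * k.choose 2 + 4 * k + 1 : ℕ) : ℤ) by
        push_cast; linear_combination (-3) * h2, Int.mul_ediv_cancel_left _ two_ne_zero,
        Int.toNat_natCast]
    rw [h3, h4, thetaTerm]
    ring
  open scoped PowerSeries.WithPiTopology in
  have h2 := PowerSeries.WithPiTopology.hasSum_pow_pentagonal_sub_pentagonalSeries ℚ
  simp only [h1] at h2
  rw [eulerProduct, PowerSeries.WithPiTopology.tprod_one_sub_X_pow, X_pow_dvd_iff]
  intro j hj
  have h3 := ((PowerSeries.WithPiTopology.hasSum_iff_hasSum_coeff ℚ).1 h2 j).unique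
    (hasSum_sum_of_ne_finset_zero (s := Finset.range (N + 1)) fun k hk => ?_)
  · rw [map_sub, h3, pentagonalSum, map_sum, sub_self]
  · have hk : N + 1 ≤ k := by simpa using hk
    refine X_pow_dvd_iff.1 ?_ j hj
    have h4 : k - 1 ≤ k.choose 2 := by
      obtain ⟨k, rfl⟩ := Nat.exists_eq_add_of_le' (show 1 ≤ k by omega)
      rw [Nat.choose_succ_succ' k 1, Nat.choose_one_right]
      omega
    refine (pow_dvd_pow X (show 3 * N + 1 ≤ 3 * k.choose 2 + 2 * k by omega)).trans
      ⟨(-1) ^ k * (1 - X * (X ^ k) ^ 2), ?_⟩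
    rw [thetaTerm]
    ring

/-! ### The expansion of the normalized colored Jones polynomial -/

/-- The summands of the expansion to second order. Here `M`, `n` and `σ` are the elementary
symmetric functions of the weights. -/
def mainTerm (N k : ℕ) (M n σ : ℚ⟦X⟧) : ℚ⟦X⟧ :=
  thetaTerm k * ((X ^ k) ^ 2 - X * (X ^ k) ^ 4) *
    (1 + X ^ (N + 1) + (X ^ (N + 1)) ^ 2 +
      (1 + X ^ (N + 1)) * M * (X ^ (N - k) * X * linCoeff k) +
      n * X ^ N * (X ^ (N - k) * X * linCoeff k) + M * ((X ^ (N - k)) ^ 2 * X * quadCoeff k) +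
      σ * (X ^ (N - k) * X * linCoeff k) ^ 2)

/-- Sorted by the three families of summands whose sums are known. The factor `(X ^ k) ^ 2` absorbs
the negative powers of `X ^ k` contained in `X ^ (N - k) = X ^ N / X ^ k`. -/
theorem mainTerm_eq {N k : ℕ} (hk : k ≤ N) (M n σ : ℚ⟦X⟧) : mainTerm N k M n σ =
    (1 + X ^ (N + 1) + (X ^ (N + 1)) ^ 2 + 2 * ((1 + X ^ (N + 1)) * M + n * X ^ N) * X ^ (N + 1) *
      (1 - X)⁻¹ + M * ((3 + 2 * X + X ^ 2) * (X ^ (N + 1)) ^ 2 * ((1 - X)⁻¹ * (1 - X ^ 2)⁻¹) -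
      X * (X ^ N) ^ 2) + (4 + 2 * X) * σ * (X ^ (N + 1) * (1 - X)⁻¹) ^ 2) *
      (thetaTerm k * ((X ^ k) ^ 2 - X * (X ^ k) ^ 4)) -
    (((1 + X ^ (N + 1)) * M + n * X ^ N) * X ^ (N + 1) * (1 - X)⁻¹ +
      2 * (1 + X) * M * (X ^ (N + 1)) ^ 2 * ((1 - X)⁻¹ * (1 - X ^ 2)⁻¹) +
      4 * σ * (X ^ (N + 1) * (1 - X)⁻¹) ^ 2) * (thetaTerm k * (X ^ k - X ^ 2 * (X ^ k) ^ 5)) +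
    (M * X * (X ^ (N + 1)) ^ 2 * ((1 - X)⁻¹ * (1 - X ^ 2)⁻¹) +
      σ * (X ^ (N + 1) * (1 - X)⁻¹) ^ 2) * (thetaTerm k *
      (1 + X ^ 2 * (X ^ k) ^ 4 - X * (X ^ k) ^ 2 - X ^ 3 * (X ^ k) ^ 6)) := by
  obtain ⟨j, rfl⟩ := Nat.exists_eq_add_of_le hk
  rw [mainTerm, linCoeff, quadCoeff, Nat.add_sub_cancel_left, pow_succ, pow_add]
  ring

/-- The 1-head. -/
def oneHead (M : ℚ⟦X⟧) : ℚ⟦X⟧ := eulerProduct * (1 + M * (1 - X)⁻¹)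

/-- The 2-head before simplification. -/
def twoHead (M n σ : ℚ⟦X⟧) : ℚ⟦X⟧ :=
  eulerProduct * (X + (M * X + n) * (1 - X)⁻¹ + M * (X * ((1 - X)⁻¹ * (1 - X ^ 2)⁻¹) - 1) +
    σ * (X * (1 - X)⁻¹) ^ 2)

/-- The three theta sums are `1`, `1` and `-X` times the Euler product, up to boundary terms that
lie beyond the precision after multiplication by their prefactors. -/
theorem X_pow_dvd_sum_mainTerm_sub (N : ℕ) (M n σ : ℚ⟦X⟧) :
    X ^ (3 * N + 1) ∣ ∑ k ∈ Finset.range (N + 1), mainTerm N k M n σ -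
      (eulerProduct + X ^ (N + 1) * oneHead M + X ^ (2 * N + 1) * twoHead M n σ) := by
  have h1 : X ^ (3 * N + 1) ∣ X ^ (N + 1) * (thetaTerm (N + 1) * ((X ^ (N + 1)) ^ 2 - X ^ (N + 1))) ∧
      X ^ (3 * N + 1) ∣ (X ^ (N + 1)) ^ 2 * (thetaTerm (N + 1) + thetaTerm (N + 1 + 1)) := by
    have h2 : N ≤ (N + 1).choose 2 := by
      rw [Nat.choose_succ_succ' N 1, Nat.choose_one_right]; omega
    have h3 := pow_dvd_pow (X : ℚ⟦X⟧)
      (show 3 * N + 1 ≤ 3 * (N + 1).choose 2 + (2 * N + 2) by omega)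
    rw [thetaTerm_succ (N + 1), thetaTerm]
    exact ⟨h3.trans ⟨(-1) ^ (N + 1) * (X ^ (N + 1) - 1), by ring⟩,
      h3.trans ⟨(-1) ^ (N + 1) * (1 - (X ^ (N + 1)) ^ 3), by ring⟩⟩
  obtain ⟨⟨δ, hδ⟩, ⟨γ, hγ⟩⟩ := h1
  obtain ⟨ε, hε⟩ := X_pow_dvd_eulerProduct_sub N
  have h2 : pentagonalSum (N + 1) = eulerProduct - X ^ (3 * N + 1) * ε := by
    linear_combination -hε
  rw [Finset.sum_congr rfl fun k hk => mainTerm_eq (Finset.mem_range_succ_iff.1 hk) M n σ,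
    Finset.sum_add_distrib, Finset.sum_sub_distrib, ← Finset.mul_sum, ← Finset.mul_sum,
    ← Finset.mul_sum, sum_theta_one, sum_theta_two, ← pentagonalSum, h2, oneHead, twoHead]
  rw [show 2 * N + 1 = N + N + 1 by ring, pow_succ X (N + N), pow_add X N N]
  generalize thetaTerm (N + 1) * ((X ^ (N + 1)) ^ 2 - X ^ (N + 1)) = d at hδ ⊢
  generalize thetaTerm (N + 1) + thetaTerm (N + 1 + 1) = c at hγ ⊢
  generalize (X ^ (3 * N + 1) : ℚ⟦X⟧) = Y at *
  generalize (1 - X : ℚ⟦X⟧)⁻¹ = i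
  generalize (1 - X ^ 2 : ℚ⟦X⟧)⁻¹ = j
  generalize eulerProduct = E
  rw [pow_succ X N] at hδ hγ ⊢
  generalize (X ^ N : ℚ⟦X⟧) = x at *
  refine ⟨-(1 + x * X + (x * X) ^ 2 + ((1 + x * X) * M + n * x) * (x * X) * i +
    M * ((x * X) ^ 2 * (i * j) - X * x ^ 2) + σ * X * (x * X * i) ^ 2) * ε -
    (((1 + x * X) * M + n * x) * i + 2 * (1 + X) * M * (x * X) * (i * j) +
      4 * σ * (x * X) * i ^ 2) * δ - (M * X * (i * j) + σ * i ^ 2) * γ, ?_⟩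
  linear_combination (-(((1 + x * X) * M + n * x) * i + 2 * (1 + X) * M * (x * X) * (i * j) +
      4 * σ * (x * X) * i ^ 2)) * hδ - (M * X * (i * j) + σ * i ^ 2) * hγ

end PretzelHead

namespace PretzelHead

/-! ### Comparison of a summand with its main term -/

open PowerSeries

theorem X_pow_dvd_summand_sub {N k : ℕ} (hk : k ≤ N) {α β Q : Fin 3 → ℚ⟦X⟧}
    (hQ : ∀ i, X ^ (3 * N + 1 - k) ∣
      Q i - (-1) ^ k * X ^ (k.choose 2) * (1 + (ratio N k - 1) * (α i + β i * X ^ N))) :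
    X ^ (3 * N + 1) ∣ (1 - X ^ (N + 1))⁻¹ * (X ^ (2 * k) * (1 - X ^ (2 * k + 1)) *
      (Q 0 * Q 1 * Q 2)) -
      mainTerm N k (∑ i, α i) (∑ i, β i) (α 0 * α 1 + α 0 * α 2 + α 1 * α 2) := by
  obtain ⟨r, hr⟩ := exists_ratio_eq hk
  have hN : (X ^ (N - k) * X ^ k : ℚ⟦X⟧) = X ^ N := by rw [← pow_add]; congr 1; omega
  have hN' : (X ^ (N - k) * X * X ^ k : ℚ⟦X⟧) = X ^ (N + 1) := by
    rw [pow_succ, ← hN]; ring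
  have h1 : (1 - X ^ (N - k) * X * X ^ k : ℚ⟦X⟧) * (1 - X ^ (N + 1))⁻¹ = 1 := by
    rw [hN']
    exact PowerSeries.mul_inv_cancel _ (by simp)
  obtain ⟨U, V, hUV⟩ := product_third_order X (X ^ (N - k)) (X ^ k) (linCoeff k) (quadCoeff k) r
    (1 - X ^ (N + 1))⁻¹ (X ^ k) α β h1
  choose D hD using hQ
  -- The remainder of `product_third_order`. Since `k - 1 ≤ k.choose 2`, the exponents `3 * k.choose
  -- 2 - k + 2` and `3 * k.choose 2 + 1`, counted from `3 * N`, are at least `1`.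
  have h2 : X ^ (3 * N + 1) ∣ thetaTerm k * ((X ^ k) ^ 2 - X * (X ^ k) ^ 4) *
      ((X ^ (N - k)) ^ 3 * X * (X * U + X ^ k * V)) := by
    have h4 : k - 1 ≤ k.choose 2 := by
      rcases k with - | k
      · simp
      · rw [Nat.choose_succ_succ' k 1, Nat.choose_one_right]; omega
    have h5 := pow_dvd_pow (X : ℚ⟦X⟧)
      (show 3 * N + 1 ≤ 3 * k.choose 2 + 2 * k + (3 * (N - k) + 2) by omega)
    have h6 := pow_dvd_pow (X : ℚ⟦X⟧)
      (show 3 * N + 1 ≤ 3 * k.choose 2 + 3 * k + (3 * (N - k) + 1) by omega)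
    have h7 := (dvd_add (h5.mul_right U) (h6.mul_right V)).mul_right
      ((-1) ^ k * (1 - X * (X ^ k) ^ 2))
    rw [thetaTerm]
    convert h7 using 1
    ring
  have h3 : X ^ (3 * N + 1) ∣ X ^ (3 * N + 1 - k) * (X ^ (2 * k) : ℚ⟦X⟧) := by
    rw [← pow_add]; exact pow_dvd_pow _ (by omega)
  rw [mainTerm, ← hN', ← hN]
  rw [← hN'] at hUV
  rw [hr, ← hN] at hD
  obtain ⟨ρ, hρ⟩ : ∃ ρ : Fin 3 → ℚ⟦X⟧, ∀ i, ρ i = 1 + (X ^ (N - k) * X * linCoeff k +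
    (X ^ (N - k)) ^ 2 * X * quadCoeff k + (X ^ (N - k)) ^ 3 * X ^ 2 * r) *
      (α i + β i * (X ^ (N - k) * X ^ k)) := ⟨_, fun _ => rfl⟩
  rw [← hρ, ← hρ, ← hρ] at hUV
  have hQ : ∀ i, Q i = (-1) ^ k * X ^ (k.choose 2) * ρ i + X ^ (3 * N + 1 - k) * D i := by
    intro i
    rw [hρ]
    linear_combination hD i
  have h7 : ((-1) ^ k * (-1) ^ k : ℚ⟦X⟧) = 1 := by rw [← mul_pow]; norm_num
  have h8 : thetaTerm k = (-1) ^ k * (-1) ^ k * (-1) ^ k * (X ^ (k.choose 2)) ^ 3 := by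
    rw [h7, thetaTerm, one_mul, pow_mul']
  rw [pow_succ X (2 * k)]
  generalize (1 - X ^ (N - k) * X * X ^ k : ℚ⟦X⟧)⁻¹ = g at *
  generalize hq : (fun i => (-1) ^ k * X ^ (k.choose 2) * ρ i : Fin 3 → ℚ⟦X⟧) = q
  have hQ' : ∀ i, Q i = q i + X ^ (3 * N + 1 - k) * D i := fun i => by rw [hQ i, ← hq]
  have h9 : q 0 * q 1 * q 2 = thetaTerm k * (ρ 0 * ρ 1 * ρ 2) := by rw [h8, ← hq]; ring
  have h10 := dvd_add h2 (h3.mul_right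
    (g * (1 - X ^ (2 * k) * X) * (D 0 * Q 1 * Q 2 + q 0 * D 1 * Q 2 + q 0 * q 1 * D 2)))
  convert h10 using 1
  have h11 : Q 0 * Q 1 * Q 2 = q 0 * q 1 * q 2 + X ^ (3 * N + 1 - k) *
      (D 0 * Q 1 * Q 2 + q 0 * D 1 * Q 2 + q 0 * q 1 * D 2) := by
    rw [hQ' 0, hQ' 1, hQ' 2]; ring
  rw [h11, h9]
  linear_combination (thetaTerm k * ((X ^ k) ^ 2 - X * (X ^ k) ^ 4)) * hUV

/-! ### Reading off the coefficients -/

theorem isTopExpansion_of_eq {L : Coeff} {P : ℚ⟦X⟧} (hP : 0 < coeff 0 P) {ε : ℤˣ} {s : ℤ}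
    (h : L = ((ε : ℤ) : Coeff) * A ^ s * ofX P) : IsTopExpansion L P := by
  have h1 : ∀ j, L.coeff j = ((ε : ℤ) : ℚ) * (ofX P).coeff (j - s) := by
    intro j
    have h2 : (A ^ s * ofX P).coeff j = (ofX P).coeff (j - s) := by
      rw [A, ← RatFunc.single_zpow, HahnSeries.coeff_single_mul, one_mul]
    rw [h, mul_assoc, ← h2]
    rcases Int.units_eq_one_or ε with rfl | rfl <;> simp
  refine ⟨hP, s, ε, fun k => ?_, fun j hj => ?_⟩
  · rw [h1, add_sub_cancel_left, coeff_ofX]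
  · rw [h1, coeff_ofX_eq_zero, mul_zero]
    intro k hk
    exact hj k (by omega)

/-- The windows `[0, N]`, `[N + 1, 2 N]` and `[2 N + 1, 3 N]` of coefficients all lie below the
precision `3 N + 1`. -/
theorem exists_heads {P : ℕ → ℚ⟦X⟧} {H H₁ H₂ : ℚ⟦X⟧}
    (h : ∀ N, X ^ (3 * N + 1) ∣ P N - (H + X ^ (N + 1) * H₁ + X ^ (2 * N + 1) * H₂)) :
    IsHead P H ∧ IsOneHead P H H₁ ∧ IsTwoHead P H H₁ H₂ := by
  have h0 : ∀ (a j : ℕ) (φ : ℚ⟦X⟧), j < a → coeff j (X ^ a * φ) = 0 :=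
    fun a j φ hj => by rw [coeff_X_pow_mul', if_neg (by omega)]
  choose D hD using h
  have h1 : ∀ N, P N = H + X ^ (N + 1) * H₁ + X ^ (2 * N + 1) * H₂ + X ^ (3 * N + 1) * D N :=
    fun N => by linear_combination hD N
  refine ⟨fun N k hk => ?_, fun N k hk => ?_, fun N k hk => ?_⟩
  · rw [h1, map_add, map_add, map_add, h0 _ _ _ (by omega), h0 _ _ _ (by omega),
      h0 _ _ _ (by omega), add_zero, add_zero, add_zero]
  · rw [show P N - H = X ^ (N + 1) * H₁ + X ^ (2 * N + 1) * H₂ + X ^ (3 * N + 1) * D N by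
      rw [h1]; ring, map_add, map_add, h0 (2 * N + 1) _ _ (by omega), h0 (3 * N + 1) _ _ (by omega),
      add_zero, add_zero, add_comm, coeff_X_pow_mul]
  · rw [show P N - H - X ^ (N + 1) * H₁ = X ^ (2 * N + 1) * H₂ + X ^ (3 * N + 1) * D N by
      rw [h1]; ring, map_add, h0 (3 * N + 1) _ _ (by omega), add_zero, add_comm, coeff_X_pow_mul]

theorem twoHead_eq_twoHeadFormula {a b c n m : ℕ} (ha : a ≤ 1) (hb : b ≤ 1) (hc : c ≤ 1)
    (h : n + m = a + b + c) :
    twoHead (a + b + c) n (a * b + a * c + b * c) = twoHeadFormula n m := by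
  have h2 := one_sub_X_sq_mul_inv
  rw [twoHead, twoHeadFormula, h, PowerSeries.mul_inv_rev, inv_one_sub_X]
  congr 1
  generalize (1 - X ^ 2 : ℚ⟦X⟧)⁻¹ = j at *
  -- For weights `0` and `1` the second symmetric function is a function of the sum, which is why
  -- `fPoly` depends on `n + m` only. In each case the two sides differ by a multiple of `(1 - X ^
  -- 2) * j = 1`.
  interval_cases a <;> interval_cases b <;> interval_cases c <;>
    simp only [Nat.cast_zero, Nat.cast_one, add_zero, zero_add, one_add_one_eq_two,
      Nat.reduceAdd, fPoly]
  · ring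
  · linear_combination ((1 - X ^ 2) * j + 1 - X * (1 + X) * j) * h2
  · linear_combination ((1 - X ^ 2) * j + 1 - X * (1 + X) * j) * h2
  · linear_combination 2 * ((1 - X ^ 2) * j + 1 - X * (1 + X) * j) * h2
  · linear_combination ((1 - X ^ 2) * j + 1 - X * (1 + X) * j) * h2
  · linear_combination 2 * ((1 - X ^ 2) * j + 1 - X * (1 + X) * j) * h2
  · linear_combination 2 * ((1 - X ^ 2) * j + 1 - X * (1 + X) * j) * h2
  · linear_combination 3 * ((1 - X ^ 2) * j + 1 - X * (1 + X) * j) * h2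

/-- The part of `devWeight` independent of the color. -/
def weightOne (p : ℕ) : ℕ := if 2 ≤ p then 1 else 0

/-- The coefficient of `X ^ N` in `devWeight`. -/
def weightTwo (p : ℕ) : ℕ := if p = 2 then 1 else 0

theorem weightOne_le_one (p : ℕ) : weightOne p ≤ 1 := by
  rw [weightOne]; split <;> simp

theorem devWeight_eq (N p : ℕ) :
    devWeight N p = (weightOne p : ℚ⟦X⟧) + (weightTwo p : ℚ⟦X⟧) * X ^ N := by
  match p with
  | 0 => simp [devWeight, weightOne, weightTwo]
  | 1 => simp [devWeight, weightOne, weightTwo]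
  | 2 => simp [devWeight, weightOne, weightTwo]
  | p + 3 =>
    rw [devWeight]
    · simp [weightOne, weightTwo]
    all_goals omega

theorem hasTwoHead_pretzel {p : Fin 3 → ℕ} (hp : ∀ i, 1 ≤ p i) (w : ℤ) :
    HasTwoHead (fun N => normalizedColoredJones N (pretzel p) w)
      (twoHead (∑ i, (weightOne (p i) : ℚ⟦X⟧)) (∑ i, (weightTwo (p i) : ℚ⟦X⟧))
        (weightOne (p 0) * weightOne (p 1) + weightOne (p 0) * weightOne (p 2) +
          weightOne (p 1) * weightOne (p 2))) := by
  choose Q hQ ε s hs using fun N => exists_normalizedColoredJones_eq N hp w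
  set P : ℕ → ℚ⟦X⟧ := fun N => (1 - X ^ (N + 1))⁻¹ * ∑ k ∈ Finset.range (N + 1),
        X ^ (2 * k) * (1 - X ^ (2 * k + 1)) * (Q N 0 k * Q N 1 k * Q N 2 k)
  have h1 : ∀ N, X ^ (3 * N + 1) ∣ P N - (eulerProduct +
      X ^ (N + 1) * oneHead (∑ i, (weightOne (p i) : ℚ⟦X⟧)) + X ^ (2 * N + 1) *
      twoHead (∑ i, (weightOne (p i) : ℚ⟦X⟧)) (∑ i, (weightTwo (p i) : ℚ⟦X⟧))
        (weightOne (p 0) * weightOne (p 1) + weightOne (p 0) * weightOne (p 2) +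
          weightOne (p 1) * weightOne (p 2))) := by
    intro N
    have h2 := Finset.dvd_sum fun k hk =>
      X_pow_dvd_summand_sub (Finset.mem_range_succ_iff.1 hk) (Q := fun i => Q N i k)
        (α := fun i => (weightOne (p i) : ℚ⟦X⟧)) (β := fun i => (weightTwo (p i) : ℚ⟦X⟧))
        fun i => by
          have := hQ N i k (Finset.mem_range_succ_iff.1 hk)
          rwa [devWeight_eq] at this
    rw [Finset.sum_sub_distrib, ← Finset.mul_sum] at h2
    have h3 := dvd_add h2 (X_pow_dvd_sum_mainTerm_sub N (∑ i, (weightOne (p i) : ℚ⟦X⟧))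
      (∑ i, (weightTwo (p i) : ℚ⟦X⟧)) (weightOne (p 0) * weightOne (p 1) +
        weightOne (p 0) * weightOne (p 2) + weightOne (p 1) * weightOne (p 2)))
    rwa [sub_add_sub_cancel] at h3
  refine ⟨P, fun N => isTopExpansion_of_eq ?_ (hs N), eulerProduct, _, exists_heads h1⟩
  -- The constant coefficient is that of the Euler product, namely `1`; this fixes the common sign.
  have h2 := (exists_heads h1).1 N 0 (by omega)
  have h3 := X_pow_dvd_iff.1 (X_pow_dvd_eulerProduct_sub 0) 0 (by omega)
  rw [h2]
  rw [map_sub, sub_eq_zero] at h3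
  rw [h3]
  simp [pentagonalSum, thetaTerm]

end PretzelHead

end

theorem theorem1p1 (p : Fin 3 → ℕ) (hp : ∀ i, 1 ≤ p i) (n m : ℕ)
    (hn : n = (Finset.univ.filter fun i => p i = 2).card)
    (hm : m = (Finset.univ.filter fun i => 3 ≤ p i).card)
    (w : ℤ) :
    PretzelHead.HasTwoHead
      (fun N => PretzelHead.normalizedColoredJones N (PretzelHead.pretzel p) w)
      (PretzelHead.twoHeadFormula n m) := by
  rw [Finset.card_filter] at hn hm
  -- The columns with at least two half-twists are those counted by `n` together with those counted
  -- by `m`.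
  have h1 : n + m = PretzelHead.weightOne (p 0) + PretzelHead.weightOne (p 1) +
      PretzelHead.weightOne (p 2) := by
    rw [hn, hm, ← Finset.sum_add_distrib, Fin.sum_univ_three]
    simp only [PretzelHead.weightOne]
    congr 1
    · congr 1 <;> split_ifs <;> omega
    · split_ifs <;> omega
  have h2 : ∑ i, (PretzelHead.weightTwo (p i) : PowerSeries ℚ) = n := by
    rw [hn, Nat.cast_sum]; rfl
  rw [← PretzelHead.twoHead_eq_twoHeadFormula (PretzelHead.weightOne_le_one _)
    (PretzelHead.weightOne_le_one _) (PretzelHead.weightOne_le_one _) h1, ← h2,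
    ← Fin.sum_univ_three fun i => (PretzelHead.weightOne (p i) : PowerSeries ℚ)]
  exact PretzelHead.hasTwoHead_pretzel hp w
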